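/- Let $V$ be a Minkowski plane, i.e. a two-dimensional real vector space with a norm $\|\cdot\|$, and let $[\cdot,\cdot]$ be a non-zero symplectic (alternating bilinear) form on $V$; area is normalised so that the parallelogram spanned by $x,y$ has area $|[x,y]|$. The antinorm is $\|x\|_a=\sup\{[y,x]:\|y\|=1\}$, with unit ball $I=\{x\in V:\|x\|_a\le 1\}$; an anticircle is the boundary of a disc $c+\rho I$ with $c\in V$, $\rho>0$. Let $n\ge 3$. An $n$-gon is a simple closed polygon $v_0v_1\dots v_{n-1}$, not necessarily convex, with $n$ distinct vertices, where angles equal to $\pi$ are permitted (so the regions bounded by $n$-gons are the regions bounded by simple polygons with at most $n$ proper corners). Its perimeter is $\sum_i\|v_{i+1}-v_i\|$ (indices modulo $n$), and its area is that of the closed region which it encloses. An $n$-gon is circumscribed about an anticircle if the region it encloses is convex and contains the disc bounded by the anticircle, and each of its sides lies on a supporting line of this disc. A Zenodorus $n$-gon is an $n$-gon circumscribed about some anticircle which has the smallest area among all $n$-gons circumscribed about the same anticircle. Then, for every $L$, the $n$-gons of largest area among all $n$-gons of perimeter $L$ (measured in the norm) are exactly the Zenodorus $n$-gons of perimeter $L$.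 -/

import Mathlib

open Module MeasureTheory

noncomputable section

namespace MinkowskiPlane

/-! A Minkowski plane is a two-dimensional real normed space `V`.  A symplectic form `[x, y]` on `V`
is a nonzero alternating form `ω`, with `[x, y] = ω ![x, y]`; it fixes the unit of area, namely the
parallelogram spanned by `x, y` has area `|ω ![x, y]|` (`AlternatingMap.measure_parallelepiped`). -/

section Antinorm

variable {V : Type*} [NormedAddCommGroup V] [NormedSpace ℝ V]

/-- The antinorm `‖x‖ₐ = sup {[y, x] : ‖y‖ = 1}`. -/
def antinorm (ω : V [⋀^Fin 2]→ₗ[ℝ] ℝ) (x : V) : ℝ :=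
  sSup {r : ℝ | ∃ y : V, ‖y‖ = 1 ∧ r = ω ![y, x]}

/-- The disc `c + ρ I` bounded by the anticircle of centre `c` and radius `ρ`, where `I` is the
unit ball of the antinorm. -/
def antidisc (ω : V [⋀^Fin 2]→ₗ[ℝ] ℝ) (c : V) (ρ : ℝ) : Set V :=
  {x : V | antinorm ω (x - c) ≤ ρ}

/-- A line supports a convex body `K` if it meets `K`, but not the interior of `K`. -/
def IsSupportingLine (l : AffineSubspace ℝ V) (K : Set V) : Prop :=
  ((l : Set V) ∩ K).Nonempty ∧ Disjoint (l : Set V) (interior K)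

end Antinorm

section Polygons

variable {V : Type*} [NormedAddCommGroup V] [NormedSpace ℝ V] {n : ℕ}

/-- A closed polygon `v₀ v₁ … vₙ₋₁ v₀` is simple if its vertices are distinct and two different
sides have no common point, except that consecutive sides share the vertex between them.
For `3 ≤ n` these are the `n`-gons.  A vertex may have angle `π`, so that the regions bounded
by simple polygons with `n` vertices are those bounded by polygons with at most `n` corners. -/
def IsSimple (P : Polygon V n) : Prop :=
  Function.Injective P.vertices ∧
    ∀ i j : Fin n, i ≠ j → ∀ x ∈ P.edgeSet ℝ i ∩ P.edgeSet ℝ j,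
      (j = finRotate n i ∧ x = P j) ∨ (i = finRotate n j ∧ x = P i)

/-- The closed region enclosed by a polygon: the closed curve itself together with the bounded
components of its complement. -/
def region (P : Polygon V n) : Set V :=
  P.boundary ℝ ∪
    {x | x ∉ P.boundary ℝ ∧ Bornology.IsBounded (connectedComponentIn (P.boundary ℝ)ᶜ x)}

/-- The perimeter of a polygon in the norm of the plane. -/
def perimeter (P : Polygon V n) : ℝ :=
  ∑ i : Fin n, ‖P (finRotate n i) - P i‖

/-- The line that contains the `i`-th side of a polygon. -/
def sideLine (P : Polygon V n) (i : Fin n) : AffineSubspace ℝ V :=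
  AffineSubspace.mk' (P i) (Submodule.span ℝ {P (finRotate n i) - P i})

/-- `P` is a convex `n`-gon circumscribed about the convex body `K`: it contains `K`, and each of
its sides lies on a supporting line of `K`. -/
structure IsCircumscribed (P : Polygon V n) (K : Set V) : Prop where
  isSimple : IsSimple P
  convex : Convex ℝ (region P)
  subset : K ⊆ region P
  supporting : ∀ i : Fin n, IsSupportingLine (sideLine P i) K

variable [MeasurableSpace V] [BorelSpace V] [FiniteDimensional ℝ V] [Fact (finrank ℝ V = 2)]

/-- The area enclosed by a polygon. -/
def area (ω : V [⋀^Fin 2]→ₗ[ℝ] ℝ) (P : Polygon V n) : ℝ :=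
  ω.measure.real (region P)

/-- A Zenodorus `n`-gon: a convex `n`-gon circumscribed about an anticircle which has the smallest
area among all `n`-gons circumscribed about this anticircle. -/
def IsZenodorus (ω : V [⋀^Fin 2]→ₗ[ℝ] ℝ) (P : Polygon V n) : Prop :=
  ∃ (c : V) (ρ : ℝ), 0 < ρ ∧ IsCircumscribed P (antidisc ω c ρ) ∧
    ∀ Q : Polygon V n, IsCircumscribed Q (antidisc ω c ρ) → area ω P ≤ area ω Q

end Polygons

end MinkowskiPlane

end

open Module MeasureTheory

noncomputable section

namespace MinkowskiPlane

open Set Metric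

/-! ### The bracket as a bilinear form -/

/-! The norm is the support function, with respect to the bracket, of the unit ball `I` of the
antinorm (`exists_antinorm_le_one`). Hence a line in the direction of `e` supports `c + ρ I` exactly
when `[x - c, e] = ± ρ ‖e‖` on it. Cutting a polygon circumscribed about `c + ρ I` into triangles
with apex `c` gives area `= ρ * perimeter / 2` (`IsCircumscribed.area_eq`).

Let `P` be any simple `n`-gon whose vertices span a hull `H` with interior. The corners of `H`, in
cyclic order, form a strictly convex cycle `w` of at most `n` points (`exists_convexCycle`). Its
perimeter is at most that of `P`: dropping points shortens a tour, and among all tours through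
points in convex position the convex order is the shortest (`ConvexCycle.perimeter_le`). Let `K` be
the polygon circumscribed about `I` with the outer normals of `w`, and `A` its area. The perimeter
of `w` is twice the mixed area of `H` and `K`, so Minkowski's inequality
(`IsSupportPolygon.minkowski`) gives `4 * area P * A ≤ 4 * area H * A ≤ (perimeter P) ^ 2`, and
equality in the mixed-area step makes `H` homothetic to `K`. This is `exists_isoperimetric`.

If `P` is a Zenodorus polygon about `c + ρ I` and `Q` has the same perimeter, then `area P ≤ ρ ^ 2 *
A` for the constant `A` of `Q`; with the inequality for `Q` and the area formula for `P` this yields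
`area Q ≤ area P`. Conversely, if `P` is maximal, comparing it with its own `K`, scaled to the
perimeter of `P`, forces equality throughout: the region of `P` is `H`, which is homothetic to `K`,
so `P` is circumscribed about an anticircle. It has the least area there, because on polygons
circumscribed about one anticircle area and perimeter are proportional.

Minkowski's inequality is proved for polygons with parallel sides only, by a discrete Picone
identity: the difference of `w` and a suitable homothetic copy of `K` has signed area equal to minus
a sum of nonnegative terms. Regions are handled without the Jordan curve theorem; all that is needed
is that the frontier of a planar convex body stays connected when a point is removed
(`IsSimple.boundary_subset_frontier`). -/

theorem update_pair_zero {V : Type*} (x y z : V) : Function.update ![x, y] 0 z = ![z, y] := by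
  ext i; fin_cases i <;> rfl

theorem update_pair_one {V : Type*} (x y z : V) : Function.update ![x, y] 1 z = ![x, z] := by
  ext i; fin_cases i <;> rfl

section Bracket

variable {V : Type*} [AddCommGroup V] [Module ℝ V]

/-- The alternating form `ω` as a bilinear map `[x, y]`. -/
def bracket (ω : V [⋀^Fin 2]→ₗ[ℝ] ℝ) : V →ₗ[ℝ] V →ₗ[ℝ] ℝ :=
  LinearMap.mk₂ ℝ (fun x y => ω ![x, y])
    (fun x x' y => by
      have := ω.map_update_add ![x, y] 0 x x'
      rwa [update_pair_zero, update_pair_zero, update_pair_zero] at this)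
    (fun c x y => by
      have := ω.map_update_smul ![x, y] 0 c x
      rwa [update_pair_zero, update_pair_zero] at this)
    (fun x y y' => by
      have := ω.map_update_add ![x, y] 1 y y'
      rwa [update_pair_one, update_pair_one, update_pair_one] at this)
    (fun c x y => by
      have := ω.map_update_smul ![x, y] 1 c y
      rwa [update_pair_one, update_pair_one] at this)

theorem bracket_apply (ω : V [⋀^Fin 2]→ₗ[ℝ] ℝ) (x y : V) : bracket ω x y = ω ![x, y] := rfl

/-- A nondegenerate alternating bilinear form on a plane, presented by the identities
that are used below. -/
structure IsAreaForm (B : V →ₗ[ℝ] V →ₗ[ℝ] ℝ) : Prop where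
  self : ∀ x, B x x = 0
  cyc : ∀ a b c : V, B a b • c + B b c • a + B c a • b = 0
  ne_zero : B ≠ 0

namespace IsAreaForm

variable {B : V →ₗ[ℝ] V →ₗ[ℝ] ℝ} (hB : IsAreaForm B)
include hB

theorem swap (x y : V) : B x y = -B y x := by
  have h := hB.self (x + y)
  simp only [map_add, LinearMap.add_apply, hB.self] at h
  linarith

/-- The linear relation between three vectors of the plane, paired with two further vectors. -/
theorem cyc_apply (a b c d : V) : B a b * B c d + B b c * B a d + B c a * B b d = 0 := by
  have h := congrArg (fun x => B x d) (hB.cyc a b c)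
  simpa using h

theorem exists_pair : ∃ a b, B a b = 1 := by
  by_contra! h
  refine hB.ne_zero (LinearMap.ext fun x => LinearMap.ext fun y => ?_)
  by_contra hxy
  refine h x ((B x y)⁻¹ • y) ?_
  have : B x y ≠ 0 := hxy
  simp [this]

/-- Vertices are compared through the two side lines that meet in them. In the cyclic relation for
`u`, `v`, `x - y` only the term `B u v • (x - y)` survives. -/
theorem eq_of_apply {u v x y : V} (huv : B u v ≠ 0) (h1 : B x u = B y u) (h2 : B x v = B y v) :
    x = y := by
  have h := hB.cyc u v (x - y)
  have e1 : B v (x - y) = 0 := by rw [hB.swap]; simp [h2]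
  have e2 : B (x - y) u = 0 := by simp [h1]
  rw [e1, e2] at h
  simp only [zero_smul, add_zero, smul_eq_zero, huv, false_or] at h
  exact sub_eq_zero.1 h

theorem eq_zero_of_forall {x : V} (h : ∀ y, B x y = 0) : x = 0 := by
  obtain ⟨a, b, hab⟩ := hB.exists_pair
  exact hB.eq_of_apply (u := a) (v := b) (by simp [hab]) (by simp [h]) (by simp [h])

theorem exists_ne_zero {x : V} (hx : x ≠ 0) : ∃ y, B x y ≠ 0 := by
  by_contra! h
  exact hx (hB.eq_zero_of_forall h)

/-- Every linear functional on the plane is a bracket. -/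
theorem exists_repr (g : V →ₗ[ℝ] ℝ) : ∃ d, ∀ x, g x = B d x := by
  obtain ⟨a, b, hab⟩ := hB.exists_pair
  -- The witness is read off by applying `g` to the cyclic relation for `a`, `b`, `x`.
  refine ⟨g b • a - g a • b, fun x => ?_⟩
  have h := congrArg g (hB.cyc a b x)
  simp only [map_add, map_smul, smul_eq_mul, map_zero, hab, one_mul] at h
  rw [hB.swap x a] at h
  simp only [map_sub, map_smul, LinearMap.sub_apply, LinearMap.smul_apply, smul_eq_mul]
  linarith

theorem exists_smul_of_eq_zero {x f : V} (hf : f ≠ 0) (h : B x f = 0) : ∃ a : ℝ, x = a • f := by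
  obtain ⟨y, hy⟩ := hB.exists_ne_zero hf
  refine ⟨B x y / B f y, ?_⟩
  have := hB.cyc x f y
  rw [h, zero_smul, zero_add, hB.swap y x, neg_smul, ← sub_eq_add_neg, sub_eq_zero] at this
  rw [div_eq_inv_mul, mul_smul, ← this, smul_smul, inv_mul_cancel₀ hy, one_smul]

/-- Coordinates of a vector with respect to two independent ones. -/
theorem decomp {u v : V} (huv : B u v ≠ 0) (d : V) :
    d = (B d v / B u v) • u + (B u d / B u v) • v := by
  refine hB.eq_of_apply huv ?_ ?_
  · simp only [map_add, map_smul, LinearMap.add_apply, LinearMap.smul_apply, smul_eq_mul, hB.self]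
    rw [hB.swap v u, hB.swap d u]
    field_simp
    ring
  · simp only [map_add, map_smul, LinearMap.add_apply, LinearMap.smul_apply, smul_eq_mul, hB.self]
    field_simp
    ring

/-- Coordinates of a vector in terms of its support numbers. -/
theorem eq_of_support {u v x : V} (huv : B u v ≠ 0) :
    x = (B u v)⁻¹ • (B x v • u - B x u • v) := by
  refine hB.eq_of_apply huv ?_ ?_
  · simp only [map_sub, map_smul, LinearMap.sub_apply, LinearMap.smul_apply, smul_eq_mul, hB.self]
    rw [hB.swap v u]
    field_simp
    ring
  · simp only [map_sub, map_smul, LinearMap.sub_apply, LinearMap.smul_apply, smul_eq_mul, hB.self]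
    field_simp
    ring

end IsAreaForm

end Bracket

section AreaForm

variable {V : Type*} [NormedAddCommGroup V] [NormedSpace ℝ V] [FiniteDimensional ℝ V]

theorem isAreaForm_bracket [Fact (finrank ℝ V = 2)] {ω : V [⋀^Fin 2]→ₗ[ℝ] ℝ} (hω : ω ≠ 0) :
    IsAreaForm (bracket ω) := by
  have hself : ∀ x, bracket ω x x = 0 := fun x => by
    rw [bracket_apply]
    exact ω.map_eq_zero_of_eq ![x, x] (i := 0) (j := 1) rfl (by decide)
  have hswap : ∀ x y, bracket ω x y = -bracket ω y x := fun x y => by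
    have h := hself (x + y)
    simp only [map_add, LinearMap.add_apply, hself] at h
    linarith
  refine ⟨hself, fun a b c => ?_, fun h => hω ?_⟩
  -- In coordinates the form is a multiple of the determinant, and the cyclic relation becomes a
  -- polynomial identity.
  · let b₀ := finBasisOfFinrankEq ℝ V (Fact.out : finrank ℝ V = 2)
    have hexp : ∀ x, x = b₀.repr x 0 • b₀ 0 + b₀.repr x 1 • b₀ 1 := fun x => by
      conv_lhs => rw [← b₀.sum_repr x, Fin.sum_univ_two]
    have hbr : ∀ x y, bracket ω x y =
        (b₀.repr x 0 * b₀.repr y 1 - b₀.repr x 1 * b₀.repr y 0) * bracket ω (b₀ 0) (b₀ 1) := by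
      intro x y
      conv_lhs => rw [hexp x, hexp y]
      simp only [map_add, map_smul, LinearMap.add_apply, LinearMap.smul_apply, smul_eq_mul, hself]
      rw [hswap (b₀ 1) (b₀ 0)]
      ring
    apply b₀.repr.injective
    ext i
    rw [hbr a b, hbr b c, hbr c a]
    fin_cases i <;> simp <;> ring
  · ext v
    have := LinearMap.congr_fun (LinearMap.congr_fun h (v 0)) (v 1)
    rw [bracket_apply] at this
    have hv : v = ![v 0, v 1] := by ext i; fin_cases i <;> rfl
    rw [hv]
    simpa using this

theorem continuous_bracket_left (B : V →ₗ[ℝ] V →ₗ[ℝ] ℝ) (d : V) : Continuous (fun x => B x d) :=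
  (B.flip d).continuous_of_finiteDimensional

end AreaForm

/-! ### The antinorm -/

section Antinorm

variable {V : Type*} [NormedAddCommGroup V] [NormedSpace ℝ V] [FiniteDimensional ℝ V]
variable (ω : V [⋀^Fin 2]→ₗ[ℝ] ℝ)

theorem exists_bracket_bound : ∃ C : ℝ, 0 ≤ C ∧ ∀ x y, bracket ω y x ≤ C * ‖y‖ * ‖x‖ := by
  let T : V →L[ℝ] V →L[ℝ] ℝ := LinearMap.toContinuousLinearMap
    ((LinearMap.toContinuousLinearMap : (V →ₗ[ℝ] ℝ) ≃ₗ[ℝ] (V →L[ℝ] ℝ)).toLinearMap ∘ₗ bracket ω)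
  refine ⟨‖T‖, norm_nonneg T, fun x y => ?_⟩
  exact (le_abs_self _).trans (T.le_opNorm₂ y x)

/-- Without this bound the supremum defining `antinorm` would take its default value `0`. -/
theorem antinorm_bddAbove (x : V) : BddAbove {r : ℝ | ∃ y : V, ‖y‖ = 1 ∧ r = ω ![y, x]} := by
  obtain ⟨C, -, hC⟩ := exists_bracket_bound ω
  refine ⟨C * ‖x‖, ?_⟩
  rintro r ⟨y, hy, rfl⟩
  have := hC x y
  rwa [hy, mul_one] at this

theorem bracket_le_antinorm (x y : V) : bracket ω y x ≤ ‖y‖ * antinorm ω x := by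
  rcases eq_or_ne y 0 with rfl | hy
  · simp
  have hy' : ‖y‖ ≠ 0 := norm_ne_zero_iff.2 hy
  have h : bracket ω (‖y‖⁻¹ • y) x ≤ antinorm ω x :=
    le_csSup (antinorm_bddAbove ω x) ⟨_, by simp [norm_smul, hy'], rfl⟩
  have hpos : 0 < ‖y‖ := norm_pos_iff.2 hy
  simp only [map_smul, LinearMap.smul_apply, smul_eq_mul] at h
  rwa [inv_mul_le_iff₀ hpos] at h

variable [Fact (finrank ℝ V = 2)]

theorem exists_norm_eq_one (V : Type*) [NormedAddCommGroup V] [NormedSpace ℝ V]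
    [Fact (finrank ℝ V = 2)] : ∃ y : V, ‖y‖ = 1 := by
  have h2 : finrank ℝ V = 2 := Fact.out
  have : Nontrivial V := nontrivial_of_finrank_pos (R := ℝ) (by omega)
  exact exists_norm_eq V zero_le_one

omit [FiniteDimensional ℝ V] in
theorem antinorm_le {x : V} {r : ℝ} (h : ∀ y, ‖y‖ = 1 → bracket ω y x ≤ r) :
    antinorm ω x ≤ r := by
  obtain ⟨y, hy⟩ := exists_norm_eq_one V
  refine csSup_le ⟨_, y, hy, rfl⟩ ?_
  rintro _ ⟨z, hz, rfl⟩
  exact h z hz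

theorem antinorm_add_le (x y : V) : antinorm ω (x + y) ≤ antinorm ω x + antinorm ω y := by
  refine antinorm_le ω fun z hz => ?_
  have h1 := bracket_le_antinorm ω x z
  have h2 := bracket_le_antinorm ω y z
  rw [hz, one_mul] at h1 h2
  rw [map_add]
  exact add_le_add h1 h2

theorem antinorm_nonneg (x : V) : 0 ≤ antinorm ω x := by
  obtain ⟨y, hy⟩ := exists_norm_eq_one V
  have h1 := bracket_le_antinorm ω x y
  have h2 := bracket_le_antinorm ω x (-y)
  simp only [norm_neg, map_neg, LinearMap.neg_apply, hy, one_mul] at h1 h2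
  linarith

theorem antinorm_smul_le (c : ℝ) (x : V) : antinorm ω (c • x) ≤ |c| * antinorm ω x := by
  refine antinorm_le ω fun z hz => ?_
  have h1 := bracket_le_antinorm ω x (c • z)
  rw [norm_smul, hz, mul_one, Real.norm_eq_abs] at h1
  simpa using h1

theorem antinorm_zero : antinorm ω 0 = 0 := by
  have := antinorm_smul_le ω 0 (0 : V)
  rw [zero_smul, abs_zero, zero_mul] at this
  exact le_antisymm this (antinorm_nonneg ω 0)

/-- The antinorm is at most a multiple of the norm, so by subadditivity a small norm ball around `x`
stays in the disc. The denominator `C + 1` avoids division by zero. -/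
theorem mem_interior_antidisc {c x : V} {ρ : ℝ} (h : antinorm ω (x - c) < ρ) :
    x ∈ interior (antidisc ω c ρ) := by
  obtain ⟨C, hC0, hC⟩ := exists_bracket_bound ω
  have hle : ∀ y : V, antinorm ω y ≤ C * ‖y‖ := fun y =>
    antinorm_le ω fun z hz => by simpa [hz] using hC y z
  rw [mem_interior_iff_mem_nhds, Metric.mem_nhds_iff]
  refine ⟨(ρ - antinorm ω (x - c)) / (C + 1), div_pos (by linarith) (by linarith), fun y hy => ?_⟩
  rw [mem_ball, dist_eq_norm, lt_div_iff₀ (by linarith)] at hy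
  have h1 := antinorm_add_le ω (x - c) (y - x)
  have h2 := hle (y - x)
  have h3 : x - c + (y - x) = y - c := by abel
  rw [h3] at h1
  change antinorm ω (y - c) ≤ ρ
  nlinarith [norm_nonneg (y - x)]

theorem center_mem_interior_antidisc (c : V) {ρ : ℝ} (hρ : 0 < ρ) :
    c ∈ interior (antidisc ω c ρ) :=
  mem_interior_antidisc ω (by simpa [antinorm_zero] using hρ)

variable {ω}

theorem bracket_le_of_mem_antidisc (hω : ω ≠ 0) {c x : V} {ρ : ℝ} (hx : x ∈ antidisc ω c ρ)
    (f : V) : bracket ω (x - c) f ≤ ρ * ‖f‖ := by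
  rw [(isAreaForm_bracket hω).swap]
  have := bracket_le_antinorm ω (x - c) (-f)
  simp only [norm_neg, map_neg, LinearMap.neg_apply] at this
  have hx' : antinorm ω (x - c) ≤ ρ := hx
  nlinarith [norm_nonneg f]

/-- The norm is the support function of the unit ball of the antinorm. -/
theorem exists_antinorm_le_one (hω : ω ≠ 0) (f : V) :
    ∃ p : V, antinorm ω p ≤ 1 ∧ bracket ω p f = ‖f‖ := by
  have hB := isAreaForm_bracket hω
  obtain ⟨g, hg, hgf⟩ := exists_dual_vector'' ℝ f
  -- The vector representing a norming functional of `f` is a point of the unit antidisc at which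
  -- `[·, f]` is largest.
  obtain ⟨d, hd⟩ := hB.exists_repr g.toLinearMap
  have hd' : ∀ x, g x = bracket ω d x := hd
  refine ⟨d, antinorm_le ω fun y hy => ?_, by rw [← hd', hgf]; rfl⟩
  rw [hB.swap, ← hd', ← map_neg]
  have h1 := (le_abs_self (g (-y))).trans (g.le_opNorm (-y))
  rw [norm_neg, hy, mul_one] at h1
  exact h1.trans hg

theorem mem_line_iff {v e x : V} (hω : ω ≠ 0) (he : e ≠ 0) :
    x ∈ AffineSubspace.mk' v (Submodule.span ℝ {e}) ↔ bracket ω (x - v) e = 0 := by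
  have hB := isAreaForm_bracket hω
  rw [AffineSubspace.mem_mk', Submodule.mem_span_singleton, vsub_eq_sub]
  constructor
  · rintro ⟨a, ha⟩
    rw [← ha]
    simp [hB.self]
  · intro h
    obtain ⟨a, ha⟩ := hB.exists_smul_of_eq_zero he h
    exact ⟨a, ha.symm⟩

/-- A line at distance `ρ ‖f‖` (measured by the bracket with `f`) from `c` supports the antidisc. -/
theorem isSupportingLine_of_bracket_eq (hω : ω ≠ 0) {c v e : V} {ρ : ℝ} (hρ : 0 < ρ)
    (he : e ≠ 0) (h : bracket ω (v - c) e = ρ * ‖e‖) :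
    IsSupportingLine (AffineSubspace.mk' v (Submodule.span ℝ {e})) (antidisc ω c ρ) := by
  have hB := isAreaForm_bracket hω
  constructor
  · obtain ⟨p, hp, hpe⟩ := exists_antinorm_le_one hω e
    refine ⟨c + ρ • p, (mem_line_iff hω he).2 ?_, ?_⟩
    · have : c + ρ • p - v = ρ • p - (v - c) := by abel
      rw [this, map_sub, LinearMap.sub_apply, h, map_smul, LinearMap.smul_apply, hpe, smul_eq_mul,
        sub_self]
    · change antinorm ω (c + ρ • p - c) ≤ ρ
      rw [add_sub_cancel_left]
      have := antinorm_smul_le ω ρ p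
      rw [abs_of_pos hρ] at this
      nlinarith
  · rw [Set.disjoint_left]
    intro x hx hxi
    have hx0 := (mem_line_iff hω he).1 hx
    have hxe : bracket ω (x - c) e = ρ * ‖e‖ := by
      rw [← h, ← sub_eq_zero, ← LinearMap.sub_apply, ← map_sub, ← hx0]
      congr 2
      abel
    -- An interior point of the disc on the line could be pushed slightly away from `c`, and `[· -
    -- c, e]` would exceed its maximum `ρ * ‖e‖` on the disc.
    have hcont : Filter.Tendsto (fun s : ℝ => c + (1 + s) • (x - c)) (nhds 0) (nhds x) := by
      have : Continuous (fun s : ℝ => c + (1 + s) • (x - c)) := by fun_prop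
      have h0 := this.tendsto 0
      simpa using h0
    have hev := hcont.eventually (mem_interior_iff_mem_nhds.1 hxi)
    have hev' : ∀ᶠ s : ℝ in nhdsWithin 0 (Ioi 0), c + (1 + s) • (x - c) ∈ antidisc ω c ρ :=
      hev.filter_mono nhdsWithin_le_nhds
    obtain ⟨s, hs, hs0⟩ := (hev'.and self_mem_nhdsWithin).exists
    have h1 := bracket_le_of_mem_antidisc hω hs e
    rw [add_sub_cancel_left, map_smul, LinearMap.smul_apply, hxe, smul_eq_mul] at h1
    have h2 : 0 < ρ * ‖e‖ := mul_pos hρ (norm_pos_iff.2 he)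
    have h3 : (0 : ℝ) < s := hs0
    nlinarith

/-- On the disc `[· - c, e]` stays between `-ρ * ‖e‖` and `ρ * ‖e‖`, and each value strictly between
is taken at an interior point `c + a • p`. The absolute value is needed because `e` alone does not
tell on which side of the line the disc lies. -/
theorem abs_bracket_of_isSupportingLine (hω : ω ≠ 0) {c v e : V} {ρ : ℝ} (he : e ≠ 0)
    (h : IsSupportingLine (AffineSubspace.mk' v (Submodule.span ℝ {e})) (antidisc ω c ρ)) :
    |bracket ω (v - c) e| = ρ * ‖e‖ := by
  have hB := isAreaForm_bracket hω
  have hepos : 0 < ‖e‖ := norm_pos_iff.2 he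
  apply le_antisymm
  · obtain ⟨x, hx, hxd⟩ := h.1
    have hx0 := (mem_line_iff hω he).1 hx
    have hxe : bracket ω (v - c) e = bracket ω (x - c) e := by
      have : x - c = (x - v) + (v - c) := by abel
      rw [this, map_add, LinearMap.add_apply, hx0, zero_add]
    rw [hxe, abs_le]
    have h1 := bracket_le_of_mem_antidisc hω hxd e
    have h2 := bracket_le_of_mem_antidisc hω hxd (-e)
    rw [map_neg, norm_neg] at h2
    exact ⟨by linarith, h1⟩
  · by_contra! hlt
    obtain ⟨p, hp, hpe⟩ := exists_antinorm_le_one hω e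
    set k := bracket ω (v - c) e
    have hdisj := Set.disjoint_left.1 h.2
    refine @hdisj (c + (k / ‖e‖) • p) ?_ ?_
    · refine (mem_line_iff hω he).2 ?_
      have : c + (k / ‖e‖) • p - v = (k / ‖e‖) • p - (v - c) := by abel
      rw [this, map_sub, LinearMap.sub_apply, map_smul, LinearMap.smul_apply, hpe, smul_eq_mul,
        div_mul_cancel₀ _ hepos.ne', sub_self]
    · refine mem_interior_antidisc ω ?_
      rw [add_sub_cancel_left]
      refine (antinorm_smul_le ω _ p).trans_lt ?_
      rw [abs_div, abs_of_pos hepos]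
      have h1 : |k| / ‖e‖ < ρ := by rwa [div_lt_iff₀ hepos]
      have h2 : 0 ≤ |k| / ‖e‖ := by positivity
      nlinarith [antinorm_nonneg ω p]

end Antinorm

/-! ### The region enclosed by a polygon -/

section Region

variable {V : Type*} [NormedAddCommGroup V] [NormedSpace ℝ V] {n : ℕ}

theorem edgeSet_eq_segment (P : Polygon V n) (i : Fin n) :
    P.edgeSet ℝ i = segment ℝ (P i) (P (finRotate n i)) :=
  affineSegment_eq_segment ℝ _ _

theorem isCompact_segment (a b : V) : IsCompact (segment ℝ a b) := by
  rw [segment_eq_image_lineMap]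
  exact isCompact_Icc.image AffineMap.lineMap_continuous

theorem isCompact_boundary (P : Polygon V n) : IsCompact (P.boundary ℝ) :=
  isCompact_iUnion fun i => by
    rw [edgeSet_eq_segment]
    exact isCompact_segment _ _

theorem edgeSet_subset_boundary (P : Polygon V n) (i : Fin n) : P.edgeSet ℝ i ⊆ P.boundary ℝ :=
  subset_iUnion _ i

theorem vertex_mem_boundary (P : Polygon V n) (i : Fin n) : P i ∈ P.boundary ℝ := by
  refine edgeSet_subset_boundary P i ?_
  rw [edgeSet_eq_segment]
  exact left_mem_segment _ _ _

theorem boundary_subset_of_convex (P : Polygon V n) {M : Set V} (hM : Convex ℝ M)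
    (h : ∀ i, P i ∈ M) : P.boundary ℝ ⊆ M := by
  refine iUnion_subset fun i => ?_
  rw [edgeSet_eq_segment]
  exact hM.segment_subset (h _) (h _)

theorem isCompact_hull (P : Polygon V n) : IsCompact (convexHull ℝ (range P.vertices)) :=
  (finite_range _).isCompact_convexHull ℝ

theorem boundary_subset_region (P : Polygon V n) : P.boundary ℝ ⊆ region P := subset_union_left

/-- A point outside the hull is strictly separated from it; the open half-plane beyond is connected,
misses the polygon and is unbounded, so the component of the point is unbounded. -/
theorem region_subset_hull (hn : 0 < n) (P : Polygon V n) :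
    region P ⊆ convexHull ℝ (range P.vertices) := by
  have hb : P.boundary ℝ ⊆ convexHull ℝ (range P.vertices) :=
    boundary_subset_of_convex P (convex_convexHull ℝ _)
      fun i => subset_convexHull ℝ _ (mem_range_self i)
  rintro x (hx | ⟨hx, hbd⟩)
  · exact hb hx
  by_contra hxH
  obtain ⟨g, u, hg, hgx⟩ := geometric_hahn_banach_closed_point (convex_convexHull ℝ _)
    (isCompact_hull P).isClosed hxH
  have h0 : g (P ⟨0, hn⟩) < u := hg _ (subset_convexHull ℝ _ (mem_range_self _))
  have hpre : IsPreconnected {y | u < g y} := (convex_halfSpace_gt g.isLinear u).isPreconnected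
  have hsub : {y | u < g y} ⊆ (P.boundary ℝ)ᶜ := fun y hy hyb => lt_asymm hy (hg y (hb hyb))
  have hbd' := hbd.subset (hpre.subset_connectedComponentIn hgx hsub)
  set d := x - P ⟨0, hn⟩
  have hd : 0 < g d := by
    rw [map_sub]
    linarith
  obtain ⟨C, hC⟩ := hbd'.exists_norm_le
  have hd0 : d ≠ 0 := fun h => by simp [h] at hd
  have hdn : 0 < ‖d‖ := norm_pos_iff.2 hd0
  -- The factor makes the norm of this point at least `|C| + 1`.
  have hmem : x + ((|C| + ‖x‖ + 1) / ‖d‖) • d ∈ {y | u < g y} := by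
    simp only [mem_ofPred_eq, map_add, map_smul, smul_eq_mul]
    have : 0 ≤ (|C| + ‖x‖ + 1) / ‖d‖ * g d := by positivity
    linarith
  have h1 := hC _ hmem
  have h2 := norm_sub_norm_le (((|C| + ‖x‖ + 1) / ‖d‖) • d) (-x)
  rw [sub_neg_eq_add, norm_neg, norm_smul, Real.norm_of_nonneg (by positivity),
    div_mul_cancel₀ _ hdn.ne', add_comm _ x] at h2
  linarith [le_abs_self C]

theorem isOpen_region_diff_boundary (P : Polygon V n) : IsOpen (region P \ P.boundary ℝ) := by
  have hopen : IsOpen (P.boundary ℝ)ᶜ := (isCompact_boundary P).isClosed.isOpen_compl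
  rw [isOpen_iff_mem_nhds]
  rintro x ⟨hx | ⟨hx, hbd⟩, hx'⟩
  · exact absurd hx hx'
  · refine Filter.mem_of_superset
      (connectedComponentIn_mem_nhds (hopen.mem_nhds hx)) fun y hy => ?_
    have hy' : y ∉ P.boundary ℝ := connectedComponentIn_subset _ _ hy
    exact ⟨Or.inr ⟨hy', by rwa [← connectedComponentIn_eq hy]⟩, hy'⟩

theorem isClosed_region (P : Polygon V n) : IsClosed (region P) := by
  have hopen : IsOpen (P.boundary ℝ)ᶜ := (isCompact_boundary P).isClosed.isOpen_compl
  rw [← isOpen_compl_iff, isOpen_iff_mem_nhds]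
  intro x hx
  have hxb : x ∉ P.boundary ℝ := fun h => hx (Or.inl h)
  refine Filter.mem_of_superset (connectedComponentIn_mem_nhds (hopen.mem_nhds hxb)) fun y hy => ?_
  rintro (h | ⟨-, h⟩)
  · exact connectedComponentIn_subset _ _ hy h
  · rw [← connectedComponentIn_eq hy] at h
    exact hx (Or.inr ⟨hxb, h⟩)

theorem isCompact_region (hn : 0 < n) (P : Polygon V n) : IsCompact (region P) :=
  (isCompact_hull P).of_isClosed_subset (isClosed_region P) (region_subset_hull hn P)

theorem frontier_region_subset (P : Polygon V n) : frontier (region P) ⊆ P.boundary ℝ := by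
  intro x hx
  by_contra hxb
  rw [(isClosed_region P).frontier_eq] at hx
  exact hx.2 (mem_interior.2 ⟨_, sdiff_subset, isOpen_region_diff_boundary P, hx.1, hxb⟩)

/-- The frontier separates the interior of `M` from its complement, so the component of an interior
point cannot leave the bounded set `M`; the other inclusion comes from the hull of the vertices. -/
theorem region_eq_of_boundary_eq_frontier (hn : 0 < n) {P : Polygon V n} {M : Set V}
    (hM : Convex ℝ M) (hMc : IsCompact M) (h : P.boundary ℝ = frontier M) : region P = M := by
  apply subset_antisymm
  · refine (region_subset_hull hn P).trans (convexHull_min ?_ hM)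
    rintro _ ⟨i, rfl⟩
    exact hMc.isClosed.frontier_subset (h ▸ vertex_mem_boundary P i)
  · intro x hx
    by_cases hxb : x ∈ P.boundary ℝ
    · exact Or.inl hxb
    refine Or.inr ⟨hxb, hMc.isBounded.subset (Subset.trans ?_ interior_subset)⟩
    have hxi : x ∈ interior M := by
      by_contra hxi
      exact hxb (h ▸ (hMc.isClosed.frontier_eq ▸ ⟨hx, hxi⟩))
    refine isPreconnected_connectedComponentIn.subset_left_of_subset_union isOpen_interior
      hMc.isClosed.isOpen_compl ?_ ?_ ⟨x, mem_connectedComponentIn hxb, hxi⟩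
    · exact disjoint_compl_right_iff_subset.2 interior_subset
    · intro y hy
      by_contra hy'
      rw [mem_union, not_or, notMem_compl_iff] at hy'
      exact connectedComponentIn_subset _ _ hy (h ▸ (hMc.isClosed.frontier_eq ▸ ⟨hy'.2, hy'.1⟩))

end Region

/-! ### Homotheties -/

section Scale

variable {V : Type*} [NormedAddCommGroup V] [NormedSpace ℝ V] {n : ℕ}

/-- The image of a polygon under a homothety. -/
def scale (s : ℝ) (P : Polygon V n) : Polygon V n := ⟨fun i => s • P i⟩

theorem scale_apply (s : ℝ) (P : Polygon V n) (i : Fin n) : scale s P i = s • P i := rfl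

theorem edgeSet_scale (s : ℝ) (P : Polygon V n) (i : Fin n) :
    (scale s P).edgeSet ℝ i = (fun x => s • x) '' P.edgeSet ℝ i := by
  rw [edgeSet_eq_segment, edgeSet_eq_segment]
  exact (image_segment ℝ (LinearMap.lsmul ℝ V s).toAffineMap _ _).symm

theorem boundary_scale (s : ℝ) (P : Polygon V n) :
    (scale s P).boundary ℝ = (fun x => s • x) '' P.boundary ℝ := by
  simp only [Polygon.boundary, edgeSet_scale, image_iUnion]

theorem isSimple_scale {s : ℝ} (hs : s ≠ 0) {P : Polygon V n} (hP : IsSimple P) :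
    IsSimple (scale s P) := by
  have hinj : Function.Injective (fun x : V => s • x) := smul_right_injective V hs
  refine ⟨hinj.comp hP.1, fun i j hij x hx => ?_⟩
  rw [edgeSet_scale, edgeSet_scale, ← image_inter hinj] at hx
  obtain ⟨y, hy, rfl⟩ := hx
  exact (hP.2 i j hij y hy).imp (fun h => ⟨h.1, by rw [h.2]; rfl⟩)
    (fun h => ⟨h.1, by rw [h.2]; rfl⟩)

theorem perimeter_scale {s : ℝ} (hs : 0 ≤ s) (P : Polygon V n) :
    perimeter (scale s P) = s * perimeter P := by
  simp only [perimeter, scale_apply, ← smul_sub, norm_smul, Real.norm_of_nonneg hs, Finset.mul_sum]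

theorem region_scale {s : ℝ} (hs : s ≠ 0) (P : Polygon V n) :
    region (scale s P) = (fun x => s • x) '' region P := by
  let h : V ≃ₜ V := Homeomorph.smulOfNeZero s hs
  have hb : (scale s P).boundary ℝ = h '' P.boundary ℝ := boundary_scale s P
  have hbd : ∀ A : Set V, Bornology.IsBounded (h '' A) ↔ Bornology.IsBounded A := by
    have key : ∀ (t : ℝ) (A : Set V), Bornology.IsBounded A →
        Bornology.IsBounded ((fun x => t • x) '' A) := by
      intro t A hA
      obtain ⟨C, hC⟩ := hA.exists_norm_le
      refine isBounded_iff_forall_norm_le.2 ⟨|t| * C, ?_⟩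
      rintro _ ⟨x, hx, rfl⟩
      simp only [norm_smul, Real.norm_eq_abs]
      exact mul_le_mul_of_nonneg_left (hC x hx) (abs_nonneg t)
    refine fun A => ⟨fun hA => ?_, key s A⟩
    have := key s⁻¹ _ hA
    rw [← image_comp] at this
    convert this
    rw [show ((fun x => s⁻¹ • x) ∘ ⇑h : V → V) = id from funext fun x => inv_smul_smul₀ hs x,
      image_id]
  change _ = h '' region P
  ext y
  obtain ⟨x, rfl⟩ := h.surjective y
  rw [h.injective.mem_set_image]
  have hxm : h x ∈ (scale s P).boundary ℝ ↔ x ∈ P.boundary ℝ := by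
    rw [hb, h.injective.mem_set_image]
  simp only [region, mem_union, mem_ofPred_eq, hxm]
  refine or_congr_right (and_congr_right fun hx => ?_)
  have key := hbd (connectedComponentIn (P.boundary ℝ)ᶜ x)
  rwa [h.image_connectedComponentIn (s := (P.boundary ℝ)ᶜ) hx, h.image_compl, ← hb] at key

end Scale

/-! ### Area of a convex body by decomposition into triangles -/

section Rays

variable {V : Type*} [NormedAddCommGroup V] [NormedSpace ℝ V]

/-- The last parameter for which the ray is still in the compact set gives a frontier point. -/
theorem exists_ray_mem_frontier {M : Set V} (hM : IsCompact M) {x u : V} (hx : x ∈ M)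
    (hu : u ≠ 0) : ∃ τ : ℝ, 0 ≤ τ ∧ x + τ • u ∈ frontier M := by
  have hcont : Continuous (fun τ : ℝ => x + τ • u) := by fun_prop
  have hun : 0 < ‖u‖ := norm_pos_iff.2 hu
  obtain ⟨C, hC⟩ := hM.isBounded.exists_norm_le
  have hbd : BddAbove {τ : ℝ | 0 ≤ τ ∧ x + τ • u ∈ M} := by
    refine ⟨(C + ‖x‖) / ‖u‖, ?_⟩
    rintro τ ⟨h0, h1⟩
    rw [le_div_iff₀ hun]
    have h2 := norm_sub_norm_le (τ • u) (-x)
    rw [sub_neg_eq_add, add_comm _ x, norm_neg, norm_smul, Real.norm_of_nonneg h0] at h2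
    linarith [hC _ h1]
  have hcl : IsClosed {τ : ℝ | 0 ≤ τ ∧ x + τ • u ∈ M} :=
    isClosed_Ici.inter (hM.isClosed.preimage hcont)
  have hmem := hcl.csSup_mem ⟨0, le_rfl, by simpa using hx⟩ hbd
  set σ := sSup {τ : ℝ | 0 ≤ τ ∧ x + τ • u ∈ M}
  refine ⟨σ, hmem.1, ?_⟩
  rw [hM.isClosed.frontier_eq]
  refine ⟨hmem.2, fun hint => ?_⟩
  have hev : ∀ᶠ τ in nhdsWithin σ (Ioi σ), x + τ • u ∈ M :=
    ((hcont.tendsto σ).eventually (mem_interior_iff_mem_nhds.1 hint)).filter_mono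
      nhdsWithin_le_nhds
  obtain ⟨τ, h1, h2⟩ := (hev.and self_mem_nhdsWithin).exists
  have h2' : σ < τ := h2
  exact absurd (le_csSup hbd ⟨hmem.1.trans h2'.le, h1⟩) (not_le.2 h2')

/-- The union of the segments from `c` to the points of `S`. -/
def coneOver (c : V) (S : Set V) : Set V :=
  (fun q : ℝ × V => c + q.1 • (q.2 - c)) '' (Icc 0 1 ×ˢ S)

theorem isCompact_coneOver (c : V) {S : Set V} (hS : IsCompact S) : IsCompact (coneOver c S) :=
  (isCompact_Icc.prod hS).image (by fun_prop)

theorem coneOver_subset {M : Set V} (hM : Convex ℝ M) {c : V} (hc : c ∈ M) {S : Set V}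
    (hS : S ⊆ M) : coneOver c S ⊆ M := by
  rintro _ ⟨⟨s, p⟩, ⟨hs, hp⟩, rfl⟩
  exact hM.add_smul_sub_mem hc (hS hp) hs

theorem subset_coneOver_frontier {M : Set V} (hM : IsCompact M) {c : V} (hc : c ∈ interior M)
    [Nontrivial V] : M ⊆ coneOver c (frontier M) := by
  intro x hx
  have hcM := interior_subset hc
  rcases eq_or_ne x c with rfl | hxc
  · obtain ⟨u, hu⟩ := exists_ne (0 : V)
    obtain ⟨τ, -, h⟩ := exists_ray_mem_frontier hM hcM hu
    exact ⟨(0, _), ⟨⟨le_rfl, zero_le_one⟩, h⟩, by simp⟩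
  · obtain ⟨τ, hτ, h⟩ := exists_ray_mem_frontier hM hx (sub_ne_zero.2 hxc)
    have h1 : (0 : ℝ) < 1 + τ := by linarith
    refine ⟨((1 + τ)⁻¹, _), ⟨⟨by positivity, inv_le_one_of_one_le₀ (by linarith)⟩, h⟩, ?_⟩
    have : x + τ • (x - c) - c = (1 + τ) • (x - c) := by
      rw [add_smul, one_smul]
      abel
    simp only [this, smul_smul, inv_mul_cancel₀ h1.ne', one_smul, add_sub_cancel]

/-- A ray from an interior point meets the frontier at most once. -/
theorem eq_of_ray_frontier {M : Set V} (hM : Convex ℝ M) (hMc : IsClosed M) {c p q : V}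
    (hc : c ∈ interior M) (hp : p ∈ frontier M) (hq : q ∈ frontier M) {s t : ℝ} (hs : 0 < s)
    (ht : 0 < t) (h : s • (p - c) = t • (q - c)) : p = q := by
  have key : ∀ {p q : V} {s t : ℝ}, p ∈ frontier M → q ∈ frontier M → 0 < s → 0 < t →
      s • (p - c) = t • (q - c) → ¬ s < t := by
    intro p q s t hp hq hs ht h hst
    rw [hMc.frontier_eq] at hp hq
    refine hq.2 ?_
    -- If `s < t`, then `q` lies strictly between `c` and `p`, hence in the interior.
    have hcomb := hM.combo_self_interior_mem_interior hp.1 hc (a := s / t) (b := 1 - s / t)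
      (by positivity) (by rw [sub_pos, div_lt_one ht]; exact hst) (by ring)
    convert hcomb
    have h2 : q - c = (s / t) • (p - c) := by
      rw [div_eq_inv_mul, mul_smul, h, smul_smul, inv_mul_cancel₀ ht.ne', one_smul]
    rw [← sub_add_cancel q c, h2, smul_sub, sub_smul, one_smul]
    abel
  have hst : s = t := le_antisymm (not_lt.1 (key hq hp ht hs h.symm)) (not_lt.1 (key hp hq hs ht h))
  subst hst
  exact sub_left_injective (smul_right_injective V hs.ne' h)

/-- A ray from `c` meets the frontier only once, so a common point other than `c` sits over a common
point of `S` and `T`. Triangles over different sides therefore overlap in a null set. -/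
theorem coneOver_inter_subset {M : Set V} (hM : Convex ℝ M) (hMc : IsClosed M) {c : V}
    (hc : c ∈ interior M) {S T : Set V} (hS : S ⊆ frontier M) (hT : T ⊆ frontier M) :
    coneOver c S ∩ coneOver c T ⊆ insert c (coneOver c (S ∩ T)) := by
  rintro x ⟨⟨⟨s, p⟩, ⟨hs, hp⟩, rfl⟩, ⟨⟨t, q⟩, ⟨ht, hq⟩, hx⟩⟩
  simp only at hs ht hp hq hx ⊢
  have hx' : s • (p - c) = t • (q - c) := (add_left_cancel hx).symm
  rcases hs.1.eq_or_lt with h | hs0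
  · left
    simp [← h]
  rcases ht.1.eq_or_lt with h | ht0
  · left
    rw [hx', ← h]
    simp
  · right
    have := eq_of_ray_frontier hM hMc hc (hS hp) (hT hq) hs0 ht0 hx'
    exact ⟨(s, p), ⟨hs, hp, this ▸ hq⟩, rfl⟩

theorem mem_coneOver_segment {c a b x : V} : x ∈ coneOver c (segment ℝ a b) ↔
    ∃ s t : ℝ, 0 ≤ s ∧ 0 ≤ t ∧ s + t ≤ 1 ∧ x = c + (s • (a - c) + t • (b - c)) := by
  constructor
  · rintro ⟨⟨r, p⟩, ⟨hr, s, t, hs, ht, hst, rfl⟩, rfl⟩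
    refine ⟨r * s, r * t, mul_nonneg hr.1 hs, mul_nonneg hr.1 ht, ?_, ?_⟩
    · rw [← mul_add, hst, mul_one]
      exact hr.2
    · simp only
      congr 1
      have : s • a + t • b - c = s • (a - c) + t • (b - c) := by
        have hc : c = (s + t) • c := by rw [hst, one_smul]
        conv_lhs => rw [hc]
        rw [add_smul, smul_sub, smul_sub]
        abel
      rw [this, smul_add, mul_smul, mul_smul]
  · rintro ⟨s, t, hs, ht, hst, rfl⟩
    rcases (add_nonneg hs ht).eq_or_lt with h | h
    · have hs0 : s = 0 := by linarith
      have ht0 : t = 0 := by linarith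
      exact ⟨(0, a), ⟨⟨le_rfl, zero_le_one⟩, left_mem_segment _ _ _⟩, by simp [hs0, ht0]⟩
    · refine ⟨(s + t, (s / (s + t)) • a + (t / (s + t)) • b), ⟨⟨h.le, hst⟩, s / (s + t),
        t / (s + t), by positivity, by positivity, by field_simp, rfl⟩, ?_⟩
      simp only
      congr 1
      rw [smul_sub, smul_add, smul_smul, smul_smul, mul_div_cancel₀ _ h.ne', mul_div_cancel₀ _ h.ne',
        add_smul, smul_sub, smul_sub]
      abel

theorem nontrivial_of_fact [Fact (finrank ℝ V = 2)] : Nontrivial V :=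
  nontrivial_of_finrank_pos (R := ℝ) (by rw [(Fact.out : finrank ℝ V = 2)]; norm_num)

end Rays

/-! ### Measure of triangles and of convex bodies cut into triangles. -/

section Area

variable {V : Type*} [NormedAddCommGroup V] [NormedSpace ℝ V] [FiniteDimensional ℝ V]
  [MeasurableSpace V] [BorelSpace V] [Fact (finrank ℝ V = 2)] {ω : V [⋀^Fin 2]→ₗ[ℝ] ℝ}

theorem isAddHaarMeasure_measure (hω : ω ≠ 0) : ω.measure.IsAddHaarMeasure := by
  rw [AlternatingMap.measure]
  refine Measure.IsAddHaarMeasure.nnreal_smul _ fun h => hω ?_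
  rw [ω.eq_smul_basis_det (finBasisOfFinrankEq ℝ V Fact.out), nnnorm_eq_zero.1 h, zero_smul]

theorem measure_line_eq_zero (hω : ω ≠ 0) {d : V} (hd : d ≠ 0) (r : ℝ) :
    ω.measure {x | bracket ω d x = r} = 0 := by
  have := isAddHaarMeasure_measure hω
  by_cases hne : ∃ x₀, bracket ω d x₀ = r
  · obtain ⟨x₀, hx₀⟩ := hne
    have hker : ω.measure (LinearMap.ker (bracket ω d) : Set V) = 0 := by
      refine Measure.addHaar_submodule _ _ fun htop => ?_
      refine hd ((isAreaForm_bracket hω).eq_zero_of_forall fun y => ?_)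
      have : y ∈ LinearMap.ker (bracket ω d) := htop ▸ Submodule.mem_top
      exact this
    rw [← measure_preimage_add ω.measure x₀]
    convert hker using 2
    ext x
    simp [hx₀]
  · have : {x | bracket ω d x = r} = ∅ := by
      ext x
      simp only [mem_ofPred_eq, mem_empty_iff_false, iff_false]
      exact fun h => hne ⟨x, h⟩
    rw [this, measure_empty]

theorem measure_coneOver_singleton (hω : ω ≠ 0) (c p : V) :
    ω.measure (insert c (coneOver c {p})) = 0 := by
  have hB := isAreaForm_bracket hω
  have := nontrivial_of_fact (V := V)
  obtain ⟨d, hd, h0⟩ : ∃ d, d ≠ 0 ∧ bracket ω d (p - c) = 0 := by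
    rcases eq_or_ne (p - c) 0 with h | h
    · obtain ⟨u, hu⟩ := exists_ne (0 : V)
      exact ⟨u, hu, by simp [h]⟩
    · exact ⟨_, h, hB.self _⟩
  refine measure_mono_null ?_ (measure_line_eq_zero hω hd (bracket ω d c))
  rintro x (rfl | ⟨⟨s, q⟩, ⟨-, hq⟩, rfl⟩)
  · rfl
  · obtain rfl : q = p := hq
    simp [h0]

theorem measure_coneOver_finite (hω : ω ≠ 0) (c : V) {S : Set V} (hS : S.Finite) :
    ω.measure (insert c (coneOver c S)) = 0 := by
  have hc : ω.measure {c} = 0 := measure_mono_null (by simp) (measure_coneOver_singleton hω c c)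
  refine measure_mono_null (t := {c} ∪ ⋃ p ∈ S, insert c (coneOver c {p})) ?_
    (measure_union_null hc ((measure_biUnion_null_iff hS.countable).2
      fun p _ => measure_coneOver_singleton hω c p))
  rintro x (rfl | ⟨⟨s, q⟩, ⟨hs, hq⟩, rfl⟩)
  · left; rfl
  · right
    exact mem_biUnion hq (Or.inr ⟨(s, q), ⟨hs, rfl⟩, rfl⟩)

theorem measure_segment (hω : ω ≠ 0) (a b : V) : ω.measure (segment ℝ a b) = 0 := by
  refine measure_mono_null ?_ (measure_coneOver_singleton hω a b)
  intro x hx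
  rw [segment_eq_image'] at hx
  obtain ⟨s, hs, rfl⟩ := hx
  exact Or.inr ⟨(s, b), ⟨hs, rfl⟩, rfl⟩

theorem interior_segment (hω : ω ≠ 0) (a b : V) : interior (segment ℝ a b) = ∅ := by
  have := isAddHaarMeasure_measure hω
  exact Measure.interior_eq_empty_of_null (measure_segment hω a b)

/-- The diagonal cuts the parallelogram spanned by `u` and `v` into this triangle and its reflection
in the centre; both have the same measure and they overlap on the line through `u` and `v` only. In
the degenerate case the triangle lies in a line. -/
theorem measure_coneOver_zero (hω : ω ≠ 0) (u v : V) :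
    ω.measure.real (coneOver 0 (segment ℝ u v)) = |bracket ω u v| / 2 := by
  have hB := isAreaForm_bracket hω
  have := isAddHaarMeasure_measure hω
  have hntr := nontrivial_of_fact (V := V)
  have hmem : ∀ {x}, x ∈ coneOver 0 (segment ℝ u v) ↔
      ∃ s t : ℝ, 0 ≤ s ∧ 0 ≤ t ∧ s + t ≤ 1 ∧ x = s • u + t • v := by
    intro x
    simpa using mem_coneOver_segment (c := 0) (a := u) (b := v) (x := x)
  set T := coneOver (0 : V) (segment ℝ u v)
  have hT : IsCompact T := isCompact_coneOver _ (isCompact_segment u v)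
  rcases eq_or_ne (bracket ω u v) 0 with h0 | h0
  · obtain ⟨d, hd, h1, h2⟩ : ∃ d, d ≠ 0 ∧ bracket ω d u = 0 ∧ bracket ω d v = 0 := by
      rcases eq_or_ne u 0 with rfl | hu
      · rcases eq_or_ne v 0 with rfl | hv
        · obtain ⟨w, hw⟩ := exists_ne (0 : V)
          exact ⟨w, hw, by simp, by simp⟩
        · exact ⟨v, hv, by simp, hB.self v⟩
      · exact ⟨u, hu, hB.self u, h0⟩
    have hz : ω.measure T = 0 := by
      refine measure_mono_null ?_ (measure_line_eq_zero hω hd 0)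
      intro x hx
      obtain ⟨s, t, -, -, -, rfl⟩ := hmem.1 hx
      simp [h1, h2]
    simp [Measure.real, hz, h0]
  have hd : v - u ≠ 0 := fun h => h0 (by rw [sub_eq_zero.1 h, hB.self])
  let T' : Set V := (fun x => -(u + v) + x) ⁻¹' (-T)
  have hT' : ω.measure T' = ω.measure T := by
    rw [measure_preimage_add, Measure.measure_neg]
  have hmem' : ∀ {x}, x ∈ T' ↔ u + v - x ∈ T := by
    intro x
    change -(-(u + v) + x) ∈ T ↔ _
    rw [neg_add, neg_neg, ← sub_eq_add_neg]
  have hmeas : NullMeasurableSet T' ω.measure := by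
    have : IsClosed T' := hT.isClosed.neg.preimage (by fun_prop)
    exact this.measurableSet.nullMeasurableSet
  have hpar : parallelepiped ![u, v] = T ∪ T' := by
    ext x
    rw [mem_parallelepiped_iff, mem_union, hmem', hmem, hmem]
    constructor
    · rintro ⟨t, ht, rfl⟩
      have h00 := ht.1 0
      have h01 := ht.1 1
      have h10 := ht.2 0
      have h11 := ht.2 1
      simp only [Pi.zero_apply, Pi.one_apply] at h00 h01 h10 h11
      rcases le_total (t 0 + t 1) 1 with h | h
      · left
        exact ⟨t 0, t 1, h00, h01, h, by simp [Fin.sum_univ_two]⟩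
      · right
        refine ⟨1 - t 0, 1 - t 1, by linarith, by linarith, by linarith, ?_⟩
        simp only [Fin.sum_univ_two, Matrix.cons_val_zero, Matrix.cons_val_one, sub_smul, one_smul]
        abel
    · rintro (⟨s, t, hs, ht, hst, rfl⟩ | ⟨s, t, hs, ht, hst, hx⟩)
      · refine ⟨![s, t], ⟨fun i => ?_, fun i => ?_⟩, by simp [Fin.sum_univ_two]⟩ <;>
          fin_cases i <;> simp <;> linarith
      · refine ⟨![1 - s, 1 - t], ⟨fun i => ?_, fun i => ?_⟩, ?_⟩
        · fin_cases i <;> simp <;> linarith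
        · fin_cases i <;> simp <;> linarith
        · rw [sub_eq_iff_eq_add, ← sub_eq_iff_eq_add'] at hx
          rw [← hx]
          simp only [Fin.sum_univ_two, Matrix.cons_val_zero, Matrix.cons_val_one, sub_smul,
            one_smul]
          abel
  have hdisj : AEDisjoint ω.measure T T' := by
    refine measure_mono_null ?_ (measure_line_eq_zero hω hd (bracket ω v u))
    rintro x ⟨hx, hx'⟩
    obtain ⟨s, t, hs, ht, hst, rfl⟩ := hmem.1 hx
    obtain ⟨s', t', hs', ht', hst', hx'⟩ := hmem.1 (hmem'.1 hx')
    have e1 := congrArg (fun y => bracket ω (v - u) y) hx'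
    simp only [map_add, map_sub, map_smul, LinearMap.sub_apply, smul_eq_mul, hB.self,
      mem_ofPred_eq] at e1 ⊢
    rw [hB.swap v u] at e1 ⊢
    have hne : bracket ω u v ≠ 0 := h0
    have e2 : (s + t + s' + t' - 2) * bracket ω u v = 0 := by linarith
    have e3 : s + t + s' + t' - 2 = 0 := by
      rcases mul_eq_zero.1 e2 with h | h
      · exact h
      · exact absurd h hne
    have e4 : s + t = 1 := by linarith
    rw [show s = 1 - t by linarith]
    ring
  have htot := ω.measure_parallelepiped ![u, v]
  rw [hpar, measure_union₀ hmeas hdisj, hT'] at htot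
  have h2 := congrArg ENNReal.toReal htot
  rw [ENNReal.toReal_add hT.measure_ne_top hT.measure_ne_top,
    ENNReal.toReal_ofReal (abs_nonneg _)] at h2
  change (ω.measure T).toReal = _
  rw [bracket_apply]
  linarith

theorem measure_coneOver_segment (hω : ω ≠ 0) (c a b : V) :
    ω.measure.real (coneOver c (segment ℝ a b)) = |bracket ω (a - c) (b - c)| / 2 := by
  rw [← measure_coneOver_zero hω, measureReal_def, measureReal_def,
    ← measure_preimage_add ω.measure c]
  congr 2
  ext x
  rw [mem_preimage, mem_coneOver_segment, mem_coneOver_segment]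
  simp

/-- The area of a convex body whose frontier is covered by finitely many segments without
overlap, seen from an interior point. -/
theorem measure_eq_sum_triangles (hω : ω ≠ 0) {M : Set V} (hM : Convex ℝ M) (hMc : IsCompact M)
    {c : V} (hc : c ∈ interior M) {ι : Type*} (s : Finset ι) (a b : ι → V)
    (hcov : frontier M ⊆ ⋃ i ∈ s, segment ℝ (a i) (b i))
    (hsub : ∀ i ∈ s, segment ℝ (a i) (b i) ⊆ frontier M)
    (hdisj : ∀ i ∈ s, ∀ j ∈ s, i ≠ j →
      (segment ℝ (a i) (b i) ∩ segment ℝ (a j) (b j)).Finite) :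
    ω.measure.real M = (∑ i ∈ s, |bracket ω (a i - c) (b i - c)|) / 2 := by
  have := nontrivial_of_fact (V := V)
  have hfr : frontier M ⊆ M := hMc.isClosed.frontier_subset
  have hunion : M = ⋃ i ∈ s, coneOver c (segment ℝ (a i) (b i)) := by
    apply subset_antisymm
    · intro x hx
      obtain ⟨⟨r, p⟩, ⟨hr, hp⟩, rfl⟩ := subset_coneOver_frontier hMc hc hx
      obtain ⟨i, hi, hpi⟩ := mem_iUnion₂.1 (hcov hp)
      exact mem_iUnion₂.2 ⟨i, hi, (r, p), ⟨hr, hpi⟩, rfl⟩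
    · exact iUnion₂_subset fun i hi =>
        coneOver_subset hM (interior_subset hc) ((hsub i hi).trans hfr)
  have hcpt : ∀ i, IsCompact (coneOver c (segment ℝ (a i) (b i))) := fun i =>
    isCompact_coneOver _ (isCompact_segment _ _)
  have hmeas := measure_biUnion_finset₀ (μ := ω.measure) (s := s)
    (f := fun i => coneOver c (segment ℝ (a i) (b i)))
    (fun i hi j hj hij => measure_mono_null
      (coneOver_inter_subset hM hMc.isClosed hc (hsub i hi) (hsub j hj))
      (measure_coneOver_finite hω c (hdisj i hi j hj hij)))
    (fun i _ => (hcpt i).isClosed.measurableSet.nullMeasurableSet)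
  rw [← hunion] at hmeas
  rw [measureReal_def, hmeas, ENNReal.toReal_sum fun i _ => (hcpt i).measure_ne_top,
    Finset.sum_div]
  exact Finset.sum_congr rfl fun i _ => measure_coneOver_segment hω c _ _

end Area

/-! ### Cyclic indexing of the vertices by natural numbers -/

section Vtx

variable {V : Type*} {n : ℕ}

/-- The vertices of a polygon, indexed periodically by the natural numbers. -/
def vtx (hn : 0 < n) (P : Polygon V n) (k : ℕ) : V := P ⟨k % n, Nat.mod_lt _ hn⟩

theorem finRotate_eq (hn : 0 < n) (i : Fin n) :
    finRotate n i = ⟨(i + 1) % n, Nat.mod_lt _ hn⟩ := by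
  obtain ⟨m, rfl⟩ := Nat.exists_eq_succ_of_ne_zero hn.ne'
  rw [finRotate_apply]
  ext
  rw [Fin.val_add]
  simp

theorem vtx_add (hn : 0 < n) (P : Polygon V n) (k : ℕ) : vtx hn P (k + n) = vtx hn P k := by
  simp [vtx]

theorem vtx_fin (hn : 0 < n) (P : Polygon V n) (i : Fin n) : vtx hn P i = P i := by
  simp [vtx, Nat.mod_eq_of_lt i.2]

theorem vtx_succ_fin (hn : 0 < n) (P : Polygon V n) (i : Fin n) :
    vtx hn P (i + 1) = P (finRotate n i) := by
  rw [finRotate_eq hn]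
  rfl

variable [NormedAddCommGroup V] [NormedSpace ℝ V]

/-- The sides of a polygon, indexed periodically by the natural numbers. -/
def side (hn : 0 < n) (P : Polygon V n) (k : ℕ) : Set V :=
  segment ℝ (vtx hn P k) (vtx hn P (k + 1))

theorem edgeSet_mod (hn : 0 < n) (P : Polygon V n) (k : ℕ) :
    P.edgeSet ℝ ⟨k % n, Nat.mod_lt _ hn⟩ = side hn P k := by
  rw [edgeSet_eq_segment, finRotate_eq hn]
  simp [side, vtx]

theorem edgeSet_fin (hn : 0 < n) (P : Polygon V n) (i : Fin n) : P.edgeSet ℝ i = side hn P i := by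
  rw [← edgeSet_mod hn]
  congr
  exact Fin.ext (Nat.mod_eq_of_lt i.2).symm

theorem IsSimple.side_inter {hn : 0 < n} {P : Polygon V n} (hP : IsSimple P) {k l : ℕ}
    (hkl : k % n ≠ l % n) {x : V} (hk : x ∈ side hn P k) (hl : x ∈ side hn P l) :
    (l % n = (k + 1) % n ∧ x = vtx hn P l) ∨ (k % n = (l + 1) % n ∧ x = vtx hn P k) := by
  rw [← edgeSet_mod hn] at hk hl
  refine (hP.2 _ _ (fun h => hkl (congrArg Fin.val h)) x ⟨hk, hl⟩).imp ?_ ?_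
  · rintro ⟨h1, h2⟩
    rw [finRotate_eq hn] at h1
    exact ⟨by simpa using congrArg Fin.val h1, h2⟩
  · rintro ⟨h1, h2⟩
    rw [finRotate_eq hn] at h1
    exact ⟨by simpa using congrArg Fin.val h1, h2⟩

theorem IsSimple.vtx_ne {hn : 0 < n} (h2 : 2 ≤ n) {P : Polygon V n} (hP : IsSimple P) (k : ℕ) :
    vtx hn P (k + 1) ≠ vtx hn P k := by
  intro h
  have h1 := congrArg Fin.val (hP.1 h)
  simp only at h1
  have h3 : (k + 1) % n ≠ k % n := by
    intro h
    have := (Nat.modEq_iff_dvd' (Nat.le_succ k)).1 (show k ≡ k + 1 [MOD n] from h.symm)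
    have := Nat.le_of_dvd (by omega) this
    omega
  exact h3 h1

end Vtx

/-! ### A simple polygon that contains the frontier of a convex body -/

section Arc

/-- Stereographic projection from `p` parametrises the rest of the sphere by a vector space. -/
theorem isPreconnected_sphere_diff_singleton {E : Type*} [NormedAddCommGroup E]
    [InnerProductSpace ℝ E] (h : 1 < Module.rank ℝ E) (p : E) :
    IsPreconnected (sphere (0 : E) 1 \ {p}) := by
  by_cases hp : p ∈ sphere (0 : E) 1
  · have hp1 : ‖p‖ = 1 := by simpa using hp
    have hr := range_stereographic_symm hp1 hp
    have hpre : IsPreconnected (range (stereographic hp1).symm) := by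
      rw [← image_univ]
      exact isPreconnected_univ.image _
        (by simpa using (stereographic hp1).continuousOn_symm)
    have := hpre.image (Subtype.val) continuous_subtype_val.continuousOn
    rw [hr] at this
    convert this
    ext x
    simp only [mem_sdiff, mem_singleton_iff, mem_image, mem_compl_iff, Subtype.exists,
      exists_and_right, exists_eq_right, Subtype.mk.injEq]
    exact ⟨fun h => ⟨h.1, h.2⟩, fun ⟨h1, h2⟩ => ⟨h1, h2⟩⟩
  · rw [sdiff_singleton_eq_self hp]
    exact isPreconnected_sphere h 0 1

variable {V : Type*} [NormedAddCommGroup V] [NormedSpace ℝ V] [FiniteDimensional ℝ V]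
  [Fact (finrank ℝ V = 2)]

/-- A homeomorphism of the plane onto the Euclidean plane carries the frontier to the unit circle.
This connectedness takes the place of the Jordan curve theorem. -/
theorem isPreconnected_frontier_diff_singleton {M : Set V} (hM : Convex ℝ M) (hMc : IsCompact M)
    (hne : (interior M).Nonempty) (p : V) : IsPreconnected (frontier M \ {p}) := by
  have hfr : finrank ℝ V = finrank ℝ (EuclideanSpace ℝ (Fin 2)) := by
    rw [(Fact.out : finrank ℝ V = 2), finrank_euclideanSpace_fin]
  let e : V ≃L[ℝ] EuclideanSpace ℝ (Fin 2) := ContinuousLinearEquiv.ofFinrankEq hfr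
  have hint : interior (e '' M) = e '' interior M :=
    (e.toHomeomorph.image_interior M).symm
  obtain ⟨h, -, -, hh⟩ := exists_homeomorph_image_interior_closure_frontier_eq_unitBall
    (hM.is_linear_image e.toLinearMap.isLinear) (s := e '' M) (by rw [hint]; exact hne.image _)
    (hMc.image e.continuous).isBounded
  let H : V ≃ₜ EuclideanSpace ℝ (Fin 2) := e.toHomeomorph.trans h
  have hH : H '' frontier M = sphere 0 1 := by
    rw [← hh]
    change _ = h '' frontier (e.toHomeomorph '' M)
    rw [← e.toHomeomorph.image_frontier, ← image_comp]
    rfl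
  have hS := isPreconnected_sphere_diff_singleton (E := EuclideanSpace ℝ (Fin 2))
    (by rw [← finrank_eq_rank, finrank_euclideanSpace_fin]; norm_num) (H p)
  rw [← hH, ← image_singleton, ← image_sdiff H.injective] at hS
  have := hS.image H.symm H.symm.continuous.continuousOn
  rwa [← image_comp, H.symm_comp_self, image_id] at this

variable [MeasurableSpace V] [BorelSpace V] {ω : V [⋀^Fin 2]→ₗ[ℝ] ℝ} {n : ℕ}

/-- Every interior point lies between two frontier points on a line through it, so the interior
would be contained in the segment, which has empty interior. -/
theorem not_frontier_subset_segment (hω : ω ≠ 0) {M : Set V} (hMc : IsCompact M)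
    (hne : (interior M).Nonempty) (a b : V) : ¬ frontier M ⊆ segment ℝ a b := by
  intro h
  have := nontrivial_of_fact (V := V)
  obtain ⟨u, hu⟩ := exists_ne (0 : V)
  have hsub : interior M ⊆ segment ℝ a b := by
    intro c hc
    obtain ⟨τ, hτ, h1⟩ := exists_ray_mem_frontier hMc (interior_subset hc) hu
    obtain ⟨σ, hσ, h2⟩ := exists_ray_mem_frontier hMc (interior_subset hc) (neg_ne_zero.2 hu)
    have hτ' : τ ≠ 0 := by
      rintro rfl
      rw [zero_smul, add_zero] at h1
      exact h1.2 hc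
    have hpos : 0 < τ + σ := by
      have := hτ.lt_of_ne hτ'.symm
      linarith
    have hcomb := (convex_segment (𝕜 := ℝ) a b) (h h1) (h h2) (a := σ / (τ + σ))
      (b := τ / (τ + σ)) (by positivity) (by positivity) (by field_simp; ring)
    convert hcomb using 1
    have e1 : σ / (τ + σ) + τ / (τ + σ) = 1 := by field_simp; ring
    have e2 : σ / (τ + σ) * τ - τ / (τ + σ) * σ = 0 := by ring
    calc c = (σ / (τ + σ) + τ / (τ + σ)) • c + (σ / (τ + σ) * τ - τ / (τ + σ) * σ) • u := by
          rw [e1, e2, one_smul, zero_smul, add_zero]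
      _ = _ := by module
  have h3 := interior_mono hsub
  rw [interior_interior, interior_segment hω] at h3
  exact hne.not_subset_empty h3

-- Going from an interior point of a convex set towards any of its points, one stays in the interior
-- until the end is reached.
omit [FiniteDimensional ℝ V] [Fact (finrank ℝ V = 2)] [MeasurableSpace V] [BorelSpace V] in
theorem eq_endpoint_of_mem_frontier {M : Set V} (hM : Convex ℝ M) (hMc : IsClosed M) {a b x y : V}
    (ha : a ∈ M) (hb : b ∈ M) (hx : x ∈ interior M) (hxs : x ∈ segment ℝ a b)
    (hy : y ∈ frontier M) (hys : y ∈ segment ℝ a b) : y = a ∨ y = b := by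
  rw [hMc.frontier_eq] at hy
  have key : ∀ {a b : V} {s t : ℝ}, a ∈ M → a + s • (b - a) ∈ interior M → 0 < t → t ≤ s →
      a + t • (b - a) ∈ interior M := by
    intro a b s t ha hs ht hts
    have hs0 : 0 < s := ht.trans_le hts
    convert hM.combo_self_interior_mem_interior ha hs (a := 1 - t / s) (b := t / s)
      (by rw [sub_nonneg, div_le_one hs0]; exact hts) (by positivity) (by ring) using 1
    rw [smul_add, smul_smul, div_mul_cancel₀ _ hs0.ne', ← add_assoc, ← add_smul, sub_add_cancel,
      one_smul]
  rw [segment_eq_image'] at hxs hys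
  obtain ⟨s, hs, rfl⟩ := hxs
  obtain ⟨t, ht, rfl⟩ := hys
  by_contra! hne
  have ht0 : 0 < t := ht.1.lt_of_ne fun h => hne.1 (by simp [← h])
  have ht1 : t < 1 := ht.2.lt_of_ne fun h => hne.2 (by simp [h])
  rcases le_total t s with h | h
  · exact hy.2 (key ha hx ht0 h)
  · refine hy.2 ?_
    have hflip : ∀ r : ℝ, a + r • (b - a) = b + (1 - r) • (a - b) := fun r => by module
    simp only [hflip] at hx ⊢
    exact key hb hx (by linarith) (by linarith)

/-- A simple polygon which lies in a convex body and contains its frontier lies in the frontier. -/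
theorem IsSimple.boundary_subset_frontier (hω : ω ≠ 0) (hn : 3 ≤ n) {P : Polygon V n}
    (hP : IsSimple P) {M : Set V} (hM : Convex ℝ M) (hMc : IsCompact M)
    (hne : (interior M).Nonempty) (h1 : frontier M ⊆ P.boundary ℝ) (h2 : P.boundary ℝ ⊆ M) :
    P.boundary ℝ ⊆ frontier M := by
  have hn0 : 0 < n := by omega
  intro x hx
  by_contra hxf
  have hxi : x ∈ interior M := by
    by_contra hxi
    exact hxf (hMc.isClosed.frontier_eq ▸ ⟨h2 hx, hxi⟩)
  obtain ⟨i, hxi'⟩ := mem_iUnion.1 hx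
  rw [edgeSet_fin hn0] at hxi'
  set j₀ : ℕ := i + 1
  have hclosed : ∀ k, IsClosed (side hn0 P k) := fun k => (isCompact_segment _ _).isClosed
  have hvM : ∀ k, vtx hn0 P k ∈ M := fun k => h2 (vertex_mem_boundary P _)
  -- A side with a point in the interior of `M` can meet the frontier only in its ends, which belong
  -- to the neighbouring sides as well; so the sides `i + 1, …, i + n - 1` cover the frontier.
  have hend : ∀ y ∈ frontier M, y ∈ ⋃ k ∈ Finset.Ico j₀ (i + n), side hn0 P k := by
    intro y hy
    obtain ⟨l, hl⟩ := mem_iUnion.1 (h1 hy)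
    rw [edgeSet_fin hn0] at hl
    rcases lt_trichotomy (l : ℕ) i with hlt | heq | hgt
    · refine mem_iUnion₂.2 ⟨l + n, Finset.mem_Ico.2 ⟨by omega, by omega⟩, ?_⟩
      rwa [side, add_right_comm, vtx_add, vtx_add]
    · rw [heq] at hl
      rcases eq_endpoint_of_mem_frontier hM hMc.isClosed (hvM _) (hvM _) hxi hxi' hy hl with h | h
      · refine mem_iUnion₂.2 ⟨i + n - 1, Finset.mem_Ico.2 ⟨by omega, by omega⟩, ?_⟩
        have : (i : ℕ) + n - 1 + 1 = i + n := by omega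
        rw [side, this, vtx_add, h]
        exact right_mem_segment _ _ _
      · refine mem_iUnion₂.2 ⟨i + 1, Finset.mem_Ico.2 ⟨by omega, by omega⟩, ?_⟩
        rw [h]
        exact left_mem_segment _ _ _
    · exact mem_iUnion₂.2 ⟨l, Finset.mem_Ico.2 ⟨by omega, by omega⟩, hl⟩
  -- Peel these sides off one by one. They form an open chain, so side `j₀ + d` meets the later ones
  -- only in its end vertex. The frontier without that vertex is connected, hence lies in this side
  -- or in the later ones, and one segment cannot hold it.
  have step : ∀ d, j₀ + d < i + n →
      frontier M ⊆ ⋃ k ∈ Finset.Ico (j₀ + d) (i + n), side hn0 P k := by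
    intro d
    induction d with
    | zero => exact fun _ => hend
    | succ d ih =>
      intro hd
      have ih' := ih (by omega)
      have hC : IsClosed (⋃ k ∈ Finset.Ico (j₀ + (d + 1)) (i + n), side hn0 P k) :=
        isClosed_biUnion_finset fun k _ => hclosed k
      have hpre := isPreconnected_iff_subset_of_disjoint_closed.1
        (isPreconnected_frontier_diff_singleton hM hMc hne (vtx hn0 P (j₀ + d + 1)))
        (side hn0 P (j₀ + d)) _ (hclosed _) hC
      have hcov : frontier M \ {vtx hn0 P (j₀ + d + 1)} ⊆ side hn0 P (j₀ + d) ∪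
          ⋃ k ∈ Finset.Ico (j₀ + (d + 1)) (i + n), side hn0 P k := by
        rintro y ⟨hy, -⟩
        obtain ⟨k, hk, hyk⟩ := mem_iUnion₂.1 (ih' hy)
        rw [Finset.mem_Ico] at hk
        rcases hk.1.eq_or_lt with h | h
        · left
          rwa [h]
        · right
          exact mem_iUnion₂.2 ⟨k, Finset.mem_Ico.2 ⟨by omega, hk.2⟩, hyk⟩
      have hint : frontier M \ {vtx hn0 P (j₀ + d + 1)} ∩ (side hn0 P (j₀ + d) ∩
          ⋃ k ∈ Finset.Ico (j₀ + (d + 1)) (i + n), side hn0 P k) = ∅ := by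
        rw [eq_empty_iff_forall_notMem]
        rintro y ⟨⟨-, hyv⟩, hyd, hyC⟩
        obtain ⟨k, hk, hyk⟩ := mem_iUnion₂.1 hyC
        rw [Finset.mem_Ico] at hk
        have hmod : ∀ {p q : ℕ}, p ≤ q → q < p + n → p % n = q % n → p = q := by
          intro p q hpq hq h
          by_contra hne
          have h1 := (Nat.modEq_iff_dvd' hpq).1 h
          have h2 := Nat.le_of_dvd (by omega) h1
          omega
        have hne' : (j₀ + d) % n ≠ k % n := fun h => by
          have := hmod (by omega) (by omega) h
          omega
        rcases hP.side_inter hne' hyd hyk with ⟨h, h'⟩ | ⟨h, h'⟩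
        · have := hmod (p := j₀ + d + 1) (q := k) (by omega) (by omega) h.symm
          rw [← this] at h'
          exact hyv h'
        · have := hmod (p := j₀ + d) (q := k + 1) (by omega) (by omega) h
          omega
      rcases hpre hcov hint with h | h
      · exfalso
        refine not_frontier_subset_segment hω hMc hne (vtx hn0 P (j₀ + d))
          (vtx hn0 P (j₀ + d + 1)) fun y hy => ?_
        by_cases hyv : y = vtx hn0 P (j₀ + d + 1)
        · rw [hyv]
          exact right_mem_segment _ _ _
        · exact h ⟨hy, hyv⟩
      · intro y hy
        by_cases hyv : y = vtx hn0 P (j₀ + d + 1)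
        · refine mem_iUnion₂.2 ⟨j₀ + (d + 1), Finset.mem_Ico.2 ⟨le_rfl, hd⟩, ?_⟩
          rw [hyv]
          exact left_mem_segment _ _ _
        · exact h ⟨hy, hyv⟩
  -- Now only side `i + n - 1` is left, and a single segment cannot contain the frontier.
  have hlast := step (n - 2) (by omega)
  refine not_frontier_subset_segment hω hMc hne (vtx hn0 P (j₀ + (n - 2)))
    (vtx hn0 P (j₀ + (n - 2) + 1)) fun y hy => ?_
  obtain ⟨k, hk, hyk⟩ := mem_iUnion₂.1 (hlast hy)
  rw [Finset.mem_Ico] at hk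
  have : k = j₀ + (n - 2) := by omega
  rwa [this] at hyk

/-- The area of a simple polygon whose region is a convex body, seen from an interior point. -/
theorem IsSimple.area_eq (hω : ω ≠ 0) (hn : 3 ≤ n) {P : Polygon V n} (hP : IsSimple P)
    (hM : Convex ℝ (region P)) {c : V} (hc : c ∈ interior (region P)) :
    area ω P = (∑ i, |bracket ω (P i - c) (P (finRotate n i) - c)|) / 2 := by
  have hn0 : 0 < n := by omega
  have hMc := isCompact_region hn0 P
  have hb := hP.boundary_subset_frontier hω hn hM hMc ⟨c, hc⟩ (frontier_region_subset P)
    (boundary_subset_region P)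
  refine measure_eq_sum_triangles hω hM hMc hc Finset.univ (fun i => P i)
    (fun i => P (finRotate n i)) ?_ ?_ ?_
  · intro x hx
    obtain ⟨i, hi⟩ := mem_iUnion.1 (frontier_region_subset P hx)
    exact mem_iUnion₂.2 ⟨i, Finset.mem_univ i, by rwa [edgeSet_eq_segment] at hi⟩
  · intro i _
    rw [← edgeSet_eq_segment]
    exact (edgeSet_subset_boundary P i).trans hb
  · intro i _ j _ hij
    refine (toFinite ({P j, P i} : Set V)).subset fun x hx => ?_
    rw [← edgeSet_eq_segment, ← edgeSet_eq_segment] at hx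
    exact (hP.2 i j hij x hx).imp (fun h => h.2) (fun h => h.2)

/-- Every side lies on a supporting line of the disc, so the triangle from `c` over it has area `ρ /
2` times the length of the side. -/
theorem IsCircumscribed.area_eq (hω : ω ≠ 0) (hn : 3 ≤ n) {P : Polygon V n} {c : V} {ρ : ℝ}
    (hρ : 0 < ρ) (hP : IsCircumscribed P (antidisc ω c ρ)) :
    area ω P = ρ * perimeter P / 2 := by
  have hn0 : 0 < n := by omega
  have hB := isAreaForm_bracket hω
  have hc : c ∈ interior (region P) :=
    interior_mono hP.subset (center_mem_interior_antidisc ω c hρ)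
  rw [hP.isSimple.area_eq hω hn hP.convex hc, perimeter, Finset.mul_sum]
  congr 1
  refine Finset.sum_congr rfl fun i _ => ?_
  have hne : P (finRotate n i) - P i ≠ 0 := by
    have := hP.isSimple.vtx_ne (hn := hn0) (by omega) i
    rw [vtx_fin, vtx_succ_fin] at this
    exact sub_ne_zero.2 this
  rw [← abs_bracket_of_isSupportingLine hω hne (hP.supporting i)]
  congr 1
  have : P (finRotate n i) - c = (P (finRotate n i) - P i) + (P i - c) := by abel
  rw [this, map_add, hB.self, add_zero]

end Arc

/-! ### Points in convex position -/

section ConvexCycle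

variable {V : Type*} [AddCommGroup V] [Module ℝ V]

/-- Twice the signed area of the triangle `a b c`. -/
def orient (B : V →ₗ[ℝ] V →ₗ[ℝ] ℝ) (a b c : V) : ℝ := B (b - a) (c - a)

/-- The side vectors of a closed polygon. -/
def edge (w : ℕ → V) (j : ℕ) : V := w (j + 1) - w j

/-- A positively oriented strictly convex closed polygon with `m` vertices. -/
structure ConvexCycle (B : V →ₗ[ℝ] V →ₗ[ℝ] ℝ) (m : ℕ) (w : ℕ → V) : Prop where
  three_le : 3 ≤ m
  periodic : ∀ j, w (j + m) = w j
  pos : ∀ i j k, i < j → j < k → k < m → 0 < orient B (w i) (w j) (w k)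

variable {B : V →ₗ[ℝ] V →ₗ[ℝ] ℝ} (hB : IsAreaForm B)
include hB

theorem IsAreaForm.orient_rotate (a b c : V) : orient B a b c = orient B b c a := by
  simp only [orient, map_sub, LinearMap.sub_apply, hB.self]
  rw [hB.swap b a, hB.swap c a, hB.swap c b]
  ring

omit hB in
theorem orient_left (a b : V) : orient B a b a = 0 := by simp [orient]

theorem IsAreaForm.orient_quad_add (a b c d : V) :
    orient B b c d + orient B a b d = orient B a c d + orient B a b c := by
  simp only [orient, map_sub, LinearMap.sub_apply, hB.self]
  rw [hB.swap c b, hB.swap b a, hB.swap c a]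
  ring

/-- The affine dependence between the vertices of a quadrilateral. -/
theorem IsAreaForm.orient_quad (a b c d : V) :
    orient B b c d • a + orient B a b d • c = orient B a c d • b + orient B a b c • d := by
  have h := hB.cyc (b - a) (c - a) (d - a)
  have h2 := hB.orient_quad_add a b c d
  have h3 : B (d - a) (b - a) = -orient B a b d := hB.swap _ _
  rw [h3] at h
  change orient B a b c • (d - a) + orient B a c d • (b - a) + _ = 0 at h
  have h4 : orient B b c d = orient B a c d + orient B a b c - orient B a b d := by linarith
  rw [h4, ← sub_eq_zero]
  rw [← neg_eq_zero, ← h]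
  module

theorem IsAreaForm.orient_quad_apply (a b c d : V) (g : V →ₗ[ℝ] ℝ) :
    orient B b c d * g a + orient B a b d * g c = orient B a c d * g b + orient B a b c * g d := by
  simpa using congrArg g (hB.orient_quad a b c d)

namespace ConvexCycle

variable {m : ℕ} {w : ℕ → V} (hw : ConvexCycle B m w)
include hw

omit hB in
theorem pos_m : 0 < m := by have := hw.three_le; omega

omit hB in
theorem mod (j : ℕ) : w (j % m) = w j := by
  conv_rhs => rw [← Nat.mod_add_div j m]
  induction j / m with
  | zero => simp
  | succ d ih => rw [mul_add, mul_one, ← add_assoc, hw.periodic, ih]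

omit hB in
theorem edge_periodic (j : ℕ) : edge w (j + m) = edge w j := by
  rw [edge, edge, add_right_comm, hw.periodic, hw.periodic]

omit hB in
theorem edge_mod (j : ℕ) : edge w (j % m) = edge w j := by
  rw [edge, edge, hw.mod, ← hw.mod (j % m + 1), Nat.mod_add_mod, hw.mod]

theorem left_pos_aux {a c : ℕ} (ha : a < m) (hc : c < m) (h1 : c ≠ a) (h2 : c ≠ (a + 1) % m) :
    0 < orient B (w a) (w (a + 1)) (w c) := by
  have h3 := hw.three_le
  rcases Nat.lt_or_ge (a + 1) m with h | h
  · rw [Nat.mod_eq_of_lt h] at h2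
    rcases Nat.lt_or_ge c a with h4 | h4
    · rw [← hB.orient_rotate]
      exact hw.pos _ _ _ h4 (Nat.lt_succ_self a) h
    · exact hw.pos _ _ _ (Nat.lt_succ_self a) (by omega) hc
  · have ham : a + 1 = m := by omega
    rw [ham, Nat.mod_self] at h2
    have h0 : w (a + 1) = w 0 := by rw [ham, ← hw.mod m, Nat.mod_self]
    rw [h0, hB.orient_rotate]
    exact hw.pos _ _ _ (by omega) (by omega) ha

theorem left_pos {j k : ℕ} (h1 : k % m ≠ j % m) (h2 : k % m ≠ (j + 1) % m) :
    0 < B (edge w j) (w k - w j) := by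
  have h := hw.left_pos_aux hB (Nat.mod_lt j hw.pos_m) (Nat.mod_lt k hw.pos_m) h1
    (by rwa [Nat.mod_add_mod])
  rw [← hw.mod (j % m + 1), Nat.mod_add_mod, hw.mod, hw.mod, hw.mod] at h
  exact h

theorem left_nonneg (j k : ℕ) : 0 ≤ B (edge w j) (w k - w j) := by
  by_cases h1 : k % m = j % m
  · rw [← hw.mod k, h1, hw.mod, sub_self, map_zero]
  by_cases h2 : k % m = (j + 1) % m
  · rw [← hw.mod k, h2, hw.mod]
    exact (hB.self _).ge
  exact (hw.left_pos hB h1 h2).le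

theorem mod_of_left_eq {j k : ℕ} (h : B (edge w j) (w k - w j) = 0) :
    k % m = j % m ∨ k % m = (j + 1) % m := by
  by_contra! hne
  exact (hw.left_pos hB hne.1 hne.2).ne' h

omit hB hw in
theorem mod_add_ne {j d : ℕ} (hd : 0 < d) (hdm : d < m) : (j + d) % m ≠ j % m := by
  intro h
  have h1 := (Nat.modEq_iff_dvd' (Nat.le_add_right j d)).1 (show j ≡ j + d [MOD m] from h.symm)
  have := Nat.le_of_dvd (by omega) h1
  omega

theorem turn (j : ℕ) : 0 < B (edge w j) (edge w (j + 1)) := by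
  have h3 := hw.three_le
  have h := hw.left_pos hB (j := j) (k := j + 2) (mod_add_ne (by omega) (by omega))
    (mod_add_ne (j := j + 1) (d := 1) (by omega) (by omega))
  have e : w (j + 2) - w j = edge w j + edge w (j + 1) := by
    simp only [edge]
    abel
  rwa [e, map_add, hB.self, zero_add] at h

theorem edge_ne_zero (j : ℕ) : edge w j ≠ 0 := fun h => by
  have := hw.turn hB j
  simp [h] at this

theorem inj {a b : ℕ} (ha : a < m) (hb : b < m) (h : w a = w b) : a = b := by
  by_contra hne
  wlog hab : a < b generalizing a b
  · exact this hb ha h.symm (Ne.symm hne) (by omega)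
  have h3 := hw.three_le
  by_cases hadj : b = a + 1
  · exact hw.edge_ne_zero hB a (by rw [edge, ← hadj, h, sub_self])
  · have := hw.left_pos_aux hB ha hb (by omega) (by rw [Nat.mod_eq_of_lt (by omega)]; exact hadj)
    rw [← h, orient_left] at this
    exact lt_irrefl _ this

/-- Two sides pointing the same way would each have the other on its left, so they would lie on one
line; but the only vertices on the line of a side are its two ends. -/
theorem not_parallel {i j : ℕ} (hij : i % m ≠ j % m) {κ : ℝ} (hκ : 0 < κ) :
    edge w j ≠ κ • edge w i := by
  intro h
  have h1 := hw.left_nonneg hB j i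
  rw [h, map_smul, LinearMap.smul_apply, smul_eq_mul] at h1
  have h2 := hw.left_nonneg hB i j
  have h3 : B (edge w i) (w i - w j) = -B (edge w i) (w j - w i) := by
    rw [← map_neg, neg_sub]
  rw [h3] at h1
  have h4 : B (edge w i) (w j - w i) = 0 := by nlinarith
  rcases hw.mod_of_left_eq hB h4 with h5 | h5
  · exact hij h5.symm
  · have h6 := hw.turn hB i
    have h7 : edge w (i + 1) = edge w j := by
      rw [← hw.edge_mod j, h5, hw.edge_mod]
    rw [h7, h, map_smul, hB.self, smul_zero] at h6
    exact lt_irrefl _ h6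

omit hB in
theorem range_eq : range w = w '' (Finset.range m : Set ℕ) := by
  apply subset_antisymm
  · rintro _ ⟨j, rfl⟩
    exact ⟨j % m, by simpa using Nat.mod_lt j hw.pos_m, hw.mod j⟩
  · exact image_subset_range _ _

omit hB in
theorem finite_range : (range w).Finite := by
  rw [hw.range_eq]
  exact (Finset.finite_toSet _).image _

/-- Every direction lies in the cone of the outer normals at some vertex. -/
theorem exists_cone (d : V) : ∃ (J : ℕ) (α β : ℝ), 0 ≤ α ∧ 0 ≤ β ∧
    d = -(α • edge w J + β • edge w (J + 1)) := by
  -- At a vertex `w J` where `B d` is largest, the sides `I` ending and `I + 1` starting there have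
  -- brackets with `d` of opposite sign (or zero), and these are the coefficients. Adding `m` keeps
  -- the index `J - 1` a natural number.
  obtain ⟨_, ⟨J, rfl⟩, hJ⟩ := Set.exists_max_image (range w) (fun x => B d x) hw.finite_range
    ⟨_, mem_range_self 0⟩
  have hm := hw.three_le
  set I := J + m - 1
  have hI : I + 1 = J + m := by omega
  have hD := hw.turn hB I
  have h1 : 0 ≤ B d (edge w I) := by
    rw [edge, hI, hw.periodic, map_sub]
    linarith [hJ _ (mem_range_self I)]
  have h2 : B d (edge w (I + 1)) ≤ 0 := by
    rw [edge, hI, hw.periodic, map_sub]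
    linarith [hJ _ (mem_range_self (J + m + 1))]
  refine ⟨I, -(B d (edge w (I + 1)) / B (edge w I) (edge w (I + 1))),
    -(B (edge w I) d / B (edge w I) (edge w (I + 1))), ?_, ?_, ?_⟩
  · rw [neg_nonneg]
    exact div_nonpos_of_nonpos_of_nonneg h2 hD.le
  · rw [neg_nonneg, hB.swap]
    exact div_nonpos_of_nonpos_of_nonneg (by linarith) hD.le
  · conv_lhs => rw [hB.decomp hD.ne' d]
    module

/-- Seen from a side, the remaining sides first rise and then fall. -/
theorem exists_turning_index : ∃ b, 1 ≤ b ∧ b + 1 < m ∧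
    (∀ j, 1 ≤ j → j ≤ b → 0 < B (edge w 0) (edge w j)) ∧
    B (edge w 0) (edge w (b + 1)) ≤ 0 ∧
    ∀ j, b + 2 ≤ j → j < m → B (edge w 0) (edge w j) < 0 := by
  have hm := hw.three_le
  -- `g j - g 0` is the height of `w j` above side `0`, and `b + 1` will be the first index `M` of
  -- greatest height. Side `M` may be parallel to side `0`, so its bracket is only known to be `≤
  -- 0`.
  set g : ℕ → ℝ := fun j => B (edge w 0) (w j) with hg
  have hedge : ∀ j, B (edge w 0) (edge w j) = g (j + 1) - g j := fun j =>
    map_sub _ _ _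
  have hg1 : g 1 = g 0 := by
    have := hB.self (edge w 0)
    rw [hedge] at this
    linarith
  have hgm : g m = g 0 := by
    simp only [hg]
    rw [← hw.periodic 0, zero_add]
  have hpos : ∀ j, 2 ≤ j → j < m → g 0 < g j := by
    intro j hj hjm
    have := hw.left_pos_aux hB (a := 0) (c := j) (by omega) hjm (by omega)
      (by rw [Nat.mod_eq_of_lt (by omega)]; omega)
    have h : orient B (w 0) (w (0 + 1)) (w j) = g j - g 0 := by
      rw [orient, map_sub]
      rfl
    linarith
  have hex : ∃ k, k < m ∧ ∀ j, j < m → g j ≤ g k := by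
    obtain ⟨k, hk, hmax⟩ := Finset.exists_max_image (Finset.range m) g ⟨0, by simp; omega⟩
    exact ⟨k, Finset.mem_range.1 hk, fun j hj => hmax j (Finset.mem_range.2 hj)⟩
  classical
  set M := Nat.find hex
  obtain ⟨hMm, hMmax⟩ := Nat.find_spec hex
  have hMfirst : ∀ j, j < M → g j < g M := by
    intro j hj
    by_contra! h
    exact Nat.find_min hex hj ⟨by omega, fun i hi => (hMmax i hi).trans h⟩
  have hM2 : 2 ≤ M := by
    by_contra! h
    have h2 := hpos 2 le_rfl (by omega)
    have h3 := hMmax 2 (by omega)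
    rcases Nat.lt_or_ge M 1 with h4 | h4
    · have h5 : M = 0 := by omega
      change g 2 ≤ g M at h3
      rw [h5] at h3
      linarith
    · have h5 : M = 1 := by omega
      change g 2 ≤ g M at h3
      rw [h5] at h3
      linarith
  have hM3 : ∀ j, j < m → g j ≤ g M := hMmax
  refine ⟨M - 1, by omega, by omega, ?_, ?_, ?_⟩
  · intro j hj1 hj2
    rw [hedge, sub_pos]
    rcases hj1.eq_or_lt with rfl | hj1
    · rw [hg1]
      exact hpos _ (by omega) (by omega)
    rcases hj2.eq_or_lt with rfl | hj2
    · rw [Nat.sub_add_cancel (by omega)]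
      exact hMfirst _ (by omega)
    -- Otherwise the diagonals of the quadrilateral `1, j, j + 1, M` could not cross: the one from
    -- `w 1` to `w (j + 1)` stays strictly below the height of `w (j + 1)` before its end, the other
    -- one never goes below it. The descending part uses `0, M, j, j + 1` in the same way.
    by_contra! hle
    have q1 := hw.pos j (j + 1) M (by omega) (by omega) (by omega)
    have q2 := hw.pos 1 (j + 1) M (by omega) (by omega) (by omega)
    have q3 := hw.pos 1 j M (by omega) (by omega) (by omega)
    have q4 := hw.pos 1 j (j + 1) (by omega) (by omega) (by omega)
    have qa := hB.orient_quad_add (w 1) (w j) (w (j + 1)) (w M)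
    have qb := hB.orient_quad_apply (w 1) (w j) (w (j + 1)) (w M) (B (edge w 0))
    have h0 := hpos (j + 1) (by omega) (by omega)
    have h1 := hM3 (j + 1) (by omega)
    change _ * g 1 + _ * g (j + 1) = _ * g j + _ * g M at qb
    rw [hg1] at qb
    have qc := congrArg (fun t => t * g (j + 1)) qa
    nlinarith [mul_nonneg q2.le (sub_nonneg.2 hle), mul_nonneg q4.le (sub_nonneg.2 h1),
      mul_pos q1 (sub_pos.2 h0)]
  · rw [Nat.sub_add_cancel (by omega), hedge, sub_nonpos]
    rcases Nat.lt_or_ge (M + 1) m with h | h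
    · exact hM3 _ h
    · have : M + 1 = m := by omega
      rw [this, hgm]
      exact hM3 0 (by omega)
  · intro j hj1 hj2
    rw [hedge, sub_neg]
    rcases Nat.lt_or_ge (j + 1) m with h | h
    · by_contra! hle
      have q1 := hw.pos M j (j + 1) (by omega) (by omega) (by omega)
      have q2 := hw.pos 0 j (j + 1) (by omega) (by omega) (by omega)
      have q3 := hw.pos 0 M (j + 1) (by omega) (by omega) (by omega)
      have q4 := hw.pos 0 M j (by omega) (by omega) (by omega)
      have qa := hB.orient_quad_add (w 0) (w M) (w j) (w (j + 1))
      have qb := hB.orient_quad_apply (w 0) (w M) (w j) (w (j + 1)) (B (edge w 0))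
      have h0 := hpos j (by omega) (by omega)
      have h1 := hM3 j (by omega)
      change _ * g 0 + _ * g j = _ * g M + _ * g (j + 1) at qb
      have qc := congrArg (fun t => t * g j) qa
      nlinarith [mul_nonneg q2.le (sub_nonneg.2 h1), mul_nonneg q4.le (sub_nonneg.2 hle),
        mul_pos q1 (sub_pos.2 h0)]
    · have : j + 1 = m := by omega
      rw [this, hgm]
      exact hpos j (by omega) hj2

end ConvexCycle

end ConvexCycle

/-! ### Convex polygons described by support numbers -/

section SupportBody

variable {V : Type*} [AddCommGroup V] [Module ℝ V]

/-- The convex set with support number `h k` for the outer normal of the side `edge w k`. -/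
def supportBody (B : V →ₗ[ℝ] V →ₗ[ℝ] ℝ) (w : ℕ → V) (h : ℕ → ℝ) : Set V :=
  {x | ∀ k, B x (edge w k) ≤ h k}

/-- The points `Y j`, on the lines with indices `j` and `j + 1`, are the vertices of the convex
polygon with sides parallel to those of `w` and support numbers `h`; sides of length zero are
allowed. -/
structure IsSupportPolygon (B : V →ₗ[ℝ] V →ₗ[ℝ] ℝ) (m : ℕ) (w : ℕ → V) (h : ℕ → ℝ)
    (Y : ℕ → V) : Prop where
  periodic : ∀ j, Y (j + m) = Y j
  left : ∀ j, B (Y j) (edge w j) = h j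
  right : ∀ j, B (Y j) (edge w (j + 1)) = h (j + 1)
  mem : ∀ j, Y j ∈ supportBody B w h

variable {B : V →ₗ[ℝ] V →ₗ[ℝ] ℝ} (hB : IsAreaForm B) {m : ℕ} {w : ℕ → V}
  (hw : ConvexCycle B m w)
include hB hw

/-- The shift is forced by the indexing: lines `j` and `j + 1` meet in `w (j + 1)`. -/
theorem ConvexCycle.isSupportPolygon :
    IsSupportPolygon B m w (fun k => B (w k) (edge w k)) (fun j => w (j + 1)) where
  periodic j := by rw [add_right_comm, hw.periodic]
  left j := by
    rw [← sub_eq_zero, ← LinearMap.sub_apply, ← map_sub]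
    exact hB.self _
  right j := rfl
  mem j k := by
    have := hw.left_nonneg hB k (j + 1)
    rw [hB.swap, map_sub, LinearMap.sub_apply] at this
    linarith

variable {h : ℕ → ℝ} {Y : ℕ → V} (hY : IsSupportPolygon B m w h Y)
include hY

namespace IsSupportPolygon

omit hB in
theorem support_mod (j : ℕ) : h (j % m) = h j := by
  have hp : ∀ j, h (j + m) = h j := fun j => by
    rw [← hY.left, ← hY.left j, hY.periodic, hw.edge_periodic]
  conv_rhs => rw [← Nat.mod_add_div j m]
  induction j / m with
  | zero => simp
  | succ d ih => rw [mul_add, mul_one, ← add_assoc, hp, ih]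

omit hB hw in
theorem vertex_mod (j : ℕ) : Y (j % m) = Y j := by
  conv_rhs => rw [← Nat.mod_add_div j m]
  induction j / m with
  | zero => simp
  | succ d ih => rw [mul_add, mul_one, ← add_assoc, hY.periodic, ih]

omit hB in
theorem finite_range : (range Y).Finite := by
  refine ((Finset.finite_toSet (Finset.range m)).image Y).subset ?_
  rintro _ ⟨j, rfl⟩
  exact ⟨j % m, by simpa using Nat.mod_lt j hw.pos_m, hY.vertex_mod j⟩

omit hB in
theorem exists_index_eq_succ (k : ℕ) :
    ∃ j < m, edge w (j + 1) = edge w k ∧ h (j + 1) = h k := by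
  have hm := hw.three_le
  refine ⟨(k + m - 1) % m, Nat.mod_lt _ hw.pos_m, ?_⟩
  have e : ((k + m - 1) % m + 1) % m = k % m := by
    rw [Nat.mod_add_mod]
    have : k + m - 1 + 1 = k + m := by omega
    rw [this, Nat.add_mod_right]
  constructor
  · rw [← hw.edge_mod, e, hw.edge_mod]
  · rw [← hY.support_mod hw, e, hY.support_mod hw]

/-- The inequality for line `j` leaves only the half of line `j + 1` that starts in `Y j`; in
`exists_sub_smul` line `j + 2` bounds the other end. -/
theorem exists_add_smul {x : V} (hx : x ∈ supportBody B w h) {j : ℕ}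
    (hxj : B x (edge w (j + 1)) = h (j + 1)) : ∃ α : ℝ, 0 ≤ α ∧ x = Y j + α • edge w (j + 1) := by
  have h0 : B (x - Y j) (edge w (j + 1)) = 0 := by
    rw [map_sub, LinearMap.sub_apply, hxj, hY.right, sub_self]
  obtain ⟨α, hα⟩ := hB.exists_smul_of_eq_zero (hw.edge_ne_zero hB _) h0
  refine ⟨α, ?_, by rw [← hα]; abel⟩
  have h1 := hx j
  have h2 : B x (edge w j) = h j - α * B (edge w j) (edge w (j + 1)) := by
    have : x = Y j + α • edge w (j + 1) := by rw [← hα]; abel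
    rw [this, map_add, LinearMap.add_apply, hY.left, map_smul, LinearMap.smul_apply, hB.swap]
    simp only [smul_eq_mul]
    ring
  have h3 := hw.turn hB j
  rw [h2] at h1
  by_contra! hneg
  nlinarith

theorem exists_sub_smul {x : V} (hx : x ∈ supportBody B w h) {j : ℕ}
    (hxj : B x (edge w (j + 1)) = h (j + 1)) :
    ∃ β : ℝ, 0 ≤ β ∧ x = Y (j + 1) - β • edge w (j + 1) := by
  have h0 : B (Y (j + 1) - x) (edge w (j + 1)) = 0 := by
    rw [map_sub, LinearMap.sub_apply, hxj, hY.left, sub_self]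
  obtain ⟨β, hβ⟩ := hB.exists_smul_of_eq_zero (hw.edge_ne_zero hB _) h0
  refine ⟨β, ?_, by rw [← hβ]; abel⟩
  have h1 := hx (j + 2)
  have h2 : B x (edge w (j + 2)) = h (j + 2) - β * B (edge w (j + 1)) (edge w (j + 2)) := by
    have : x = Y (j + 1) - β • edge w (j + 1) := by rw [← hβ]; abel
    rw [this, map_sub, LinearMap.sub_apply, hY.right (j + 1), map_smul, LinearMap.smul_apply]
    simp only [smul_eq_mul]
  have h3 := hw.turn hB (j + 1)
  rw [h2] at h1
  by_contra! hneg
  nlinarith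

theorem exists_length (j : ℕ) : ∃ l : ℝ, 0 ≤ l ∧ Y (j + 1) = Y j + l • edge w (j + 1) :=
  hY.exists_add_smul hB hw (hY.mem _) (hY.left _)

theorem mem_segment_of_eq {x : V} (hx : x ∈ supportBody B w h) {j : ℕ}
    (hxj : B x (edge w (j + 1)) = h (j + 1)) : x ∈ segment ℝ (Y j) (Y (j + 1)) := by
  obtain ⟨α, hα, rfl⟩ := hY.exists_add_smul hB hw hx hxj
  obtain ⟨β, hβ, h2⟩ := hY.exists_sub_smul hB hw hx hxj
  have h3 : Y (j + 1) = Y j + (α + β) • edge w (j + 1) := by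
    rw [eq_sub_iff_add_eq] at h2
    rw [← h2, add_smul, add_assoc]
  rcases (add_nonneg hα hβ).eq_or_lt with h | h
  · have : α = 0 := by linarith
    rw [this, zero_smul, add_zero]
    exact left_mem_segment _ _ _
  · rw [segment_eq_image']
    refine ⟨α / (α + β), ⟨by positivity, by rw [div_le_one h]; linarith⟩, ?_⟩
    simp only
    rw [h3, add_sub_cancel_left, smul_smul, div_mul_cancel₀ _ h.ne']

end IsSupportPolygon

omit hB hw hY in
theorem convex_supportBody : Convex ℝ (supportBody B w h) := by
  intro x hx y hy a b ha hb hab k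
  have h1 := hx k
  have h2 := hy k
  simp only [map_add, map_smul, LinearMap.add_apply, LinearMap.smul_apply, smul_eq_mul]
  calc a * B x (edge w k) + b * B y (edge w k) ≤ a * h k + b * h k := by gcongr
    _ = h k := by rw [← add_mul, hab, one_mul]

end SupportBody

/-! ### Hull, interior and frontier of a support polygon. -/

section SupportBodyTopology

variable {V : Type*} [NormedAddCommGroup V] [NormedSpace ℝ V] [FiniteDimensional ℝ V]
variable {B : V →ₗ[ℝ] V →ₗ[ℝ] ℝ} (hB : IsAreaForm B) {m : ℕ} {w : ℕ → V}
  (hw : ConvexCycle B m w) {h : ℕ → ℝ} {Y : ℕ → V} (hY : IsSupportPolygon B m w h Y)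
include hB hw hY

namespace IsSupportPolygon

-- A functional separating a point from the hull is a nonnegative combination of two consecutive
-- outer normals `J`, `J + 1`. At `Y J` both support numbers are attained, so the functional is
-- largest there on the whole body.
omit [FiniteDimensional ℝ V] in
theorem eq_convexHull : supportBody B w h = convexHull ℝ (range Y) := by
  apply subset_antisymm
  · intro x hx
    by_contra hxH
    obtain ⟨g, u, hg, hgx⟩ := geometric_hahn_banach_closed_point (convex_convexHull ℝ _)
      ((hY.finite_range hw).isCompact_convexHull ℝ).isClosed hxH
    obtain ⟨d, hd⟩ := hB.exists_repr g.toLinearMap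
    have hd' : ∀ x, g x = B d x := hd
    obtain ⟨J, α, β, hα, hβ, hJ⟩ := hw.exists_cone hB d
    have hg' : ∀ x, g x = α * B x (edge w J) + β * B x (edge w (J + 1)) := by
      intro x
      rw [hd', hB.swap, hJ]
      simp
    have h1 := hg _ (subset_convexHull ℝ _ (mem_range_self J))
    rw [hg', hY.left, hY.right] at h1
    rw [hg'] at hgx
    have h2 := mul_le_mul_of_nonneg_left (hx J) hα
    have h3 := mul_le_mul_of_nonneg_left (hx (J + 1)) hβ
    linarith
  · refine convexHull_min ?_ convex_supportBody
    rintro _ ⟨j, rfl⟩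
    exact hY.mem j

omit [FiniteDimensional ℝ V] in
theorem isCompact : IsCompact (supportBody B w h) := by
  rw [hY.eq_convexHull hB hw]
  exact (hY.finite_range hw).isCompact_convexHull ℝ

-- An interior point can still be moved a little in a direction in which the bracket with `edge w k`
-- grows.
omit [FiniteDimensional ℝ V] hY in
theorem lt_of_mem_interior {x : V} (hx : x ∈ interior (supportBody B w h)) (k : ℕ) :
    B x (edge w k) < h k := by
  obtain ⟨v, hv⟩ := hB.exists_ne_zero (hw.edge_ne_zero hB k)
  rw [hB.swap] at hv
  have hcont : Continuous (fun s : ℝ => x + s • (-B v (edge w k) • -v)) := by fun_prop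
  have hev : ∀ᶠ s : ℝ in nhdsWithin 0 (Ioi 0), x + s • (-B v (edge w k) • -v) ∈
      supportBody B w h := by
    have h0 : supportBody B w h ∈ nhds (x + (0 : ℝ) • (-B v (edge w k) • -v)) := by
      rw [zero_smul, add_zero]
      exact mem_interior_iff_mem_nhds.1 hx
    exact ((hcont.tendsto 0).eventually h0).filter_mono nhdsWithin_le_nhds
  obtain ⟨s, hs, hs0⟩ := (hev.and self_mem_nhdsWithin).exists
  have h1 := hs k
  have h2 : (0 : ℝ) < s := hs0
  have h3 : 0 < B v (edge w k) * B v (edge w k) := by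
    rw [← neg_mul_neg]
    exact mul_self_pos.2 hv
  simp only [map_add, map_smul, map_neg, LinearMap.add_apply, LinearMap.smul_apply,
    LinearMap.neg_apply, smul_eq_mul] at h1
  nlinarith [mul_pos h2 h3]

theorem exists_eq_of_mem_frontier {x : V} (hx : x ∈ frontier (supportBody B w h)) :
    ∃ j < m, B x (edge w (j + 1)) = h (j + 1) := by
  rw [(hY.isCompact hB hw).isClosed.frontier_eq] at hx
  by_contra! hne
  refine hx.2 (mem_interior.2 ⟨⋂ j ∈ Finset.range m, {y | B y (edge w (j + 1)) < h (j + 1)},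
    ?_, ?_, ?_⟩)
  · intro y hy k
    obtain ⟨j, hj, h1, h2⟩ := hY.exists_index_eq_succ hw k
    rw [← h1, ← h2]
    exact (mem_iInter₂.1 hy j (Finset.mem_range.2 hj)).le
  · exact isOpen_biInter_finset fun j _ =>
      isOpen_lt (continuous_bracket_left B _) continuous_const
  · exact mem_iInter₂.2 fun j hj => (hx.1 _).lt_of_ne (hne j (Finset.mem_range.1 hj))

theorem mem_frontier_iff {x : V} : x ∈ frontier (supportBody B w h) ↔
    x ∈ supportBody B w h ∧ ∃ j < m, B x (edge w (j + 1)) = h (j + 1) := by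
  refine ⟨fun hx => ⟨(hY.isCompact hB hw).isClosed.frontier_subset hx,
    hY.exists_eq_of_mem_frontier hB hw hx⟩, ?_⟩
  rintro ⟨hx, j, -, hj⟩
  rw [(hY.isCompact hB hw).isClosed.frontier_eq]
  exact ⟨hx, fun hi => (lt_of_mem_interior hB hw hi (j + 1)).ne hj⟩

omit [FiniteDimensional ℝ V] hB hw in
theorem eq_of_mem_segment {x : V} {j : ℕ} (hx : x ∈ segment ℝ (Y j) (Y (j + 1))) :
    x ∈ supportBody B w h ∧ B x (edge w (j + 1)) = h (j + 1) := by
  refine ⟨convex_supportBody.segment_subset (hY.mem _) (hY.mem _) hx, ?_⟩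
  obtain ⟨a, b, ha, hb, hab, rfl⟩ := hx
  simp only [map_add, map_smul, LinearMap.add_apply, LinearMap.smul_apply, smul_eq_mul, hY.left,
    hY.right]
  rw [← add_mul, hab, one_mul]

theorem frontier_eq : frontier (supportBody B w h) =
    ⋃ j ∈ Finset.range m, segment ℝ (Y j) (Y (j + 1)) := by
  ext x
  rw [hY.mem_frontier_iff hB hw, mem_iUnion₂]
  constructor
  · rintro ⟨hx, j, hj, hxj⟩
    exact ⟨j, Finset.mem_range.2 hj, hY.mem_segment_of_eq hB hw hx hxj⟩
  · rintro ⟨j, hj, hxj⟩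
    exact ⟨(hY.eq_of_mem_segment hxj).1, j, Finset.mem_range.1 hj,
      (hY.eq_of_mem_segment hxj).2⟩

-- Lines that are not parallel meet in one point. Parallel side lines have opposite outer normals by
-- `not_parallel`, and they cannot coincide because there is an interior point between them.
omit [FiniteDimensional ℝ V] in
theorem segment_inter_finite (hne : (interior (supportBody B w h)).Nonempty) {i j : ℕ}
    (hi : i < m) (hj : j < m) (hij : i ≠ j) :
    (segment ℝ (Y i) (Y (i + 1)) ∩ segment ℝ (Y j) (Y (j + 1))).Finite := by
  refine Subsingleton.finite fun x hx y hy => ?_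
  have hx1 := (hY.eq_of_mem_segment hx.1).2
  have hx2 := (hY.eq_of_mem_segment hx.2).2
  have hy1 := (hY.eq_of_mem_segment hy.1).2
  have hy2 := (hY.eq_of_mem_segment hy.2).2
  by_cases h0 : B (edge w (i + 1)) (edge w (j + 1)) = 0
  · exfalso
    obtain ⟨c, hc⟩ := hne
    have hc1 := lt_of_mem_interior hB hw hc (i + 1)
    have hc2 := lt_of_mem_interior hB hw hc (j + 1)
    rw [hB.swap, neg_eq_zero] at h0
    obtain ⟨κ, hκ⟩ := hB.exists_smul_of_eq_zero (hw.edge_ne_zero hB (i + 1)) h0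
    have hmod : (i + 1) % m ≠ (j + 1) % m := by
      intro h
      have h5 : i ≡ j [MOD m] := Nat.ModEq.add_right_cancel' 1 h
      have h6 : i % m = j % m := h5
      rw [Nat.mod_eq_of_lt hi, Nat.mod_eq_of_lt hj] at h6
      exact hij h6
    have hκ0 : κ ≤ 0 := by
      by_contra! hpos
      exact hw.not_parallel hB hmod hpos hκ
    rw [hκ, map_smul, smul_eq_mul] at hx2 hc2
    rw [hx1] at hx2
    nlinarith
  · exact hB.eq_of_apply h0 (hx1.trans hy1.symm) (hx2.trans hy2.symm)

end IsSupportPolygon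

end SupportBodyTopology

section SupportBodyArea

variable {V : Type*} [NormedAddCommGroup V] [NormedSpace ℝ V] [FiniteDimensional ℝ V]
  [MeasurableSpace V] [BorelSpace V] [Fact (finrank ℝ V = 2)] {ω : V [⋀^Fin 2]→ₗ[ℝ] ℝ}

/-- The shoelace formula. -/
theorem IsSupportPolygon.measure_eq (hω : ω ≠ 0) {m : ℕ} {w : ℕ → V} {h : ℕ → ℝ} {Y : ℕ → V}
    (hw : ConvexCycle (bracket ω) m w) (hY : IsSupportPolygon (bracket ω) m w h Y)
    (hne : (interior (supportBody (bracket ω) w h)).Nonempty) :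
    ω.measure.real (supportBody (bracket ω) w h) =
      (∑ j ∈ Finset.range m, bracket ω (Y j) (Y (j + 1))) / 2 := by
  have hB := isAreaForm_bracket hω
  obtain ⟨c, hc⟩ := hne
  have hf := hY.frontier_eq hB hw
  rw [measure_eq_sum_triangles hω convex_supportBody (hY.isCompact hB hw) hc (Finset.range m)
    Y (fun j => Y (j + 1)) hf.subset
    (fun i hi => by rw [hf]; exact subset_biUnion_of_mem (u := fun j => segment ℝ (Y j) (Y (j + 1))) hi)
    (fun i hi j hj hij => hY.segment_inter_finite hB hw ⟨c, hc⟩ (Finset.mem_range.1 hi)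
      (Finset.mem_range.1 hj) hij)]
  congr 1
  -- Seen from the interior point `c` all triangles are positively oriented, and moving the apex
  -- from `c` to the origin costs a telescoping term.
  have hterm : ∀ j, |bracket ω (Y j - c) (Y (j + 1) - c)| =
      bracket ω (Y j) (Y (j + 1)) - (bracket ω c (Y (j + 1)) - bracket ω c (Y j)) := by
    intro j
    obtain ⟨l, hl, hlj⟩ := hY.exists_length hB hw j
    have h1 := lt_of_mem_interior hB hw hc (j + 1)
    have h2 : bracket ω (Y j - c) (Y (j + 1) - c) =
        l * (h (j + 1) - bracket ω c (edge w (j + 1))) := by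
      rw [hlj, add_sub_right_comm, map_add, hB.self, zero_add, map_smul, map_sub,
        LinearMap.sub_apply, hY.right, smul_eq_mul]
    rw [abs_of_nonneg (by rw [h2]; exact mul_nonneg hl (by linarith))]
    simp only [map_sub, LinearMap.sub_apply, hB.self]
    rw [hB.swap (Y j) c]
    ring
  rw [Finset.sum_congr rfl fun j _ => hterm j, Finset.sum_sub_distrib,
    Finset.sum_range_sub (fun j => bracket ω c (Y j))]
  have : Y m = Y 0 := by rw [← hY.periodic 0, zero_add]
  rw [this, sub_self, sub_zero]

end SupportBodyArea

/-! ### The Minkowski inequality for polygons with parallel sides -/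

section Picone

variable {V : Type*} [AddCommGroup V] [Module ℝ V]
variable {B : V →ₗ[ℝ] V →ₗ[ℝ] ℝ} (hB : IsAreaForm B) {m : ℕ} {w : ℕ → V}
  (hw : ConvexCycle B m w)
include hB hw

/-- A discrete Picone identity: the signed area of a closed polygon `z` whose sides are parallel to
those of `w`, in terms of its support numbers `q j * B (edge w 0) (edge w j)`. -/
theorem ConvexCycle.picone {z : ℕ → V} {q : ℕ → ℝ} (hz : z m = z 0)
    (h1 : ∀ j, j < m → B (z j) (edge w j) = q j * B (edge w 0) (edge w j))
    (h2 : ∀ j, j < m → B (z (j + 1)) (edge w j) = q j * B (edge w 0) (edge w j)) :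
    ∑ j ∈ Finset.range m, B (z j) (z (j + 1)) = -∑ j ∈ Finset.range (m - 1),
      B (edge w 0) (edge w j) * B (edge w 0) (edge w (j + 1)) * (q (j + 1) - q j) ^ 2 /
        B (edge w j) (edge w (j + 1)) := by
  have hm := hw.three_le
  obtain ⟨k, rfl⟩ : ∃ k, m = k + 1 := ⟨m - 1, by omega⟩
  set s : ℕ → ℝ := fun j => B (edge w 0) (edge w j)
  set g : ℕ → ℝ := fun j => B (edge w 0) (z j)
  have hs0 : s 0 = 0 := hB.self _
  have hg0 : g 0 = 0 := by
    have := h1 0 (by omega)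
    rw [hB.self, mul_zero, hB.swap, neg_eq_zero] at this
    exact this
  have hg1 : g 1 = 0 := by
    have := h2 0 (by omega)
    rw [hB.self, mul_zero, hB.swap, neg_eq_zero] at this
    exact this
  have hgk : g (k + 1) = 0 := by
    change B _ (z (k + 1)) = 0
    rw [hz]
    exact hg0
  -- The side `z (j + 1) - z j` is a multiple `ν • edge w j`, and both factors on the right produce
  -- that `ν`.
  have hterm : ∀ j, j < k + 1 → B (z j) (z (j + 1)) = q j * (g (j + 1) - g j) := by
    intro j hj
    have h0 : B (z (j + 1) - z j) (edge w j) = 0 := by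
      rw [map_sub, LinearMap.sub_apply, h1 j hj, h2 j hj, sub_self]
    obtain ⟨ν, hν⟩ := hB.exists_smul_of_eq_zero (hw.edge_ne_zero hB j) h0
    have e1 : B (z j) (z (j + 1)) = ν * B (z j) (edge w j) := by
      rw [← sub_add_cancel (z (j + 1)) (z j), hν, map_add, hB.self, add_zero, map_smul, smul_eq_mul]
    have e2 : g (j + 1) - g j = ν * s j := by
      change B _ _ - B _ _ = _
      rw [← map_sub, hν, map_smul, smul_eq_mul]
    rw [e1, e2, h1 j hj]
    ring
  -- The vertex `z (j + 1)` is recovered from its support numbers on lines `j` and `j + 1`.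
  have hprod : ∀ j, j < k → (q (j + 1) - q j) * g (j + 1) =
      s j * s (j + 1) * (q (j + 1) - q j) ^ 2 / B (edge w j) (edge w (j + 1)) := by
    intro j hj
    have hD := hw.turn hB j
    have hrep := hB.eq_of_support (x := z (j + 1)) hD.ne'
    have e : g (j + 1) = (B (edge w j) (edge w (j + 1)))⁻¹ *
        (q (j + 1) * s (j + 1) * s j - q j * s j * s (j + 1)) := by
      change B (edge w 0) (z (j + 1)) = _
      rw [hrep, h1 (j + 1) (by omega), h2 j (by omega)]
      simp only [map_smul, map_sub, smul_eq_mul]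
      rfl
    rw [e]
    field_simp
  rw [Nat.add_sub_cancel, Finset.sum_congr rfl fun j hj => hterm j (Finset.mem_range.1 hj),
    Finset.sum_range_succ', hg0, hg1, sub_self, mul_zero, add_zero,
    ← Finset.sum_congr rfl fun j hj => hprod j (Finset.mem_range.1 hj), ← Finset.sum_neg_distrib,
    ← sub_eq_zero, ← Finset.sum_sub_distrib]
  -- Summation by parts; the boundary terms vanish since `g 1 = g (k + 1) = 0`.
  have htel : ∀ j, q (j + 1) * (g (j + 1 + 1) - g (j + 1)) - -((q (j + 1) - q j) * g (j + 1)) =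
      q (j + 1) * g (j + 1 + 1) - q j * g (j + 1) := fun j => by ring
  rw [Finset.sum_congr rfl fun j _ => htel j, Finset.sum_range_sub (fun j => q j * g (j + 1)),
    hgk, hg1]
  ring

/-- A functional strictly between two consecutive normals is extremal on the polygon at the single
vertex `w (j + 1)`, whereas the normal of a side is extremal at both ends of the side. -/
theorem ConvexCycle.not_between {j k : ℕ} {α β : ℝ} (hα : 0 < α) (hβ : 0 < β) :
    edge w k ≠ α • edge w j + β • edge w (j + 1) := by
  intro hk
  have hkey : ∀ i, B (edge w k) (w i - w (j + 1)) =
      α * B (edge w j) (w i - w j) + β * B (edge w (j + 1)) (w i - w (j + 1)) := by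
    intro i
    have e : B (edge w j) (w i - w (j + 1)) = B (edge w j) (w i - w j) := by
      have : w i - w (j + 1) = w i - w j - edge w j := by
        rw [edge]
        abel
      rw [this, map_sub, hB.self, sub_zero]
    rw [hk, map_add, LinearMap.add_apply, map_smul, map_smul, LinearMap.smul_apply,
      LinearMap.smul_apply, e]
    rfl
  have hmin : ∀ i, B (edge w k) (w i - w (j + 1)) = 0 → w i = w (j + 1) := by
    intro i hi
    rw [hkey] at hi
    have h1 := hw.left_nonneg hB j i
    have h2 := hw.left_nonneg hB (j + 1) i
    have h3 : B (edge w j) (w i - w j) = 0 := by nlinarith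
    have h4 : B (edge w (j + 1)) (w i - w (j + 1)) = 0 := by nlinarith
    have e : B (edge w j) (w i - w (j + 1)) = 0 := by
      have : w i - w (j + 1) = w i - w j - edge w j := by
        rw [edge]
        abel
      rw [this, map_sub, hB.self, sub_zero, h3]
    rw [hB.swap, neg_eq_zero] at e h4
    exact sub_eq_zero.1 (hB.eq_of_apply (hw.turn hB j).ne' (by rw [e, map_zero]; rfl)
      (by rw [h4, map_zero]; rfl))
  have h1 := hw.left_nonneg hB k (j + 1)
  have h2 : 0 ≤ B (edge w k) (w k - w (j + 1)) := by
    rw [hkey]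
    exact add_nonneg (mul_nonneg hα.le (hw.left_nonneg hB _ _))
      (mul_nonneg hβ.le (hw.left_nonneg hB _ _))
  have h3 : B (edge w k) (w k - w (j + 1)) = 0 := by
    rw [← neg_sub (w (j + 1)), map_neg] at h2 ⊢
    linarith
  have h4 : B (edge w k) (w (k + 1) - w (j + 1)) = 0 := by
    have : w (k + 1) - w (j + 1) = edge w k + (w k - w (j + 1)) := by
      rw [edge]
      abel
    rw [this, map_add, hB.self, h3, add_zero]
  exact hw.edge_ne_zero hB k (by rw [edge, hmin k h3, hmin _ h4, sub_self])

variable {h : ℕ → ℝ} {Y : ℕ → V} (hY : IsSupportPolygon B m w h Y)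
include hY

/-- Minkowski's inequality for the mixed area of two polygons with parallel sides, with the case
of equality. -/
theorem IsSupportPolygon.minkowski (hpos : ∀ k, 0 < h k)
    (hS : 0 < ∑ j ∈ Finset.range m, B (Y j) (Y (j + 1))) :
    (∑ j ∈ Finset.range m, B (w j) (w (j + 1))) * (∑ j ∈ Finset.range m, B (Y j) (Y (j + 1))) ≤
      (∑ j ∈ Finset.range m, h j) ^ 2 ∧
    ((∑ j ∈ Finset.range m, h j) ^ 2 ≤ (∑ j ∈ Finset.range m, B (w j) (w (j + 1))) *
      (∑ j ∈ Finset.range m, B (Y j) (Y (j + 1))) →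
      ∃ (c : V) (t : ℝ), 0 < t ∧ ∀ j, w (j + 1) = c + t • Y j) := by
  have hm := hw.three_le
  obtain ⟨b, hb1, hbm, hsp, hsb, hsn⟩ := hw.exists_turning_index hB
  set s : ℕ → ℝ := fun j => B (edge w 0) (edge w j) with hs
  have hs0 : s 0 = 0 := hB.self _
  -- `y` is `Y` moved back by one index modulo `m`, so that side `j` runs from `y j` to `y (j + 1)`,
  -- as it does for `w`.
  set y : ℕ → V := fun j => Y (j + m - 1) with hy
  have hy1 : ∀ j, y (j + 1) = Y j := fun j => by
    simp only [hy]
    rw [← hY.periodic j]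
    congr 1
    omega
  have hyl : ∀ j, B (y j) (edge w j) = h j := fun j => by
    have h1 := hY.right (j + m - 1)
    have e : j + m - 1 + 1 = j + m := by omega
    rw [e, hw.edge_periodic] at h1
    rw [h1, ← hY.support_mod hw, Nat.add_mod_right, hY.support_mod hw]
  have hyr : ∀ j, B (y (j + 1)) (edge w j) = h j := fun j => by rw [hy1, hY.left]
  have hym : y m = y 0 := by
    obtain ⟨k, rfl⟩ : ∃ k, m = k + 1 := ⟨m - 1, by omega⟩
    rw [hy1]
    simp [hy]
  have hwm : w m = w 0 := by rw [← hw.periodic 0, zero_add]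
  have hSY : ∑ j ∈ Finset.range m, B (Y j) (Y (j + 1)) =
      ∑ j ∈ Finset.range m, B (y j) (y (j + 1)) := by
    have h1 := Finset.sum_range_succ' (fun j => B (y j) (y (j + 1))) m
    rw [Finset.sum_range_succ] at h1
    have h2 : y (m + 1) = y (0 + 1) := by
      rw [hy1, hy1, ← hY.periodic 0, zero_add]
    rw [hym, h2] at h1
    rw [add_right_cancel h1]
    exact Finset.sum_congr rfl fun j _ => by rw [hy1, hy1]
  rw [hSY] at hS ⊢
  set SY := ∑ j ∈ Finset.range m, B (y j) (y (j + 1))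
  set SW := ∑ j ∈ Finset.range m, B (w j) (w (j + 1))
  set L := ∑ j ∈ Finset.range m, h j
  -- The vertex opposite to side `0` lies beyond the origin, because all support numbers are
  -- positive.
  have hneg : B (y (b + 1)) (edge w 0) < 0 := by
    have hD := hw.turn hB b
    have e := hB.eq_of_support (x := y (b + 1)) hD.ne'
    rw [hyl, hyr] at e
    rw [e, hB.swap, neg_lt_zero]
    simp only [map_smul, map_sub, smul_eq_mul]
    refine mul_pos (inv_pos.2 hD) ?_
    have h1 := mul_pos (hpos (b + 1)) (hsp b hb1 le_rfl)
    have h2 := mul_nonneg (hpos b).le (neg_nonneg.2 hsb)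
    linarith
  -- `t` and `c` are chosen so that `c + t • y` shares with `w` the vertex `b + 1` and the line of
  -- side `0`. The support numbers `H` of the difference `z` then vanish at `0`, `b` and `b + 1`,
  -- where `s` changes sign.
  set t : ℝ := B (w (b + 1) - w 0) (edge w 0) / B (y (b + 1) - y 0) (edge w 0)
  set c : V := w (b + 1) - t • y (b + 1)
  have hden : B (y (b + 1) - y 0) (edge w 0) < 0 := by
    rw [map_sub, LinearMap.sub_apply, hyl]
    linarith [hpos 0]
  set z : ℕ → V := fun j => w j - t • y j - c with hz
  set H : ℕ → ℝ := fun j => B (w j) (edge w j) - t * h j - B c (edge w j) with hH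
  have hzl : ∀ j, B (z j) (edge w j) = H j := fun j => by
    simp only [hz, hH, map_sub, map_smul, LinearMap.sub_apply, LinearMap.smul_apply, smul_eq_mul,
      hyl]
  have hzr : ∀ j, B (z (j + 1)) (edge w j) = H j := fun j => by
    have e : B (w (j + 1)) (edge w j) = B (w j) (edge w j) := by
      rw [← sub_eq_zero, ← LinearMap.sub_apply, ← map_sub]
      exact hB.self _
    simp only [hz, hH, map_sub, map_smul, LinearMap.sub_apply, LinearMap.smul_apply, smul_eq_mul,
      hyr, e]
  have hzm : z m = z 0 := by simp only [hz, hwm, hym]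
  have hzb : z (b + 1) = 0 := by simp only [hz, c, sub_self]
  have hHb1 : H (b + 1) = 0 := by rw [← hzl, hzb]; simp
  have hHb : H b = 0 := by rw [← hzr, hzb]; simp
  have hH0 : H 0 = 0 := by
    rw [← hzl]
    have e : z 0 = t • (y (b + 1) - y 0) - (w (b + 1) - w 0) := by
      simp only [hz, c]
      module
    rw [e, map_sub, map_smul, LinearMap.sub_apply, LinearMap.smul_apply, smul_eq_mul,
      div_mul_cancel₀ _ hden.ne, sub_self]
  -- Below `m`, `s` vanishes at `0` and possibly at `b + 1` only, where `H` is zero as well, so the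
  -- value `0` of a division by zero does no harm.
  set q : ℕ → ℝ := fun j => H j / s j with hq
  have hqs : ∀ j, j < m → H j = q j * s j := by
    intro j hj
    by_cases h0 : s j = 0
    · have : H j = 0 := by
        rcases Nat.lt_or_ge j 1 with h1 | h1
        · rw [show j = 0 by omega, hH0]
        rcases Nat.lt_or_ge j (b + 1) with h2 | h2
        · exact absurd h0 (hsp j h1 (by omega)).ne'
        rcases h2.eq_or_lt with h3 | h3
        · rw [← h3, hHb1]
        · exact absurd h0 (hsn j h3 hj).ne
      rw [this, h0, mul_zero]
    · simp only [hq]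
      rw [div_mul_cancel₀ _ h0]
  have hqb : q b = 0 := by simp only [hq, hHb, zero_div]
  have hqb1 : q (b + 1) = 0 := by simp only [hq, hHb1, zero_div]
  have hpic := hw.picone hB (z := z) (q := q) hzm (fun j hj => by rw [hzl, hqs j hj])
    (fun j hj => by rw [hzr, hqs j hj])
  -- Away from the pair `b`, `b + 1` consecutive values of `s` have the same sign or vanish, and at
  -- that pair `q` is zero twice.
  have hterm : ∀ j ∈ Finset.range (m - 1), 0 ≤ s j * s (j + 1) * (q (j + 1) - q j) ^ 2 /
      B (edge w j) (edge w (j + 1)) := by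
    intro j hj
    rw [Finset.mem_range] at hj
    refine div_nonneg ?_ (hw.turn hB j).le
    rcases Nat.lt_or_ge j 1 with h1 | h1
    · rw [show j = 0 by omega, hs0, zero_mul, zero_mul]
    rcases lt_trichotomy j b with h2 | rfl | h2
    · exact mul_nonneg (mul_nonneg (hsp j h1 h2.le).le (hsp (j + 1) (by omega) h2).le) (sq_nonneg _)
    · rw [hqb, hqb1, sub_self]
      simp
    · have h3 : s (j + 1) ≤ 0 := (hsn (j + 1) (by omega) (by omega)).le
      have h4 : s j ≤ 0 := by
        rcases Nat.lt_or_ge j (b + 2) with h5 | h5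
        · rw [show j = b + 1 by omega]
          exact hsb
        · exact (hsn j h5 (by omega)).le
      exact mul_nonneg (mul_nonneg_of_nonpos_of_nonpos h4 h3) (sq_nonneg _)
  set SZ := ∑ j ∈ Finset.range m, B (z j) (z (j + 1)) with hSZ
  have hSZ0 : SZ ≤ 0 := by
    rw [hpic]
    exact neg_nonpos.2 (Finset.sum_nonneg hterm)
  -- Up to telescoping terms both mixed sums equal `L`.
  have hexp : SZ = SW - 2 * t * L + t ^ 2 * SY := by
    have e : ∀ j, B (z j) (z (j + 1)) = B (w j) (w (j + 1)) - 2 * t * h j +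
        t ^ 2 * B (y j) (y (j + 1)) +
        ((-t * B (w (j + 1)) (y (j + 1)) - B c (w (j + 1)) + t * B c (y (j + 1))) -
          (-t * B (w j) (y j) - B c (w j) + t * B c (y j))) := by
      intro j
      have e1 := hyl j
      have e2 := hyr j
      simp only [edge, map_sub] at e1 e2
      simp only [hz, map_sub, map_smul, LinearMap.sub_apply, LinearMap.smul_apply, smul_eq_mul,
        hB.self]
      rw [hB.swap (w j) c, hB.swap (y j) c, hB.swap (w j) (y (j + 1)),
        hB.swap (w (j + 1)) (y (j + 1)), hB.swap (w j) (y j)]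
      linear_combination (-t) * e1 + (-t) * e2
    rw [hSZ, Finset.sum_congr rfl fun j _ => e j, Finset.sum_add_distrib, Finset.sum_add_distrib,
      Finset.sum_sub_distrib, ← Finset.mul_sum, ← Finset.mul_sum,
      Finset.sum_range_sub (fun j => -t * B (w j) (y j) - B c (w j) + t * B c (y j)), hwm, hym,
      sub_self, add_zero]
  -- The quadratic `SW - 2 * t * L + t ^ 2 * SY` in `t` takes a value `≤ 0`, so its discriminant is
  -- nonnegative; completing the square shows this together with the case of equality.
  have hkey : SY * SZ = (t * SY - L) ^ 2 - (L ^ 2 - SW * SY) := by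
    rw [hexp]
    ring
  have hle : SY * SZ ≤ 0 := mul_nonpos_of_nonneg_of_nonpos hS.le hSZ0
  refine ⟨by nlinarith [sq_nonneg (t * SY - L)], fun hLe => ?_⟩
  have hsq : (t * SY - L) ^ 2 = 0 := by nlinarith [sq_nonneg (t * SY - L)]
  have htL : t * SY = L := sub_eq_zero.1 (pow_eq_zero_iff two_ne_zero |>.1 hsq)
  have hSZ' : SZ = 0 := by
    have h1 : SY * SZ = 0 := by
      refine le_antisymm hle ?_
      rw [hkey, hsq]
      linarith
    exact (mul_eq_zero.1 h1).resolve_left hS.ne'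
  have hL : 0 < L := Finset.sum_pos (fun k _ => hpos k) ⟨0, Finset.mem_range.2 (by omega)⟩
  have ht : 0 < t := by
    by_contra! hneg
    nlinarith
  -- Equality kills every Picone term, so `q` is constant along the rising chain and along the
  -- falling chain.
  have hzero : ∀ j, j + 1 < m → s j ≠ 0 → s (j + 1) ≠ 0 → q (j + 1) = q j := by
    intro j hj h1 h2
    have h3 : ∑ j ∈ Finset.range (m - 1), s j * s (j + 1) * (q (j + 1) - q j) ^ 2 /
        B (edge w j) (edge w (j + 1)) = 0 := by
      rw [hSZ'] at hpic
      linarith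
    have h4 := (Finset.sum_eq_zero_iff_of_nonneg hterm).1 h3 j (Finset.mem_range.2 (by omega))
    rw [div_eq_zero_iff, or_iff_left (hw.turn hB j).ne', mul_eq_zero,
      or_iff_right (mul_ne_zero h1 h2), pow_eq_zero_iff two_ne_zero, sub_eq_zero] at h4
    exact h4
  have hHlow : ∀ d, d < b → H (b - d) = 0 := by
    intro d hd
    have hq0 : q (b - d) = 0 := by
      induction d with
      | zero => exact hqb
      | succ d ih =>
        have h1 := hzero (b - (d + 1)) (by omega) (hsp _ (by omega) (by omega)).ne'
          (hsp _ (by omega) (by omega)).ne'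
        rw [← h1, show b - (d + 1) + 1 = b - d by omega]
        exact ih (by omega)
    rw [hqs _ (by omega), hq0, zero_mul]
  have hHlow' : ∀ j, j ≤ b + 1 → H j = 0 := by
    intro j hj
    rcases Nat.lt_or_ge j 1 with h1 | h1
    · rw [show j = 0 by omega, hH0]
    rcases hj.eq_or_lt with h2 | h2
    · rw [h2, hHb1]
    · have := hHlow (b - j) (by omega)
      rwa [show b - (b - j) = j by omega] at this
  -- On the falling chain the constant need not be zero: if side `b + 1` is parallel to side `0`,
  -- then `s (b + 1) = 0` and the link to `q (b + 1) = 0` is lost. That part of `z` may then still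
  -- be a slide along side `0`.
  obtain ⟨r, hr⟩ : ∃ r : ℝ, ∀ j, b + 1 ≤ j → j < m → H j = r * s j := by
    rcases Nat.lt_or_ge (b + 2) m with h1 | h1
    · refine ⟨q (b + 2), fun j hj1 hj2 => ?_⟩
      rcases hj1.eq_or_lt with rfl | hj1
      · rw [hHb1]
        by_cases h2 : s (b + 1) = 0
        · rw [h2, mul_zero]
        · rw [hzero (b + 1) h1 h2 (hsn _ le_rfl h1).ne, hqb1, zero_mul]
      · have hc : ∀ d, b + 2 + d < m → q (b + 2 + d) = q (b + 2) := by
          intro d hd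
          induction d with
          | zero => rfl
          | succ d ih =>
            rw [← ih (by omega)]
            exact hzero (b + 2 + d) hd (hsn (b + 2 + d) (by omega) (by omega)).ne
              (hsn (b + 2 + d + 1) (by omega) hd).ne
        have := hc (j - (b + 2)) (by omega)
        rw [show b + 2 + (j - (b + 2)) = j by omega] at this
        rw [hqs j hj2, this]
    · exact ⟨0, fun j hj1 hj2 => by rw [show j = b + 1 by omega, hHb1, zero_mul]⟩
  have hzlow : ∀ j, j ≤ b → z (j + 1) = 0 := by
    intro j hj
    refine hB.eq_of_apply (hw.turn hB j).ne' ?_ ?_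
    · rw [hzr, hHlow' j (by omega)]
      simp
    · rw [hzl, hHlow' (j + 1) (by omega)]
      simp
  have hzhigh : ∀ j, b + 1 ≤ j → j < m → z (j + 1) = r • edge w 0 := by
    intro j hj1 hj2
    refine hB.eq_of_apply (hw.turn hB j).ne' ?_ ?_
    · rw [hzr, hr j hj1 hj2]
      simp [hs]
    · rw [hzl, map_smul, LinearMap.smul_apply, smul_eq_mul]
      rcases Nat.lt_or_ge (j + 1) m with h1 | h1
      · exact hr _ (by omega) h1
      · have h2 : edge w (j + 1) = edge w 0 := by
          rw [show j + 1 = 0 + m by omega, hw.edge_periodic]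
        rw [h2, hB.self, mul_zero, ← hzl, h2, show j + 1 = m by omega, hzm, hzl, hH0]
  -- The sum equals `L - t * SY`, which vanishes in the case of equality. Evaluated at the values of
  -- `z` just found it leaves `r` times a nonzero width, so the slide is trivial.
  have hE : ∑ j ∈ Finset.range m, B (y j) (z (j + 1) - z j) = 0 := by
    have e : ∀ j, B (y j) (z (j + 1) - z j) = h j - t * B (y j) (y (j + 1)) := by
      intro j
      have e1 : z (j + 1) - z j = edge w j - t • y (j + 1) + t • y j := by
        simp only [hz, edge]
        module
      rw [e1, map_add, map_sub, map_smul, map_smul, hB.self, hyl]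
      simp
    rw [Finset.sum_congr rfl fun j _ => e j, Finset.sum_sub_distrib, ← Finset.mul_sum, htL]
    exact sub_self L
  have hz0 : z 0 = r • edge w 0 := by
    rw [← hzm, show m = m - 1 + 1 by omega]
    exact hzhigh _ (by omega) (by omega)
  have hr0 : r = 0 := by
    have e : ∀ j ∈ Finset.range m, B (y j) (z (j + 1) - z j) =
        (if j = 0 then -r * h 0 else 0) + (if j = b + 1 then r * B (y (b + 1)) (edge w 0) else 0) := by
      intro j hj
      rw [Finset.mem_range] at hj
      rcases Nat.lt_or_ge j 1 with h1 | h1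
      · obtain rfl : j = 0 := by omega
        rw [if_pos rfl, if_neg (by omega), hzlow 0 (by omega), hz0, zero_sub, map_neg, map_smul,
          hyl, smul_eq_mul]
        ring
      rw [if_neg (by omega)]
      obtain ⟨i, rfl⟩ : ∃ i, j = i + 1 := ⟨j - 1, by omega⟩
      rcases lt_trichotomy i b with h2 | rfl | h2
      · rw [if_neg (by omega), hzlow _ (by omega), hzlow _ (by omega)]
        simp
      · rw [if_pos rfl, hzlow i le_rfl, hzhigh _ le_rfl hj]
        simp
      · rw [if_neg (by omega), hzhigh i (by omega) (by omega), hzhigh _ (by omega) hj]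
        simp
    rw [Finset.sum_congr rfl e, Finset.sum_add_distrib, Finset.sum_ite_eq', Finset.sum_ite_eq',
      if_pos (Finset.mem_range.2 (by omega)), if_pos (Finset.mem_range.2 hbm)] at hE
    have h1 : r * (B (y (b + 1)) (edge w 0) - h 0) = 0 := by linarith
    refine (mul_eq_zero.1 h1).resolve_right ?_
    have := hpos 0
    linarith
  have hzall : ∀ j, j < m → z (j + 1) = 0 := by
    intro j hj
    rcases Nat.lt_or_ge j (b + 1) with h1 | h1
    · exact hzlow j (by omega)
    · rw [hzhigh j h1 hj, hr0, zero_smul]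
  refine ⟨c, t, ht, fun j => ?_⟩
  have h1 := hzall (j % m) (Nat.mod_lt _ hw.pos_m)
  simp only [hz] at h1
  rw [hy1, hY.vertex_mod] at h1
  have h2 : w (j % m + 1) = w (j + 1) := by
    rw [← hw.mod, Nat.mod_add_mod, hw.mod]
  rw [h2, sub_sub, sub_eq_zero] at h1
  rw [h1, add_comm]

end Picone

/-! ### The polygon with the directions of `w` circumscribed about an antidisc -/

section Circumscribed

variable {V : Type*} [NormedAddCommGroup V] [NormedSpace ℝ V]
variable {B : V →ₗ[ℝ] V →ₗ[ℝ] ℝ} (hB : IsAreaForm B) {m : ℕ} {w : ℕ → V}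
  (hw : ConvexCycle B m w)
include hB hw

/-- The polygon with the outer normals of `w` whose support function is the norm of the sides. -/
theorem ConvexCycle.exists_isSupportPolygon_norm :
    ∃ Y, IsSupportPolygon B m w (fun k => ‖edge w k‖) Y := by
  -- The intersection point of lines `j` and `j + 1`, in the form of `eq_of_support`.
  refine ⟨fun j => (B (edge w j) (edge w (j + 1)))⁻¹ •
    (‖edge w (j + 1)‖ • edge w j - ‖edge w j‖ • edge w (j + 1)), fun j => ?_, fun j => ?_,
    fun j => ?_, fun j k => ?_⟩
  · rw [add_right_comm, hw.edge_periodic, hw.edge_periodic]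
  · have hD := (hw.turn hB j).ne'
    simp only [map_smul, map_sub, LinearMap.smul_apply, LinearMap.sub_apply, smul_eq_mul, hB.self]
    rw [hB.swap (edge w (j + 1)) (edge w j)]
    field_simp
    ring
  · have hD := (hw.turn hB j).ne'
    simp only [map_smul, map_sub, LinearMap.smul_apply, LinearMap.sub_apply, smul_eq_mul, hB.self]
    field_simp
    ring
  · have hD := hw.turn hB j
    have hdec := hB.decomp hD.ne' (edge w k)
    set u := edge w j
    set v := edge w (j + 1)
    set α := B (edge w k) v / B u v with hα
    set β := B u (edge w k) / B u v with hβ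
    have e : B ((B u v)⁻¹ • (‖v‖ • u - ‖u‖ • v)) (edge w k) = β * ‖v‖ + α * ‖u‖ := by
      simp only [map_smul, map_sub, LinearMap.smul_apply, LinearMap.sub_apply, smul_eq_mul, hα, hβ]
      rw [hB.swap v (edge w k)]
      ring
    rw [e]
    -- With `edge w k = α • u + β • v` the claim `β * ‖v‖ + α * ‖u‖ ≤ ‖edge w k‖` is a triangle
    -- inequality unless `α` and `β` are both positive, and that is excluded by `not_between`.
    rcases le_or_gt α 0 with h1 | h1
    · have h3 : β • v = edge w k - α • u := by
        rw [hdec]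
        abel
      have h4 := norm_sub_le (edge w k) (α • u)
      rw [← h3, norm_smul, norm_smul, Real.norm_of_nonpos h1] at h4
      have h5 : β * ‖v‖ ≤ ‖β‖ * ‖v‖ :=
        mul_le_mul_of_nonneg_right (le_abs_self β) (norm_nonneg v)
      linarith
    rcases le_or_gt β 0 with h2 | h2
    · have h3 : α • u = edge w k - β • v := by
        rw [hdec]
        abel
      have h4 := norm_sub_le (edge w k) (β • v)
      rw [← h3, norm_smul, norm_smul, Real.norm_of_nonpos h2] at h4
      have h5 : α * ‖u‖ ≤ ‖α‖ * ‖u‖ :=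
        mul_le_mul_of_nonneg_right (le_abs_self α) (norm_nonneg u)
      linarith
    exact absurd hdec (hw.not_between hB h1 h2)

omit hB hw in
theorem IsSupportPolygon.homothety {h : ℕ → ℝ} {Y : ℕ → V} (hY : IsSupportPolygon B m w h Y)
    (c : V) {ρ : ℝ} (hρ : 0 ≤ ρ) :
    IsSupportPolygon B m w (fun k => B c (edge w k) + ρ * h k) (fun j => c + ρ • Y j) where
  periodic j := by rw [hY.periodic]
  left j := by simp [hY.left]
  right j := by simp [hY.right]
  mem j k := by
    have := mul_le_mul_of_nonneg_left (hY.mem j k) hρ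
    simpa using this

end Circumscribed

/-! ### The vertices of a convex polygon in cyclic order -/

section Enumeration

variable {V : Type*} [NormedAddCommGroup V] [NormedSpace ℝ V]

/-- A generating subset of least cardinality has no redundant point; its elements serve as the
corners of the hull. -/
theorem exists_minimal_generators {S : Set V} (hS : S.Finite) :
    ∃ E : Finset V, (E : Set V) ⊆ S ∧ convexHull ℝ (E : Set V) = convexHull ℝ S ∧
      ∀ x ∈ E, x ∉ convexHull ℝ ((E : Set V) \ {x}) := by
  classical
  have hex : ∃ k, ∃ E : Finset V, E.card = k ∧ (E : Set V) ⊆ S ∧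
      convexHull ℝ (E : Set V) = convexHull ℝ S :=
    ⟨_, hS.toFinset, rfl, by simp, by simp⟩
  obtain ⟨E, hcard, hES, hE⟩ := Nat.find_spec hex
  refine ⟨E, hES, hE, fun x hx hxE => ?_⟩
  refine Nat.find_min hex (m := (E.erase x).card) ?_ ⟨E.erase x, rfl, ?_, ?_⟩
  · rw [← hcard]
    exact Finset.card_erase_lt_of_mem hx
  · exact (Finset.coe_subset.2 (Finset.erase_subset x E)).trans hES
  · rw [← hE, Finset.coe_erase]
    refine (convexHull_mono sdiff_subset).antisymm (convexHull_min ?_ (convex_convexHull ℝ _))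
    intro y hy
    by_cases hyx : y = x
    · rwa [hyx]
    · exact subset_convexHull ℝ _ ⟨hy, hyx⟩

variable [FiniteDimensional ℝ V] [MeasurableSpace V] [BorelSpace V] [Fact (finrank ℝ V = 2)]
  {ω : V [⋀^Fin 2]→ₗ[ℝ] ℝ}

/-- A convex polygon is the convex hull of a strictly convex cycle. -/
theorem exists_convexCycle (hω : ω ≠ 0) {S : Set V} (hS : S.Finite)
    (hne : (interior (convexHull ℝ S)).Nonempty) :
    ∃ (m : ℕ) (w : ℕ → V), ConvexCycle (bracket ω) m w ∧ range w ⊆ S ∧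
      convexHull ℝ (range w) = convexHull ℝ S := by
  classical
  have hB := isAreaForm_bracket hω
  set B := bracket ω
  obtain ⟨E, hES, hE, hmin⟩ := exists_minimal_generators hS
  have hE0 : E.Nonempty := by
    rw [← Finset.coe_nonempty, ← convexHull_nonempty_iff (𝕜 := ℝ), hE]
    exact hne.mono interior_subset
  obtain ⟨w₀, hw₀⟩ := hE0
  -- Separating the corner `w₀` from the other points puts them in an open half-plane as seen from
  -- `w₀`, so they can be sorted by the slope `σ`.
  obtain ⟨f, u, hf, hfu⟩ := geometric_hahn_banach_point_closed
    (convex_convexHull ℝ ((E : Set V) \ {w₀}))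
    ((E.finite_toSet.sdiff).isCompact_convexHull ℝ).isClosed (hmin w₀ hw₀)
  obtain ⟨d, hd⟩ := hB.exists_repr f.toLinearMap
  have hd' : ∀ x, f x = B d x := hd
  set T := E.erase w₀ with hT
  have hTE : ∀ {x}, x ∈ T → x ∈ E ∧ x ≠ w₀ := fun hx =>
    ⟨Finset.mem_of_mem_erase hx, Finset.ne_of_mem_erase hx⟩
  have hG : ∀ x ∈ T, 0 < B d (x - w₀) := by
    intro x hx
    have h1 := hfu x (subset_convexHull ℝ _ (show x ∈ (E : Set V) \ {w₀} from ⟨(hTE hx).1, (hTE hx).2⟩))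
    rw [map_sub, ← hd', ← hd']
    linarith
  have hmem : ∀ {x : V} {A : Set V}, x ∈ E → A ⊆ (E : Set V) → x ∉ A → x ∉ convexHull ℝ A :=
    fun {x A} hx hA hxA h => hmin _ hx (convexHull_mono
      (show A ⊆ (E : Set V) \ {x} from fun y hy => ⟨hA hy, fun h => hxA (h ▸ hy)⟩) h)
  have hEseg : ∀ a b : V, ¬ (E : Set V) ⊆ segment ℝ a b := by
    intro a b h
    have h1 := convexHull_min h (convex_segment a b)
    rw [hE] at h1
    have h2 := interior_mono h1
    rw [interior_segment hω] at h2
    exact hne.not_subset_empty h2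
  obtain ⟨x₀, hx₀⟩ : T.Nonempty := by
    by_contra hempty
    rw [Finset.not_nonempty_iff_eq_empty] at hempty
    refine hEseg w₀ w₀ fun x hx => ?_
    by_cases h : x = w₀
    · rw [h]
      exact left_mem_segment _ _ _
    · have : x ∈ T := Finset.mem_erase.2 ⟨h, hx⟩
      rw [hempty] at this
      simp at this
  obtain ⟨e, he⟩ : ∃ e, B d e = 1 := by
    have := (hG x₀ hx₀).ne'
    exact ⟨(B d (x₀ - w₀))⁻¹ • (x₀ - w₀), by rw [map_smul, smul_eq_mul, inv_mul_cancel₀ this]⟩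
  set σ : V → ℝ := fun x => B e (x - w₀) / B d (x - w₀) with hσ
  have horient : ∀ a ∈ T, ∀ b ∈ T, orient B w₀ a b =
      B d (a - w₀) * B d (b - w₀) * (σ b - σ a) := by
    intro a ha b hb
    have h1 := hB.cyc_apply d e (a - w₀) (b - w₀)
    rw [he, one_mul, hB.swap (a - w₀) d] at h1
    have ha' := (hG a ha).ne'
    have hb' := (hG b hb).ne'
    simp only [hσ, orient]
    field_simp
    linarith
  -- Equal slopes would put one of the two points on the segment from `w₀` to the other, against
  -- minimality.
  have hinj : ∀ x ∈ T, ∀ y ∈ T, σ x = σ y → x = y := by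
    have key : ∀ x ∈ T, ∀ y ∈ T, σ x = σ y → B d (y - w₀) ≤ B d (x - w₀) → x = y := by
      intro x hx y hy h hle
      by_contra hxy
      have h1 := hB.cyc d (x - w₀) (y - w₀)
      have h2 := horient x hx y hy
      rw [h, sub_self, mul_zero, orient] at h2
      rw [h2, zero_smul, add_zero, hB.swap (y - w₀) d, neg_smul, add_neg_eq_zero] at h1
      have hx' := hG x hx
      have hy' := hG y hy
      have h3 : y - w₀ = (B d (y - w₀) / B d (x - w₀)) • (x - w₀) := by
        rw [div_eq_inv_mul, mul_smul, ← h1, smul_smul, inv_mul_cancel₀ hx'.ne', one_smul]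
      refine hmem (A := {w₀, x}) (hTE hy).1 ?_ ?_ ?_
      · rintro z (rfl | rfl)
        exacts [hw₀, (hTE hx).1]
      · rintro (h | h)
        exacts [(hTE hy).2 h, hxy h.symm]
      · rw [convexHull_pair, segment_eq_image']
        exact ⟨_, ⟨(div_pos hy' hx').le, (div_le_one hx').2 hle⟩, by simp only [← h3]; abel⟩
    intro x hx y hy h
    rcases le_total (B d (y - w₀)) (B d (x - w₀)) with h1 | h1
    · exact key x hx y hy h h1
    · exact (key y hy x hx h.symm h1).symm
  set k := (T.image σ).card with hk
  let emb := (T.image σ).orderEmbOfFin hk.symm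
  have hchoose : ∀ i : Fin k, ∃ x ∈ T, σ x = emb i := fun i =>
    Finset.mem_image.1 ((T.image σ).orderEmbOfFin_mem hk.symm i)
  choose p hpT hpσ using hchoose
  -- `w₀` comes first, then the other points by increasing slope.
  let v : ℕ → V := fun i => if h : 0 < i ∧ i - 1 < k then p ⟨i - 1, h.2⟩ else w₀
  have hv0 : v 0 = w₀ := dif_neg (by omega)
  have hvs : ∀ i (h : i < k), v (i + 1) = p ⟨i, h⟩ := fun i h => by
    have : 0 < i + 1 ∧ i + 1 - 1 < k := by omega
    simp only [v]
    rw [dif_pos this]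
    rfl
  have hvT : ∀ i, 0 < i → i < k + 1 → v i ∈ T := by
    intro i hi hik
    obtain ⟨j, rfl⟩ : ∃ j, i = j + 1 := ⟨i - 1, by omega⟩
    rw [hvs j (by omega)]
    exact hpT _
  have hvσ : ∀ i j, 0 < i → i < j → j < k + 1 → σ (v i) < σ (v j) := by
    intro i j hi hij hj
    obtain ⟨i, rfl⟩ : ∃ i', i = i' + 1 := ⟨i - 1, by omega⟩
    obtain ⟨j, rfl⟩ : ∃ j', j = j' + 1 := ⟨j - 1, by omega⟩
    rw [hvs i (by omega), hvs j (by omega), hpσ, hpσ]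
    exact emb.strictMono (by simpa using hij)
  have hvne : ∀ i j, 0 < i → i < j → j < k + 1 → v i ≠ v j := fun i j hi hij hj h =>
    (hvσ i j hi hij hj).ne (by rw [h])
  have hpos0 : ∀ i j, 0 < i → i < j → j < k + 1 → 0 < orient B w₀ (v i) (v j) := by
    intro i j hi hij hj
    have h1 := hvT i hi (by omega)
    have h2 := hvT j (by omega) hj
    rw [horient _ h1 _ h2]
    exact mul_pos (mul_pos (hG _ h1) (hG _ h2)) (sub_pos.2 (hvσ i j hi hij hj))
  have hpos : ∀ i j l, i < j → j < l → l < k + 1 → 0 < orient B (v i) (v j) (v l) := by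
    intro i j l hij hjl hl
    rcases Nat.eq_zero_or_pos i with rfl | hi
    · rw [hv0]
      exact hpos0 j l hij hjl hl
    -- A turn that is not positive would place `v j` in the triangle `w₀`, `v i`, `v l`; the
    -- coefficients come from `orient_quad`.
    by_contra! hle
    have D2 := hpos0 j l (by omega) hjl hl
    have D3 := hpos0 i l hi (by omega) hl
    have D4 := hpos0 i j hi hij (by omega)
    have hadd := hB.orient_quad_add w₀ (v i) (v j) (v l)
    have hq := hB.orient_quad w₀ (v i) (v j) (v l)
    have hj := hvT j (by omega) (by omega)
    refine hmem (A := {w₀, v i, v l}) (hTE hj).1 ?_ ?_ ?_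
    · rintro z (rfl | rfl | rfl)
      exacts [hw₀, (hTE (hvT i hi (by omega))).1, (hTE (hvT l (by omega) hl)).1]
    · rintro (h | h | h)
      exacts [(hTE hj).2 h, hvne i j hi hij (by omega) h.symm, hvne j l (by omega) hjl hl h]
    · set D1 := orient B (v i) (v j) (v l)
      set E2 := orient B w₀ (v j) (v l)
      set E3 := orient B w₀ (v i) (v l)
      set E4 := orient B w₀ (v i) (v j)
      have hA := convex_convexHull ℝ ({w₀, v i, v l} : Set V)
      have m1 : w₀ ∈ convexHull ℝ ({w₀, v i, v l} : Set V) := subset_convexHull ℝ _ (by simp)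
      have m2 : v i ∈ convexHull ℝ ({w₀, v i, v l} : Set V) := subset_convexHull ℝ _ (by simp)
      have m3 : v l ∈ convexHull ℝ ({w₀, v i, v l} : Set V) := subset_convexHull ℝ _ (by simp)
      have hvj : v j = (-D1 / E3) • w₀ + (E2 / E3) • v i + (E4 / E3) • v l := by
        have h1 : E3 • v j = (-D1) • w₀ + E2 • v i + E4 • v l := by
          rw [add_assoc, ← hq]
          module
        rw [div_eq_inv_mul, div_eq_inv_mul, div_eq_inv_mul, mul_smul, mul_smul, mul_smul,
          ← smul_add, ← smul_add, ← h1, smul_smul, inv_mul_cancel₀ D3.ne', one_smul]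
      have hsum := hA.sum_mem (t := Finset.univ) (w := ![-D1 / E3, E2 / E3, E4 / E3])
        (z := ![w₀, v i, v l]) (fun i _ => by
          fin_cases i
          · exact div_nonneg (by linarith) D3.le
          · exact div_nonneg D2.le D3.le
          · exact div_nonneg D4.le D3.le) (by
          rw [Fin.sum_univ_three]
          change -D1 / E3 + E2 / E3 + E4 / E3 = 1
          rw [← add_div, ← add_div, div_eq_one_iff_eq D3.ne']
          linarith) (fun i _ => by
          fin_cases i
          exacts [m1, m2, m3])
      rw [hvj]
      simpa [Fin.sum_univ_three] using hsum
  set w : ℕ → V := fun j => v (j % (k + 1))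
  have hwv : ∀ j, j < k + 1 → w j = v j := fun j hj => by
    simp only [w]
    rw [Nat.mod_eq_of_lt hj]
  have hwE : range w = E := by
    apply subset_antisymm
    · rintro _ ⟨j, rfl⟩
      have hlt : j % (k + 1) < k + 1 := Nat.mod_lt j (Nat.succ_pos k)
      rcases Nat.eq_zero_or_pos (j % (k + 1)) with h | h
      · change v (j % (k + 1)) ∈ _
        rw [h, hv0]
        exact hw₀
      · exact (hTE (hvT _ h hlt)).1
    · intro x hx
      by_cases h : x = w₀
      · exact ⟨0, by rw [hwv 0 (by omega), hv0, h]⟩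
      · have hxT : x ∈ T := Finset.mem_erase.2 ⟨h, hx⟩
        have h1 : σ x ∈ range emb := by
          rw [Finset.range_orderEmbOfFin]
          exact Finset.mem_coe.2 (Finset.mem_image_of_mem σ hxT)
        obtain ⟨i, hi⟩ := h1
        refine ⟨i + 1, ?_⟩
        rw [hwv _ (by omega), hvs i i.2]
        exact hinj _ (hpT _) _ hxT (by rw [hpσ, ← hi])
  refine ⟨k + 1, w, ⟨?_, fun j => ?_, fun i j l hij hjl hl => ?_⟩, hwE ▸ hES, by rw [hwE, hE]⟩
  · by_contra! hk2
    refine hEseg (v 0) (v 1) ?_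
    rw [← hwE]
    rintro _ ⟨j, rfl⟩
    have hlt : j % (k + 1) < k + 1 := Nat.mod_lt j (Nat.succ_pos k)
    have : j % (k + 1) = 0 ∨ j % (k + 1) = 1 := by omega
    change v (j % (k + 1)) ∈ _
    rcases this with h | h <;> rw [h]
    exacts [left_mem_segment _ _ _, right_mem_segment _ _ _]
  · simp [w]
  · rw [hwv i (by omega), hwv j (by omega), hwv l hl]
    exact hpos i j l hij hjl hl

end Enumeration

/-! ### Shortest tours through points in convex position -/

section Tour

variable {V : Type*} [NormedAddCommGroup V]

/-- The length of the path from `a` through the points of a list to `z`. -/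
def pathLen : V → List V → V → ℝ
  | a, [], z => dist a z
  | a, b :: l, z => dist a b + pathLen b l z

/-- The length of the closed tour through the points of a list. -/
def tourLen : List V → ℝ
  | [] => 0
  | a :: l => pathLen a l a

theorem pathLen_append (a b z : V) (l₁ l₂ : List V) :
    pathLen a (l₁ ++ b :: l₂) z = pathLen a l₁ b + pathLen b l₂ z := by
  induction l₁ generalizing a with
  | nil => rfl
  | cons c l ih =>
    simp only [List.cons_append, pathLen, ih]
    ring

theorem tourLen_append_comm (l₁ l₂ : List V) : tourLen (l₁ ++ l₂) = tourLen (l₂ ++ l₁) := by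
  cases l₁ with
  | nil => simp
  | cons a l₁ =>
    cases l₂ with
    | nil => simp
    | cons b l₂ =>
      simp only [List.cons_append, tourLen, pathLen_append]
      ring

theorem pathLen_le_cons (a b z : V) (l : List V) : pathLen a l z ≤ dist a b + pathLen b l z := by
  cases l with
  | nil => exact dist_triangle _ _ _
  | cons c l =>
    simp only [pathLen]
    linarith [dist_triangle a b c]

theorem pathLen_le_add (a y z : V) (l : List V) : pathLen a l z ≤ pathLen a l y + dist y z := by
  induction l generalizing a with
  | nil => exact dist_triangle _ _ _
  | cons c l ih =>
    simp only [pathLen]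
    linarith [ih c]

theorem pathLen_sublist {l l' : List V} (h : List.Sublist l' l) (a z : V) :
    pathLen a l' z ≤ pathLen a l z := by
  induction h generalizing a with
  | slnil => rfl
  | cons b _ ih => exact (pathLen_le_cons a b z _).trans (add_le_add_right (ih b) _)
  | cons_cons b _ ih => exact add_le_add_right (ih b) _

theorem tourLen_nonneg (l : List V) : 0 ≤ tourLen l := by
  have : ∀ (l : List V) (a z : V), 0 ≤ pathLen a l z := by
    intro l
    induction l with
    | nil => exact fun _ _ => dist_nonneg
    | cons b l ih => exact fun _ _ => add_nonneg dist_nonneg (ih _ _)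
  cases l with
  | nil => exact le_rfl
  | cons a l => exact this _ _ _

theorem tourLen_sublist {l l' : List V} (h : List.Sublist l' l) : tourLen l' ≤ tourLen l := by
  induction h with
  | slnil => rfl
  | @cons l₁ l₂ b _ ih =>
    refine ih.trans ?_
    cases l₂ with
    | nil => exact tourLen_nonneg [b]
    | cons c l =>
      simp only [tourLen, pathLen]
      linarith [pathLen_le_add c b c l]
  | cons_cons b h _ => exact pathLen_sublist h b b

theorem pathLen_getLast (q : V) (l : List V) (y z : V) :
    pathLen q l y - dist ((q :: l).getLast (List.cons_ne_nil _ _)) y =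
      pathLen q l z - dist ((q :: l).getLast (List.cons_ne_nil _ _)) z := by
  induction l generalizing q with
  | nil => simp [pathLen]
  | cons c l ih =>
    rw [List.getLast_cons (List.cons_ne_nil _ _)]
    simp only [pathLen]
    linarith [ih c]

/-- This isolates the cost of inserting `w` between the last point and the first, so that two
insertions can be compared. -/
theorem tourLen_cons_cons (w q : V) (l : List V) :
    tourLen (w :: q :: l) = tourLen (q :: l) + dist w q +
      dist ((q :: l).getLast (List.cons_ne_nil _ _)) w -
      dist ((q :: l).getLast (List.cons_ne_nil _ _)) q := by
  have := pathLen_getLast q l w q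
  simp only [tourLen, pathLen]
  linarith

theorem tourLen_map_range {u : ℕ → V} {n : ℕ} (hn : 0 < n) (hu : u n = u 0) :
    tourLen ((List.range n).map u) = ∑ j ∈ Finset.range n, dist (u j) (u (j + 1)) := by
  have key : ∀ (k i : ℕ) (z : V), pathLen (u i) ((List.range' (i + 1) k).map u) z =
      ∑ j ∈ Finset.range k, dist (u (i + j)) (u (i + j + 1)) + dist (u (i + k)) z := by
    intro k
    induction k with
    | zero => intro i z; simp [pathLen]
    | succ k ih =>
      intro i z
      rw [List.range'_succ, List.map_cons, pathLen, ih, Finset.sum_range_succ']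
      have e : ∀ j, i + 1 + j = i + (j + 1) := fun j => by omega
      simp only [e, add_zero]
      ring
  obtain ⟨k, rfl⟩ : ∃ k, n = k + 1 := ⟨n - 1, by omega⟩
  rw [List.range_eq_range', List.range'_succ, List.map_cons, tourLen, key, Finset.sum_range_succ]
  simp [← hu]

omit [NormedAddCommGroup V] in
theorem sublist_pair_or {l : List V} {x y : V} (hx : x ∈ l) (hy : y ∈ l) (hxy : x ≠ y) :
    List.Sublist [x, y] l ∨ List.Sublist [y, x] l := by
  induction l with
  | nil => simp at hx
  | cons a l ih =>
    rcases List.mem_cons.1 hx with rfl | hx'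
    · left
      exact (List.singleton_sublist.2 ((List.mem_cons.1 hy).resolve_left hxy.symm)).cons_cons _
    rcases List.mem_cons.1 hy with rfl | hy'
    · right
      exact (List.singleton_sublist.2 hx').cons_cons _
    · exact (ih hx' hy').imp (List.Sublist.cons _) (List.Sublist.cons _)

variable [NormedSpace ℝ V] {B : V →ₗ[ℝ] V →ₗ[ℝ] ℝ} (hB : IsAreaForm B)
include hB

/-- The diagonals of a convex quadrilateral are together at least as long as two opposite sides. -/
theorem IsAreaForm.dist_quad {a b c d : V} (h1 : 0 < orient B b c d) (h2 : 0 < orient B a c d)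
    (h3 : 0 < orient B a b d) (h4 : 0 < orient B a b c) :
    dist a b + dist c d ≤ dist a c + dist b d ∧ dist b c + dist a d ≤ dist a c + dist b d := by
  have hadd := hB.orient_quad_add a b c d
  have hq := hB.orient_quad a b c d
  set D1 := orient B b c d
  set D2 := orient B a c d
  set D3 := orient B a b d
  set D4 := orient B a b c
  have hs : 0 < D1 + D3 := by linarith
  obtain ⟨x, hx1, hx2⟩ : ∃ x, x ∈ segment ℝ a c ∧ x ∈ segment ℝ b d := by
    refine ⟨(D1 + D3)⁻¹ • (D1 • a + D3 • c), ⟨D1 / (D1 + D3), D3 / (D1 + D3), by positivity,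
      by positivity, by field_simp, ?_⟩, ⟨D2 / (D1 + D3), D4 / (D1 + D3), by positivity,
      by positivity, ?_, ?_⟩⟩
    · rw [div_eq_inv_mul, div_eq_inv_mul, mul_smul, mul_smul, smul_add]
    · rw [← add_div, ← hadd, div_self hs.ne']
    · rw [hq, div_eq_inv_mul, div_eq_inv_mul, mul_smul, mul_smul, smul_add]
  have e1 := dist_add_dist_of_mem_segment hx1
  have e2 := dist_add_dist_of_mem_segment hx2
  constructor
  · have t1 := dist_triangle a x b
    have t2 := dist_triangle c x d
    rw [dist_comm x b] at t1
    rw [dist_comm c x] at t2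
    linarith
  · have t1 := dist_triangle b x c
    have t2 := dist_triangle a x d
    linarith

/-- In a convex polygon it is cheapest to insert a vertex between its two neighbours. -/
theorem IsAreaForm.insertion_le {w b q p : V} {R : List V}
    (hW : ∀ x y z, List.Sublist [x, y, z] (w :: b :: R) → 0 < orient B x y z) (hR : R ≠ [])
    (hqp : List.Sublist [q, p] (b :: R)) :
    dist w b + dist (R.getLast hR) w + dist p q ≤
      dist w q + dist p w + dist (R.getLast hR) b := by
  set a := R.getLast hR
  have hquad : ∀ {c d : V}, List.Sublist [c, d] R →
      dist w b + dist c d ≤ dist w c + dist b d ∧ dist b c + dist w d ≤ dist w c + dist b d := by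
    intro c d h
    have hc : List.Sublist [c] R := (List.Sublist.cons_cons c (List.nil_sublist [d])).trans h
    have hd : List.Sublist [d] R := (List.sublist_cons_self c [d]).trans h
    exact hB.dist_quad (hW _ _ _ ((h.cons_cons b).cons w)) (hW _ _ _ ((h.cons b).cons_cons w))
      (hW _ _ _ ((hd.cons_cons b).cons_cons w)) (hW _ _ _ ((hc.cons_cons b).cons_cons w))
  have hpR : p ∈ R := by
    cases hqp with
    | cons _ h => exact h.subset (by simp)
    | cons_cons _ h => exact List.singleton_sublist.1 h
  -- Quadrilateral `w, b, p, a` with diagonals `wp` and `ba`; it degenerates if `p = a`.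
  have h1 : dist a w + dist b p ≤ dist a b + dist w p := by
    by_cases hpa : p = a
    · rw [hpa, dist_comm a w, dist_comm a b, add_comm]
    · have hsplit := List.dropLast_append_getLast hR
      have hp : p ∈ R.dropLast := by
        rw [← hsplit, List.mem_append, List.mem_singleton] at hpR
        exact hpR.resolve_right hpa
      have hsub : List.Sublist [p, a] R := by
        rw [← hsplit]
        exact (List.singleton_sublist.2 hp).append (List.Sublist.refl [a])
      have := (hquad hsub).2
      rw [dist_comm a w, dist_comm a b]
      linarith
  -- Quadrilateral `w, b, q, p` with diagonals `wq` and `bp`; it degenerates if `q = b`.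
  have h2 : dist w b + dist p q ≤ dist w q + dist b p := by
    cases hqp with
    | cons _ h =>
      rw [dist_comm p q]
      exact (hquad h).1
    | cons_cons _ h => rw [dist_comm p b]
  rw [dist_comm p w]
  linarith

/-- Induction on the number of points. Rotate the tour `l` so that it starts at `w` and remove `w`;
the rest is no shorter than the convex tour of the remaining points. Putting `w` back costs least
between its neighbours in the convex order, by `insertion_le`, applied to the tour or to its
reversal. -/
theorem IsAreaForm.tourLen_le {W l : List V} (hnd : W.Nodup)
    (hW : ∀ x y z, List.Sublist [x, y, z] W → 0 < orient B x y z) (hl : l.Perm W) :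
    tourLen W ≤ tourLen l := by
  induction W generalizing l with
  | nil => rw [hl.eq_nil]
  | cons w W ih =>
    obtain ⟨l₁, l₂, rfl⟩ := List.append_of_mem (hl.symm.subset List.mem_cons_self)
    have hl' : (l₂ ++ l₁).Perm W :=
      List.perm_append_comm.trans ((List.perm_middle.symm.trans hl).cons_inv)
    rw [tourLen_append_comm, List.cons_append]
    have ih' := ih hnd.of_cons (fun x y z h => hW x y z (h.cons w)) hl'
    generalize l₂ ++ l₁ = l at hl' ih'
    match W, l, hl' with
    | [], l, hl' => rw [hl'.eq_nil]
    | [b], l, hl' => rw [List.perm_singleton.1 hl']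
    | b :: c :: R, [], hl' => exact absurd hl'.length_eq (by simp)
    | b :: c :: R, [q], hl' => exact absurd hl'.length_eq (by simp)
    | b :: c :: R, q :: r :: l, hl' =>
      rw [tourLen_cons_cons w b, tourLen_cons_cons w q]
      rw [List.getLast_cons (List.cons_ne_nil _ _), List.getLast_cons (List.cons_ne_nil _ _)]
      set p := (r :: l).getLast (List.cons_ne_nil _ _)
      have hnd' := hl'.nodup_iff.2 hnd.of_cons
      have hp : p ∈ r :: l := List.getLast_mem _
      have hqp : q ≠ p := fun h => (List.nodup_cons.1 hnd').1 (h ▸ hp)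
      have hqW : q ∈ b :: c :: R := hl'.subset List.mem_cons_self
      have hpW : p ∈ b :: c :: R := hl'.subset (List.mem_cons_of_mem _ hp)
      rcases sublist_pair_or hqW hpW hqp with h | h
      · have := hB.insertion_le hW (List.cons_ne_nil _ _) h
        linarith
      · have := hB.insertion_le hW (List.cons_ne_nil _ _) h
        rw [dist_comm w p, dist_comm q w, dist_comm q p] at this
        linarith

variable {m n : ℕ} {w : ℕ → V} (hw : ConvexCycle B m w)
include hw

/-- Deleting the vertices of `P` outside the cycle does not lengthen the tour; what remains is a
permutation of the cycle, and the convex order is shortest. -/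
theorem ConvexCycle.perimeter_le (hn : 0 < n) {P : Polygon V n}
    (hP : Function.Injective P.vertices) (hsub : range w ⊆ range P.vertices) :
    ∑ j ∈ Finset.range m, ‖edge w j‖ ≤ perimeter P := by
  classical
  have hperP : perimeter P = tourLen ((List.range n).map (vtx hn P)) := by
    rw [tourLen_map_range hn (by rw [← vtx_add hn P 0, zero_add]), perimeter,
      Finset.sum_range fun j => dist (vtx hn P j) (vtx hn P (j + 1))]
    refine Finset.sum_congr rfl fun i _ => ?_
    rw [vtx_fin, vtx_succ_fin, dist_comm, dist_eq_norm]
  have hperw : ∑ j ∈ Finset.range m, ‖edge w j‖ = tourLen ((List.range m).map w) := by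
    rw [tourLen_map_range hw.pos_m (by rw [← hw.periodic 0, zero_add])]
    refine Finset.sum_congr rfl fun j _ => ?_
    rw [dist_comm, dist_eq_norm]
    rfl
  rw [hperP, hperw]
  have hndw : ((List.range m).map w).Nodup :=
    List.Nodup.map_on (fun x hx y hy h => hw.inj hB (List.mem_range.1 hx) (List.mem_range.1 hy) h)
      List.nodup_range
  have hndP : ((List.range n).map (vtx hn P)).Nodup := by
    refine List.Nodup.map_on (fun x hx y hy h => ?_) List.nodup_range
    have h1 := congrArg Fin.val (hP h)
    simp only at h1
    rwa [Nat.mod_eq_of_lt (List.mem_range.1 hx), Nat.mod_eq_of_lt (List.mem_range.1 hy)] at h1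
  have hfil : List.Sublist (((List.range n).map (vtx hn P)).filter (fun x => x ∈ range w))
      ((List.range n).map (vtx hn P)) := List.filter_sublist
  refine le_trans (hB.tourLen_le hndw ?_ ?_) (tourLen_sublist hfil)
  · intro x y z h
    obtain ⟨l, hl, he⟩ := List.sublist_map_iff.1 h
    match l, he with
    | [i, j, k], he =>
      simp only [List.map_cons, List.map_nil, List.cons.injEq, and_true] at he
      obtain ⟨rfl, rfl, rfl⟩ := he
      have hlt := List.pairwise_lt_range.sublist hl
      simp only [List.pairwise_cons, List.mem_cons, List.not_mem_nil, or_false, forall_eq_or_imp,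
        forall_eq] at hlt
      exact hw.pos i j k hlt.1.1 hlt.2.1 (List.mem_range.1 (hl.subset (by simp)))
  · refine (List.perm_ext_iff_of_nodup (hndP.filter _) hndw).2 fun x => ?_
    simp only [List.mem_filter, List.mem_map, List.mem_range, decide_eq_true_eq]
    constructor
    · rintro ⟨-, j, rfl⟩
      exact ⟨j % m, Nat.mod_lt _ hw.pos_m, hw.mod j⟩
    · rintro ⟨j, hj, rfl⟩
      refine ⟨?_, j, rfl⟩
      obtain ⟨i, hi⟩ := hsub (mem_range_self j)
      exact ⟨i, i.2, by rw [vtx_fin, ← hi]⟩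

theorem ConvexCycle.card_le {P : Polygon V n} (hsub : range w ⊆ range P.vertices) : m ≤ n := by
  have hex : ∀ j : Fin m, ∃ i : Fin n, P i = w j := fun j => hsub (mem_range_self (j : ℕ))
  choose f hf using hex
  have hinj : Function.Injective f := fun i j h =>
    Fin.ext (hw.inj hB i.2 j.2 (by rw [← hf i, ← hf j, h]))
  simpa using Fintype.card_le_of_injective f hinj

end Tour

/-! ### Simple polygons along the frontier of a convex polygon -/

section Path

variable {V : Type*} [AddCommGroup V] [Module ℝ V]

/-- The closed polygonal path through the points `w j`, at unit speed with respect to the index. -/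
def polyPath (w : ℕ → V) (s : ℝ) : V := w ⌊s⌋₊ + (s - ⌊s⌋₊) • edge w ⌊s⌋₊

theorem polyPath_eq (w : ℕ → V) {s : ℝ} {j : ℕ} (h1 : (j : ℝ) ≤ s) (h2 : s ≤ j + 1) :
    polyPath w s = w j + (s - j) • edge w j := by
  rcases h2.eq_or_lt with rfl | h2
  · have : ⌊(j : ℝ) + 1⌋₊ = j + 1 := by exact_mod_cast Nat.floor_natCast (R := ℝ) (j + 1)
    rw [polyPath, this]
    push_cast
    rw [sub_self, zero_smul, add_zero, add_sub_cancel_left, one_smul, edge, add_sub_cancel]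
  · have : ⌊s⌋₊ = j := (Nat.floor_eq_iff ((Nat.cast_nonneg j).trans h1)).2 ⟨h1, h2⟩
    rw [polyPath, this]

theorem polyPath_natCast (w : ℕ → V) (j : ℕ) : polyPath w j = w j := by
  rw [polyPath_eq w le_rfl (by linarith), sub_self, zero_smul, add_zero]

theorem polyPath_mem_segment (w : ℕ → V) {j : ℕ} {a b s : ℝ} (ha : (j : ℝ) ≤ a) (hb : b ≤ j + 1)
    (h1 : a ≤ s) (h2 : s ≤ b) : polyPath w s ∈ segment ℝ (polyPath w a) (polyPath w b) := by
  rw [polyPath_eq w (ha.trans h1) (h2.trans hb), polyPath_eq w ha (by linarith),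
    polyPath_eq w (by linarith) hb]
  rcases (h1.trans h2).eq_or_lt with rfl | hlt
  · rw [le_antisymm h2 h1]
    exact left_mem_segment _ _ _
  · have h0 : 0 < b - a := by linarith
    rw [segment_eq_image']
    refine ⟨(s - a) / (b - a), ⟨div_nonneg (by linarith) h0.le, (div_le_one h0).2 (by linarith)⟩, ?_⟩
    have e : w j + (b - j) • edge w j - (w j + (a - j) • edge w j) = (b - a) • edge w j := by
      module
    simp only
    rw [e, smul_smul, div_mul_cancel₀ _ h0.ne']
    module

theorem exists_polyPath_of_mem_segment (w : ℕ → V) {j : ℕ} {a b : ℝ} (ha : (j : ℝ) ≤ a)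
    (hb : b ≤ j + 1) (hab : a ≤ b) {x : V} (hx : x ∈ segment ℝ (polyPath w a) (polyPath w b)) :
    ∃ s, a ≤ s ∧ s ≤ b ∧ x = polyPath w s := by
  rw [polyPath_eq w ha (by linarith), polyPath_eq w (by linarith) hb, segment_eq_image'] at hx
  obtain ⟨θ, hθ, rfl⟩ := hx
  have h1 : a ≤ a + θ * (b - a) := by nlinarith [hθ.1]
  have h2 : a + θ * (b - a) ≤ b := by nlinarith [hθ.2]
  refine ⟨a + θ * (b - a), h1, h2, ?_⟩
  rw [polyPath_eq w (ha.trans h1) (h2.trans hb)]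
  module

variable {B : V →ₗ[ℝ] V →ₗ[ℝ] ℝ} (hB : IsAreaForm B) {m : ℕ} {w : ℕ → V}
  (hw : ConvexCycle B m w)
include hB hw

/-- A point of side `k` other than its final end has positive weight at `w k`. If it lies on the
line of side `j`, then so does `w k`, hence `k` is `j` or `j + 1` modulo `m`. By symmetry `j` is `k`
or `k + 1`, and `m ≥ 3` leaves `j = k`. -/
theorem ConvexCycle.polyPath_injOn {s t : ℝ} (hs : 0 ≤ s) (hsm : s < m) (ht : 0 ≤ t)
    (htm : t < m) (h : polyPath w s = polyPath w t) : s = t := by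
  have hm := hw.three_le
  have key : ∀ {s t : ℝ}, 0 ≤ s → 0 ≤ t → polyPath w s = polyPath w t →
      ⌊t⌋₊ % m = ⌊s⌋₊ % m ∨ ⌊t⌋₊ % m = (⌊s⌋₊ + 1) % m := by
    intro s t hs ht h
    have h1 := Nat.floor_le ht
    have h2 := Nat.lt_floor_add_one t
    set j := ⌊s⌋₊
    set k := ⌊t⌋₊
    have e1 : B (edge w j) (polyPath w s - w j) = 0 := by
      have e : polyPath w s - w j = (s - j) • edge w j := add_sub_cancel_left _ _
      rw [e, map_smul, hB.self, smul_zero]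
    have e2 : polyPath w t - w j = (1 - (t - k)) • (w k - w j) + (t - k) • (w (k + 1) - w j) := by
      change w k + (t - k) • (w (k + 1) - w k) - w j = _
      module
    rw [h, e2, map_add, map_smul, map_smul, smul_eq_mul, smul_eq_mul] at e1
    refine hw.mod_of_left_eq hB ?_
    have n1 := hw.left_nonneg hB j k
    have n2 := hw.left_nonneg hB j (k + 1)
    have h3 : 0 < 1 - (t - k) := by linarith
    have h4 : 0 ≤ t - k := by linarith
    have p1 := mul_nonneg h3.le n1
    have p2 := mul_nonneg h4 n2
    have : (1 - (t - k)) * B (edge w j) (w k - w j) = 0 := by linarith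
    exact (mul_eq_zero.1 this).resolve_left h3.ne'
  have hj : ⌊s⌋₊ < m := (Nat.floor_lt hs).2 hsm
  have hk : ⌊t⌋₊ < m := (Nat.floor_lt ht).2 htm
  have hjk : ⌊s⌋₊ = ⌊t⌋₊ := by
    have k1 := key hs ht h
    have k2 := key ht hs h.symm
    rw [Nat.mod_eq_of_lt hj, Nat.mod_eq_of_lt hk] at k1 k2
    by_contra hne
    have k1' := k1.resolve_left (Ne.symm hne)
    have k2' := k2.resolve_left hne
    rcases Nat.lt_or_ge (⌊s⌋₊ + 1) m with h1 | h1
    · rw [Nat.mod_eq_of_lt h1] at k1'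
      rcases Nat.lt_or_ge (⌊t⌋₊ + 1) m with h2 | h2
      · rw [Nat.mod_eq_of_lt h2] at k2'
        omega
      · rw [show ⌊t⌋₊ + 1 = m by omega, Nat.mod_self] at k2'
        omega
    · rw [show ⌊s⌋₊ + 1 = m by omega, Nat.mod_self] at k1'
      rw [k1', Nat.mod_eq_of_lt (by omega)] at k2'
      omega
  rw [polyPath, polyPath, hjk] at h
  have h1 := add_left_cancel h
  have h2 := smul_left_injective ℝ (hw.edge_ne_zero hB ⌊t⌋₊) h1
  simpa using h2

end Path

/-! ### A simple `n`-gon tracing a strictly convex cycle. -/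

section Construction

theorem ConvexCycle.range_shift {V : Type*} [AddCommGroup V] [Module ℝ V]
    {B : V →ₗ[ℝ] V →ₗ[ℝ] ℝ} {m : ℕ} {w : ℕ → V} (hw : ConvexCycle B m w) :
    range (fun j => w (j + 1)) = range w := by
  have hm := hw.three_le
  apply subset_antisymm
  · rintro _ ⟨j, rfl⟩
    exact ⟨j + 1, rfl⟩
  · rintro _ ⟨j, rfl⟩
    refine ⟨j + m - 1, ?_⟩
    simp only
    rw [show j + m - 1 + 1 = j + m by omega, hw.periodic]

variable {V : Type*} [NormedAddCommGroup V] [NormedSpace ℝ V]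
variable {B : V →ₗ[ℝ] V →ₗ[ℝ] ℝ} (hB : IsAreaForm B) {m n : ℕ} {w : ℕ → V}
  (hw : ConvexCycle B m w)
include hB hw

/-- A strictly convex cycle of at most `n` points is the boundary of a simple `n`-gon: the
superfluous vertices are put on the last side. -/
theorem ConvexCycle.exists_isSimple (hmn : m ≤ n) :
    ∃ Q : Polygon V n, IsSimple Q ∧ Q.boundary ℝ = ⋃ j : ℕ, segment ℝ (w j) (w (j + 1)) := by
  have hm := hw.three_le
  have hn : 0 < n := by omega
  have hmR : (m : ℝ) ≤ n := by exact_mod_cast hmn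
  have hN : (0 : ℝ) < n - m + 1 := by linarith
  have hm1 : ((m - 1 : ℕ) : ℝ) = m - 1 := by
    rw [Nat.cast_sub (by omega), Nat.cast_one]
  -- Parameters of the new vertices on the path: the integers up to `m - 1`, then the `n - m`
  -- superfluous ones evenly spaced in the last interval, so that `t n = m` closes up.
  let t : ℕ → ℝ := fun i => if i < m then i else m - 1 + (i - (m - 1)) / (n - m + 1)
  have ht1 : ∀ i, i < m → t i = i := fun i hi => if_pos hi
  have ht2 : ∀ i, m - 1 ≤ i → t i = m - 1 + (i - (m - 1)) / (n - m + 1) := by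
    intro i hi
    rcases Nat.lt_or_ge i m with h | h
    · have : i = m - 1 := by omega
      rw [ht1 i h, this, hm1, sub_self, zero_div, add_zero]
    · exact if_neg (by omega)
  have ht0 : t 0 = 0 := by rw [ht1 0 (by omega), Nat.cast_zero]
  have htn : t n = m := by
    rw [ht2 n (by omega)]
    have : (n : ℝ) - (m - 1) = n - m + 1 := by ring
    rw [this, div_self hN.ne']
    ring
  have hlt : ∀ i, t i < t (i + 1) := by
    intro i
    rcases Nat.lt_or_ge (i + 1) m with h | h
    · rw [ht1 i (by omega), ht1 _ h]
      push_cast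
      linarith
    · rw [ht2 i (by omega), ht2 (i + 1) (by omega)]
      push_cast
      have : ((i : ℝ) - (m - 1)) / (n - m + 1) < (i + 1 - (m - 1)) / (n - m + 1) :=
        div_lt_div_of_pos_right (by linarith) hN
      linarith
  have hmono : StrictMono t := strictMono_nat_of_lt_succ hlt
  have hpiece : ∀ i, i < n → ∃ j : ℕ, (j : ℝ) ≤ t i ∧ t (i + 1) ≤ j + 1 := by
    intro i hi
    rcases Nat.lt_or_ge (i + 1) m with h | h
    · refine ⟨i, (ht1 i (by omega)).ge, ?_⟩
      rw [ht1 _ h]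
      push_cast
      exact le_rfl
    · refine ⟨m - 1, ?_, ?_⟩
      · rw [← ht1 (m - 1) (by omega)]
        exact hmono.monotone (by omega)
      · rw [hm1, sub_add_cancel, ← htn]
        exact hmono.monotone (by omega)
  have hper : polyPath w m = polyPath w 0 := by
    have h0 := polyPath_natCast w 0
    rw [Nat.cast_zero] at h0
    rw [h0, polyPath_natCast, ← hw.periodic 0, zero_add]
  let Q : Polygon V n := ⟨fun i => polyPath w (t i)⟩
  have hQ : ∀ i : Fin n, Q i = polyPath w (t i) := fun _ => rfl
  have hQs : ∀ i : Fin n, Q (finRotate n i) = polyPath w (t (i + 1)) := by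
    intro i
    rw [finRotate_eq hn, hQ]
    simp only
    rcases Nat.lt_or_ge (i + 1) n with h | h
    · rw [Nat.mod_eq_of_lt h]
    · have : (i : ℕ) + 1 = n := by omega
      rw [this, Nat.mod_self, ht0, htn, hper]
  have hside : ∀ (i : Fin n) (x : V), x ∈ Q.edgeSet ℝ i ↔
      ∃ s, t i ≤ s ∧ s ≤ t (i + 1) ∧ x = polyPath w s := by
    intro i x
    rw [edgeSet_eq_segment, hQ, hQs]
    obtain ⟨j, hj1, hj2⟩ := hpiece i i.2
    constructor
    · exact exists_polyPath_of_mem_segment w hj1 hj2 (hlt i).le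
    · rintro ⟨s, h1, h2, rfl⟩
      exact polyPath_mem_segment w hj1 hj2 h1 h2
  have htnn : ∀ i, 0 ≤ t i := fun i => ht0 ▸ hmono.monotone (Nat.zero_le i)
  have htm : ∀ i, i < n → t i < m := fun i hi => htn ▸ hmono hi
  -- Sides are images of consecutive parameter intervals and the path is injective on `[0, m)`. So
  -- two sides meet only at a shared parameter, or where the parameter `m` returns to `0`.
  have hadj : ∀ i j : Fin n, i < j → ∀ x ∈ Q.edgeSet ℝ i ∩ Q.edgeSet ℝ j,
      (j = finRotate n i ∧ x = Q j) ∨ (i = finRotate n j ∧ x = Q i) := by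
    rintro i j hij x ⟨hxi, hxj⟩
    obtain ⟨a, ha1, ha2, rfl⟩ := (hside i x).1 hxi
    obtain ⟨b, hb1, hb2, hab⟩ := (hside j _).1 hxj
    have hij' : (i : ℕ) < j := hij
    have h1 : t (i + 1) ≤ t j := hmono.monotone (by omega)
    have hbm : b ≤ m := hb2.trans (htn ▸ hmono.monotone (by omega))
    have ham : a < m := (ha2.trans h1).trans_lt (htm j j.2)
    have ha0 : 0 ≤ a := (htnn i).trans ha1
    rcases hbm.lt_or_eq with hbm | rfl
    · left
      have hab' := hw.polyPath_injOn hB ha0 ham ((htnn j).trans hb1) hbm hab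
      have h2 : t (i + 1) = t j := by linarith
      have h3 : (i : ℕ) + 1 = j := hmono.injective h2
      refine ⟨?_, ?_⟩
      · rw [finRotate_eq hn]
        ext
        simp only
        rw [h3, Nat.mod_eq_of_lt j.2]
      · rw [hQ, ← h2]
        congr 1
        linarith
    · right
      rw [hper] at hab
      have hab' := hw.polyPath_injOn hB ha0 ham le_rfl (by exact_mod_cast hw.pos_m) hab
      have h2 : t i = t 0 := by
        have := htnn i
        linarith
      have h3 : (i : ℕ) = 0 := hmono.injective h2
      have h4 : t n ≤ t (j + 1) := by rw [htn]; exact hb2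
      have h5 : n ≤ j + 1 := hmono.le_iff_le.1 h4
      refine ⟨?_, ?_⟩
      · rw [finRotate_eq hn]
        ext
        simp only
        rw [show (j : ℕ) + 1 = n by omega, Nat.mod_self, h3]
      · rw [hQ, hab', h2, ht0]
  refine ⟨Q, ⟨fun i j h => ?_, fun i j hij x hx => ?_⟩, ?_⟩
  · have h1 := hw.polyPath_injOn hB (htnn i) (htm i i.2) (htnn j) (htm j j.2) h
    exact Fin.ext (hmono.injective h1)
  · rcases lt_or_gt_of_ne hij with h | h
    · exact hadj i j h x hx
    · exact (hadj j i h x hx.symm).symm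
  · ext x
    simp only [Polygon.boundary, mem_iUnion]
    constructor
    · rintro ⟨i, hi⟩
      obtain ⟨s, h1, h2, rfl⟩ := (hside i x).1 hi
      obtain ⟨j, hj1, hj2⟩ := hpiece i i.2
      refine ⟨j, ?_⟩
      have := polyPath_mem_segment w (j := j) (a := j) (b := j + 1) le_rfl le_rfl (hj1.trans h1)
        (h2.trans hj2)
      rwa [polyPath_natCast, ← Nat.cast_succ, polyPath_natCast] at this
    · rintro ⟨j, hj⟩
      have hj' : x ∈ segment ℝ (w (j % m)) (w (j % m + 1)) := by
        rwa [hw.mod, ← hw.mod (j % m + 1), Nat.mod_add_mod, hw.mod]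
      rw [← polyPath_natCast w (j % m), ← polyPath_natCast w (j % m + 1), Nat.cast_succ] at hj'
      obtain ⟨s, h1, h2, rfl⟩ := exists_polyPath_of_mem_segment w le_rfl le_rfl (by linarith) hj'
      have hs0 : t 0 ≤ s := by
        rw [ht0]
        exact (Nat.cast_nonneg _).trans h1
      have hsn : s ≤ t n := by
        rw [htn]
        refine h2.trans ?_
        exact_mod_cast Nat.mod_lt j hw.pos_m
      have hfind : ∀ N, 0 < N → s ≤ t N → ∃ i < N, t i ≤ s ∧ s ≤ t (i + 1) := by
        intro N
        induction N with
        | zero => intro h; exact absurd h (lt_irrefl _)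
        | succ N ih =>
          intro _ hN
          rcases le_total (t N) s with h | h
          · exact ⟨N, Nat.lt_succ_self N, h, hN⟩
          · rcases Nat.eq_zero_or_pos N with rfl | h0
            · exact ⟨0, by omega, hs0, hN⟩
            · obtain ⟨i, hi, h'⟩ := ih h0 h
              exact ⟨i, by omega, h'⟩
      obtain ⟨i, hi, h3, h4⟩ := hfind n hn hsn
      exact ⟨⟨i, hi⟩, (hside _ _).2 ⟨s, h3, h4, rfl⟩⟩

variable [FiniteDimensional ℝ V]

theorem ConvexCycle.frontier_eq_iUnion : frontier (convexHull ℝ (range w)) =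
    ⋃ j : ℕ, segment ℝ (w j) (w (j + 1)) := by
  have hm := hw.three_le
  have hY := hw.isSupportPolygon hB
  rw [← hw.range_shift, ← hY.eq_convexHull hB hw, hY.frontier_eq hB hw]
  ext x
  simp only [mem_iUnion, Finset.mem_range, exists_prop]
  constructor
  · rintro ⟨j, -, hj⟩
    exact ⟨j + 1, hj⟩
  · rintro ⟨j, hj⟩
    refine ⟨(j + m - 1) % m, Nat.mod_lt _ hw.pos_m, ?_⟩
    have e1 : w ((j + m - 1) % m + 1) = w j := by
      rw [← hw.mod, Nat.mod_add_mod, show j + m - 1 + 1 = j + m by omega, hw.mod, hw.periodic]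
    have e2 : w ((j + m - 1) % m + 1 + 1) = w (j + 1) := by
      rw [← hw.mod, add_assoc, Nat.mod_add_mod, show j + m - 1 + (1 + 1) = j + 1 + m by omega,
        hw.mod, hw.periodic]
    rwa [e1, e2]

end Construction

section Polygons

variable {V : Type*} [NormedAddCommGroup V] [NormedSpace ℝ V] [FiniteDimensional ℝ V]
  [MeasurableSpace V] [BorelSpace V] [Fact (finrank ℝ V = 2)] {ω : V [⋀^Fin 2]→ₗ[ℝ] ℝ}

/-- The convex hull of at most `n` points that are not collinear is the region of a simple
`n`-gon. -/
theorem exists_isSimple_region_eq (hω : ω ≠ 0) {n : ℕ} {u : Fin n → V}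
    (hne : (interior (convexHull ℝ (range u))).Nonempty) :
    ∃ Q : Polygon V n, IsSimple Q ∧ region Q = convexHull ℝ (range u) := by
  have hB := isAreaForm_bracket hω
  obtain ⟨m, w, hw, hsub, hhull⟩ := exists_convexCycle hω (finite_range u) hne
  have hmn : m ≤ n := hw.card_le hB (P := ⟨u⟩) hsub
  obtain ⟨Q, hQ, hQb⟩ := hw.exists_isSimple hB hmn
  refine ⟨Q, hQ, ?_⟩
  have hn : 0 < n := hw.pos_m.trans_le hmn
  refine region_eq_of_boundary_eq_frontier hn (convex_convexHull ℝ _)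
    ((finite_range u).isCompact_convexHull ℝ) ?_
  rw [hQb, ← hhull, hw.frontier_eq_iUnion hB]

end Polygons

/-! ### The isoperimetric inequality for polygons -/

section Isoperimetric

variable {V : Type*} [NormedAddCommGroup V] [NormedSpace ℝ V] {n : ℕ}

theorem IsSimple.side_ne_zero (hn : 2 ≤ n) {P : Polygon V n} (hP : IsSimple P) (i : Fin n) :
    P (finRotate n i) - P i ≠ 0 := by
  have := hP.vtx_ne (hn := by omega) hn i
  rw [vtx_fin, vtx_succ_fin] at this
  exact sub_ne_zero.2 this

theorem IsSimple.perimeter_pos (hn : 2 ≤ n) {P : Polygon V n} (hP : IsSimple P) :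
    0 < perimeter P :=
  Finset.sum_pos (fun i _ => norm_pos_iff.2 (hP.side_ne_zero hn i))
    ⟨⟨0, by omega⟩, Finset.mem_univ _⟩

theorem ConvexCycle.sum_shift {B : V →ₗ[ℝ] V →ₗ[ℝ] ℝ} {m : ℕ} {w : ℕ → V}
    (hw : ConvexCycle B m w) (F : V → V → ℝ) :
    ∑ j ∈ Finset.range m, F (w (j + 1)) (w (j + 1 + 1)) =
      ∑ j ∈ Finset.range m, F (w j) (w (j + 1)) := by
  have h1 := Finset.sum_range_succ (fun j => F (w j) (w (j + 1))) m
  have h2 := Finset.sum_range_succ' (fun j => F (w j) (w (j + 1))) m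
  have h3 : w m = w 0 := by rw [← hw.periodic 0, zero_add]
  have h4 : w (m + 1) = w (0 + 1) := by rw [add_comm, hw.periodic]
  simp only [h3, h4] at h1
  linarith

variable [FiniteDimensional ℝ V] [MeasurableSpace V] [BorelSpace V] [Fact (finrank ℝ V = 2)]
  {ω : V [⋀^Fin 2]→ₗ[ℝ] ℝ}

theorem area_scale (hω : ω ≠ 0) {s : ℝ} (hs : s ≠ 0) (P : Polygon V n) :
    area ω (scale s P) = s ^ 2 * area ω P := by
  have := isAddHaarMeasure_measure hω
  rw [area, region_scale hs, area, image_smul, measureReal_def, Measure.addHaar_smul,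
    ENNReal.toReal_mul, (Fact.out : finrank ℝ V = 2), ENNReal.toReal_ofReal (abs_nonneg _),
    abs_of_nonneg (sq_nonneg s), measureReal_def]

/-- A simple polygon can be scaled to any perimeter. -/
theorem IsSimple.exists_scale (hω : ω ≠ 0) (hn : 2 ≤ n) {P : Polygon V n} (hP : IsSimple P)
    {L : ℝ} (hL : 0 < L) : ∃ Q : Polygon V n, IsSimple Q ∧ perimeter Q = L ∧
      area ω Q = (L / perimeter P) ^ 2 * area ω P := by
  have hp := hP.perimeter_pos hn
  have hs : 0 < L / perimeter P := div_pos hL hp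
  refine ⟨scale (L / perimeter P) P, isSimple_scale hs.ne' hP, ?_, area_scale hω hs.ne' P⟩
  rw [perimeter_scale hs.le, div_mul_cancel₀ _ hp.ne']

theorem area_le_hull (hω : ω ≠ 0) (hn : 0 < n) (P : Polygon V n) :
    area ω P ≤ ω.measure.real (convexHull ℝ (range P.vertices)) := by
  have := isAddHaarMeasure_measure hω
  exact measureReal_mono (region_subset_hull hn P) (isCompact_hull P).measure_lt_top.ne

/-- The frontier of a convex set is a null set, so a hull without interior has measure zero. -/
theorem nonempty_interior_hull_of_area_pos (hω : ω ≠ 0) (hn : 0 < n) {P : Polygon V n}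
    (h : 0 < area ω P) : (interior (convexHull ℝ (range P.vertices))).Nonempty := by
  have := isAddHaarMeasure_measure hω
  by_contra hne
  have hf : frontier (convexHull ℝ (range P.vertices)) = convexHull ℝ (range P.vertices) := by
    rw [(isCompact_hull P).isClosed.frontier_eq, not_nonempty_iff_eq_empty.1 hne, sdiff_empty]
  have h0 := (convex_convexHull ℝ (range P.vertices)).addHaar_frontier ω.measure
  rw [hf] at h0
  have h1 := area_le_hull hω hn P
  rw [measureReal_def, h0, ENNReal.toReal_zero] at h1
  exact absurd h (not_lt.2 h1)

theorem measure_real_pos (hω : ω ≠ 0) {M : Set V} (hM : IsCompact M)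
    (hne : (interior M).Nonempty) : 0 < ω.measure.real M := by
  have := isAddHaarMeasure_measure hω
  exact ENNReal.toReal_pos (ω.measure.measure_pos_of_nonempty_interior hne).ne' hM.measure_lt_top.ne

/-- The part of the interior of the hull missed by the closed region is open and null, hence empty;
and the hull is the closure of its interior. -/
theorem region_eq_hull_of_area_eq (hω : ω ≠ 0) (hn : 0 < n) {P : Polygon V n}
    (hne : (interior (convexHull ℝ (range P.vertices))).Nonempty)
    (h : ω.measure.real (convexHull ℝ (range P.vertices)) ≤ area ω P) :
    region P = convexHull ℝ (range P.vertices) := by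
  have := isAddHaarMeasure_measure hω
  set H := convexHull ℝ (range P.vertices) with hH
  have hHc : IsCompact H := isCompact_hull P
  have hHconv : Convex ℝ H := convex_convexHull ℝ _
  have hsub : region P ⊆ H := region_subset_hull hn P
  refine hsub.antisymm ?_
  have hopen : IsOpen (interior H \ region P) := isOpen_interior.sdiff (isClosed_region P)
  have hzero : ω.measure (H \ region P) = 0 := by
    have h1 := measureReal_sdiff (μ := ω.measure) hsub (isClosed_region P).measurableSet
      hHc.measure_lt_top.ne
    have h2 : ω.measure.real (H \ region P) = 0 := by
      refine le_antisymm ?_ measureReal_nonneg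
      rw [h1]
      exact sub_nonpos.2 h
    exact (measureReal_eq_zero_iff
      (measure_ne_top_of_subset sdiff_subset hHc.measure_lt_top.ne)).1 h2
  have hempty : interior H \ region P = ∅ :=
    hopen.eq_empty_of_measure_zero (measure_mono_null (sdiff_subset_sdiff_left interior_subset) hzero)
  have h1 : interior H ⊆ region P := sdiff_eq_empty.1 hempty
  have h2 : closure (interior H) ⊆ region P := closure_minimal h1 (isClosed_region P)
  rwa [hHconv.closure_interior_eq_closure_of_nonempty_interior hne, hHc.isClosed.closure_eq] at h2

/-- A triangle with superfluous vertices. It guarantees that a polygon of maximal area has positive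
area, and so a hull with interior. -/
theorem exists_isSimple_area_pos (hω : ω ≠ 0) (hn : 3 ≤ n) :
    ∃ Q : Polygon V n, IsSimple Q ∧ 0 < area ω Q := by
  let b : Basis (Fin 2) ℝ V := finBasisOfFinrankEq ℝ V Fact.out
  let u : Fin n → V := fun i => if (i : ℕ) = 0 then 0 else if (i : ℕ) = 1 then b 0 else b 1
  have hu : insert 0 (range b) ⊆ range u := by
    rintro _ (rfl | ⟨k, rfl⟩)
    · exact ⟨⟨0, by omega⟩, by simp [u]⟩
    · fin_cases k
      · exact ⟨⟨1, by omega⟩, by simp [u]⟩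
      · exact ⟨⟨2, by omega⟩, by simp [u]⟩
  have hne : (interior (convexHull ℝ (range u))).Nonempty := by
    rw [interior_convexHull_nonempty_iff_affineSpan_eq_top, eq_top_iff]
    refine le_trans (fun x _ => ?_) (affineSpan_mono ℝ hu)
    rw [← SetLike.mem_coe, affineSpan_insert_zero, b.span_eq]
    trivial
  obtain ⟨Q, hQ, hr⟩ := exists_isSimple_region_eq hω hne
  refine ⟨Q, hQ, ?_⟩
  rw [area, hr]
  exact measure_real_pos hω ((finite_range u).isCompact_convexHull ℝ) hne

/-- A simple polygon whose region has supporting lines parallel to the sides of `w`, at distance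
`ρ` from `c` in the norm, is circumscribed about an antidisc. -/
theorem IsSimple.isCircumscribed (hω : ω ≠ 0) (hn : 3 ≤ n) {m : ℕ} {w Y : ℕ → V}
    (hw : ConvexCycle (bracket ω) m w) {P : Polygon V n} (hP : IsSimple P) {c : V} {ρ : ℝ}
    (hρ : 0 < ρ)
    (hY : IsSupportPolygon (bracket ω) m w
      (fun k => bracket ω c (edge w k) + ρ * ‖edge w k‖) Y)
    (hr : region P = supportBody (bracket ω) w
      (fun k => bracket ω c (edge w k) + ρ * ‖edge w k‖)) :
    IsCircumscribed P (antidisc ω c ρ) := by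
  have hB := isAreaForm_bracket hω
  have hn0 : 0 < n := by omega
  have hsub : antidisc ω c ρ ⊆ region P := by
    intro x hx
    rw [hr]
    intro k
    have := bracket_le_of_mem_antidisc hω hx (edge w k)
    rw [map_sub, LinearMap.sub_apply] at this
    linarith
  have hne : (interior (region P)).Nonempty :=
    ⟨c, interior_mono hsub (center_mem_interior_antidisc ω c hρ)⟩
  have hconv : Convex ℝ (region P) := by
    rw [hr]
    exact convex_supportBody
  refine ⟨hP, hconv, hsub, fun i => ?_⟩
  have hb := hP.boundary_subset_frontier hω hn hconv (isCompact_region hn0 P) hne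
    (frontier_region_subset P) (boundary_subset_region P)
  set a := P i with ha
  set d := P (finRotate n i) with hd
  -- The midpoint of side `i` is a frontier point, so it attains some support number; a linear
  -- functional bounded on both ends by its value at the midpoint is constant on the side.
  have hmid : (1 / 2 : ℝ) • a + (1 / 2 : ℝ) • d ∈ P.boundary ℝ := by
    refine edgeSet_subset_boundary P i ?_
    rw [edgeSet_eq_segment]
    exact ⟨1 / 2, 1 / 2, by norm_num, by norm_num, by norm_num, rfl⟩
  have hmid' := hb hmid
  rw [hr] at hmid'
  obtain ⟨j, -, hj⟩ := hY.exists_eq_of_mem_frontier hB hw hmid'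
  set f := edge w (j + 1) with hf
  have h1 : bracket ω a f ≤ bracket ω c f + ρ * ‖f‖ := by
    have : a ∈ region P := boundary_subset_region P (vertex_mem_boundary P i)
    rw [hr] at this
    exact this (j + 1)
  have h2 : bracket ω d f ≤ bracket ω c f + ρ * ‖f‖ := by
    have : d ∈ region P := boundary_subset_region P (vertex_mem_boundary P _)
    rw [hr] at this
    exact this (j + 1)
  simp only [map_add, map_smul, LinearMap.add_apply, LinearMap.smul_apply, smul_eq_mul] at hj
  have h3 : bracket ω a f = bracket ω c f + ρ * ‖f‖ := by linarith
  have h4 : bracket ω d f = bracket ω c f + ρ * ‖f‖ := by linarith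
  have hf0 : f ≠ 0 := hw.edge_ne_zero hB (j + 1)
  obtain ⟨μ, hμ⟩ := hB.exists_smul_of_eq_zero hf0 (x := d - a)
    (by rw [map_sub, LinearMap.sub_apply, h3, h4, sub_self])
  have hμ0 : μ ≠ 0 := by
    rintro rfl
    rw [zero_smul] at hμ
    exact hP.side_ne_zero (by omega) i hμ
  have hspan : Submodule.span ℝ {d - a} = Submodule.span ℝ {f} := by
    rw [hμ]
    exact Submodule.span_singleton_smul_eq (IsUnit.mk0 μ hμ0) f
  rw [sideLine, ← ha, ← hd, hspan]
  refine isSupportingLine_of_bracket_eq hω hρ hf0 ?_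
  rw [map_sub, LinearMap.sub_apply, h3]
  ring

/-- The isoperimetric inequality for the polygon `P`. The constant `A` is the area of the polygon
circumscribed about the unit antidisc with the outer normals of the convex hull of `P`. -/
theorem exists_isoperimetric (hω : ω ≠ 0) (hn : 3 ≤ n) {P : Polygon V n}
    (hP : Function.Injective P.vertices)
    (hne : (interior (convexHull ℝ (range P.vertices))).Nonempty) :
    ∃ A : ℝ, 0 < A ∧
      4 * ω.measure.real (convexHull ℝ (range P.vertices)) * A ≤ perimeter P ^ 2 ∧
      (∀ (c : V) (ρ : ℝ), 0 < ρ → ∃ Q : Polygon V n,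
        IsCircumscribed Q (antidisc ω c ρ) ∧ area ω Q = ρ ^ 2 * A) ∧
      (perimeter P ^ 2 ≤ 4 * ω.measure.real (convexHull ℝ (range P.vertices)) * A →
        IsSimple P → region P = convexHull ℝ (range P.vertices) →
        ∃ (c : V) (t : ℝ), 0 < t ∧ IsCircumscribed P (antidisc ω c t)) := by
  have hB := isAreaForm_bracket hω
  have hn0 : 0 < n := by omega
  obtain ⟨m, w, hw, hsub, hhull⟩ := exists_convexCycle hω (finite_range P.vertices) hne
  have hmn : m ≤ n := hw.card_le hB hsub
  obtain ⟨Y, hY⟩ := hw.exists_isSupportPolygon_norm hB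
  have hpos : ∀ k, 0 < ‖edge w k‖ := fun k => norm_pos_iff.2 (hw.edge_ne_zero hB k)
  have hper := hw.perimeter_le hB hn0 hP hsub
  have hw' := hw.isSupportPolygon hB
  have hH := hw'.eq_convexHull hB hw
  rw [hw.range_shift, hhull] at hH
  have hne' := hne
  rw [← hH] at hne'
  have hAH := hw'.measure_eq hω hw hne'
  rw [hw.sum_shift fun x y => bracket ω x y] at hAH
  have hcirc : ∀ (c : V) (ρ : ℝ), 0 < ρ →
      (interior (supportBody (bracket ω) w
        (fun k => bracket ω c (edge w k) + ρ * ‖edge w k‖))).Nonempty := by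
    intro c ρ hρ
    refine ⟨c, interior_mono (fun x hx k => ?_) (center_mem_interior_antidisc ω c hρ)⟩
    have := bracket_le_of_mem_antidisc hω hx (edge w k)
    rw [map_sub, LinearMap.sub_apply] at this
    linarith
  have hsb : ∀ (c : V) (ρ : ℝ), 0 < ρ → ω.measure.real (supportBody (bracket ω) w
      (fun k => bracket ω c (edge w k) + ρ * ‖edge w k‖)) =
        ρ ^ 2 * ((∑ j ∈ Finset.range m, bracket ω (Y j) (Y (j + 1))) / 2) := by
    intro c ρ hρ
    rw [(hY.homothety c hρ.le).measure_eq hω hw (hcirc c ρ hρ), ← mul_div_assoc]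
    congr 1
    have e : ∀ j, bracket ω (c + ρ • Y j) (c + ρ • Y (j + 1)) =
        ρ ^ 2 * bracket ω (Y j) (Y (j + 1)) +
          ρ * (bracket ω c (Y (j + 1)) - bracket ω c (Y j)) := by
      intro j
      simp only [map_add, map_smul, LinearMap.add_apply, LinearMap.smul_apply, smul_eq_mul,
        hB.self]
      rw [hB.swap (Y j) c]
      ring
    have h0 : Y m = Y 0 := by rw [← hY.periodic 0, zero_add]
    rw [Finset.sum_congr rfl fun j _ => e j, Finset.sum_add_distrib, ← Finset.mul_sum,
      ← Finset.mul_sum, Finset.sum_range_sub (fun j => bracket ω c (Y j)), h0, sub_self, mul_zero,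
      add_zero]
  have hA : 0 < (∑ j ∈ Finset.range m, bracket ω (Y j) (Y (j + 1))) / 2 := by
    have h1 := measure_real_pos hω ((hY.homothety 0 zero_le_one).isCompact hB hw)
      (hcirc 0 1 one_pos)
    rwa [hsb 0 1 one_pos, one_pow, one_mul] at h1
  -- The support numbers of `Y` are the side lengths of `w`, so `L` in Minkowski's inequality is the
  -- perimeter of `w`; the two shoelace sums are twice the areas, whence the factor `4`.
  obtain ⟨hmink, heq⟩ := hY.minkowski hB hw hpos (by linarith)
  have hsum0 : 0 ≤ ∑ j ∈ Finset.range m, ‖edge w j‖ := Finset.sum_nonneg fun _ _ => norm_nonneg _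
  rw [hH] at hAH
  refine ⟨_, hA, ?_, fun c ρ hρ => ?_, fun h hPs hPr => ?_⟩
  · rw [hAH]
    have := pow_le_pow_left₀ hsum0 hper 2
    linarith
  · have hZ := hY.homothety c hρ.le
    -- Some of the points may coincide and they repeat with period `m`; only their hull matters, and
    -- `exists_isSimple_region_eq` supplies a simple `n`-gon around it.
    let u : Fin n → V := fun i => c + ρ • Y i
    have hu : range u = range (fun j => c + ρ • Y j) := by
      apply subset_antisymm
      · rintro _ ⟨i, rfl⟩
        exact ⟨i, rfl⟩
      · rintro _ ⟨j, rfl⟩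
        refine ⟨⟨j % m, (Nat.mod_lt j hw.pos_m).trans_le hmn⟩, ?_⟩
        simp only [u]
        rw [hY.vertex_mod]
    have hK := hZ.eq_convexHull hB hw
    rw [← hu] at hK
    have hneK := hcirc c ρ hρ
    rw [hK] at hneK
    obtain ⟨Q, hQ, hQr⟩ := exists_isSimple_region_eq hω hneK
    rw [← hK] at hQr
    refine ⟨Q, hQ.isCircumscribed hω hn hw hρ hZ hQr, ?_⟩
    rw [area, hQr, hsb c ρ hρ]
  · have h1 := pow_le_pow_left₀ hsum0 hper 2
    rw [hAH] at h
    obtain ⟨c, t, ht, hct⟩ := heq (by linarith)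
    refine ⟨c, t, ht, hPs.isCircumscribed hω hn hw ht (hY.homothety c ht.le) ?_⟩
    rw [hPr, (hY.homothety c ht.le).eq_convexHull hB hw, ← hhull, ← hw.range_shift, funext hct]

/-- Maximality is used twice: against the circumscribed polygon with the normals of the hull of `P`,
which forces equality in the isoperimetric inequality, and against any polygon circumscribed about
the resulting antidisc, which gives minimality. -/
theorem isZenodorus_of_maximal (hω : ω ≠ 0) (hn : 3 ≤ n) {P : Polygon V n} (hP : IsSimple P)
    (hmax : ∀ Q : Polygon V n, IsSimple Q → perimeter Q = perimeter P → area ω Q ≤ area ω P) :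
    IsZenodorus ω P := by
  have hn0 : 0 < n := by omega
  have hL := hP.perimeter_pos (by omega)
  have hAP : 0 < area ω P := by
    obtain ⟨Q, hQ, hQA⟩ := exists_isSimple_area_pos (V := V) hω hn
    obtain ⟨R, hR, hRp, hRA⟩ := hQ.exists_scale hω (by omega) hL
    have hQp := hQ.perimeter_pos (by omega)
    refine lt_of_lt_of_le ?_ (hmax R hR hRp)
    rw [hRA]
    positivity
  have hne := nonempty_interior_hull_of_area_pos hω hn0 hAP
  obtain ⟨A, hA, hiso, hex, heq⟩ := exists_isoperimetric hω hn hP.1 hne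
  have hle := area_le_hull hω hn0 P
  -- The comparison polygon about the unit antidisc has area `A`, hence perimeter `2 * A`; scaled to
  -- the perimeter `L` of `P` its area is `L ^ 2 / (4 * A)`.
  have hkey : perimeter P ^ 2 ≤ 4 * area ω P * A := by
    obtain ⟨Q, hQ, hQA⟩ := hex 0 1 one_pos
    obtain ⟨R, hR, hRp, hRA⟩ := hQ.isSimple.exists_scale hω (by omega) hL
    have h1 := hmax R hR hRp
    have h2 := hQ.area_eq hω hn one_pos
    rw [hQA] at h2
    have h3 : perimeter Q = 2 * A := by linarith
    rw [hRA, hQA, h3, one_pow, one_mul, div_pow, div_mul_eq_mul_div, div_le_iff₀ (by positivity)]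
      at h1
    have h4 : A * perimeter P ^ 2 ≤ A * (4 * area ω P * A) := by linarith
    exact le_of_mul_le_mul_left h4 hA
  have hge : ω.measure.real (convexHull ℝ (range P.vertices)) ≤ area ω P := by
    refine le_of_mul_le_mul_right ?_ hA
    linarith
  have hr := region_eq_hull_of_area_eq hω hn0 hne hge
  have h5 : perimeter P ^ 2 ≤ 4 * ω.measure.real (convexHull ℝ (range P.vertices)) * A :=
    hkey.trans (mul_le_mul_of_nonneg_right (by linarith) hA.le)
  obtain ⟨c, t, ht, hc⟩ := heq h5 hP hr
  refine ⟨c, t, ht, hc, fun Q hQ => ?_⟩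
  have h6 := hc.area_eq hω hn ht
  have h7 := hQ.area_eq hω hn ht
  have hQp := hQ.isSimple.perimeter_pos (by omega)
  obtain ⟨R, hR, hRp, hRA⟩ := hQ.isSimple.exists_scale hω (by omega) hL
  have h8 := hmax R hR hRp
  rw [hRA, h6, h7, div_pow, div_mul_eq_mul_div, div_le_iff₀ (by positivity)] at h8
  -- About one antidisc area is `t / 2` times perimeter, so scaling `Q` to the perimeter of `P` and
  -- using maximality bounds the perimeter of `Q` from below.
  have h9 : perimeter P ≤ perimeter Q := by
    have : (t * perimeter P * perimeter Q / 2) * perimeter P ≤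
        (t * perimeter P * perimeter Q / 2) * perimeter Q := by linarith
    exact le_of_mul_le_mul_left this (by positivity)
  rw [h6, h7]
  exact div_le_div_of_nonneg_right (mul_le_mul_of_nonneg_left h9 ht.le) (by norm_num)

theorem IsZenodorus.isSimple {P : Polygon V n} (hP : IsZenodorus ω P) : IsSimple P := by
  obtain ⟨_, _, _, hP, _⟩ := hP
  exact hP.isSimple

/-- With `A` the constant of `Q` and `L` the common perimeter, minimality of `P` gives `area P ≤ ρ ^
2 * A`. So `area Q * area P ≤ ρ ^ 2 * (area Q * A) ≤ ρ ^ 2 * L ^ 2 / 4 = (area P) ^ 2`. -/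
theorem IsZenodorus.area_le (hω : ω ≠ 0) (hn : 3 ≤ n) {P Q : Polygon V n} (hP : IsZenodorus ω P)
    (hQ : IsSimple Q) (hPQ : perimeter Q = perimeter P) : area ω Q ≤ area ω P := by
  have hn0 : 0 < n := by omega
  obtain ⟨c, ρ, hρ, hPc, hmin⟩ := hP
  have hL := hPc.isSimple.perimeter_pos (by omega)
  have hAP := hPc.area_eq hω hn hρ
  have hAP0 : 0 < area ω P := by
    rw [hAP]
    positivity
  rcases le_or_gt (area ω Q) 0 with h0 | h0
  · exact h0.trans hAP0.le
  obtain ⟨A, hA, hiso, hex, -⟩ :=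
    exists_isoperimetric hω hn hQ.1 (nonempty_interior_hull_of_area_pos hω hn0 h0)
  obtain ⟨K, hK, hKA⟩ := hex c ρ hρ
  have h1 := hmin K hK
  have h2 := area_le_hull hω hn0 Q
  rw [hKA] at h1
  have h3 : 4 * area ω Q * A ≤ perimeter P ^ 2 := by
    rw [← hPQ]
    refine le_trans ?_ hiso
    exact mul_le_mul_of_nonneg_right (by linarith) hA.le
  have h4 : area ω P ^ 2 = ρ ^ 2 * perimeter P ^ 2 / 4 := by
    rw [hAP]
    ring
  have h5 : area ω Q * area ω P ≤ area ω Q * (ρ ^ 2 * A) := mul_le_mul_of_nonneg_left h1 h0.le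
  have h6 : ρ ^ 2 * (4 * area ω Q * A) ≤ ρ ^ 2 * perimeter P ^ 2 :=
    mul_le_mul_of_nonneg_left h3 (sq_nonneg ρ)
  refine le_of_mul_le_mul_right ?_ hAP0
  nlinarith

end Isoperimetric

end MinkowskiPlane

end

theorem corollary10p6 {V : Type*} [NormedAddCommGroup V] [NormedSpace ℝ V]
    [MeasurableSpace V] [BorelSpace V] [FiniteDimensional ℝ V] [Fact (Module.finrank ℝ V = 2)]
    (ω : V [⋀^Fin 2]→ₗ[ℝ] ℝ) (hω : ω ≠ 0) (n : ℕ) (hn : 3 ≤ n) (L : ℝ) :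
    {P : Polygon V n | MinkowskiPlane.IsSimple P ∧ MinkowskiPlane.perimeter P = L ∧
      ∀ Q : Polygon V n, MinkowskiPlane.IsSimple Q → MinkowskiPlane.perimeter Q = L →
        MinkowskiPlane.area ω Q ≤ MinkowskiPlane.area ω P} =
    {P : Polygon V n | MinkowskiPlane.IsZenodorus ω P ∧ MinkowskiPlane.perimeter P = L} := by
  ext P
  constructor
  · rintro ⟨hP, rfl, hmax⟩
    exact ⟨MinkowskiPlane.isZenodorus_of_maximal hω hn hP hmax, rfl⟩
  · rintro ⟨hP, rfl⟩
    exact ⟨hP.isSimple, rfl, fun Q hQ hQp => hP.area_le hω hn hQ hQp⟩
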